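/- Let $n\ge 3$, write $\xi=(\xi',\xi_n)\in\mathbb{R}^{n-1}\times\mathbb{R}$, let $\varphi,\psi\in C_c^\infty([\tfrac12,2])$, and let $\hat f$ be the Fourier transform of $f\in L^2(\mathbb{R}^n)$, normalized by $\hat f(\xi)=\int f(x)e^{-2\pi i x\cdot\xi}\,dx$ for $f\in L^1\cap L^2$. Put $r_+^a=r^a$ for $r>0$ and $r_+^a=0$ for $r\le 0$. For $f,g\in L^2(\mathbb{R}^n)$, $R,t>0$ and $j\in\mathbb{N}$ define \[\mathcal{T}^\lambda_R(f,g)(x)=\int_{\mathbb{R}^{2n}}\Big(1-\frac{|\xi'|^2}{R^2\xi_n^2}-\frac{|\eta'|^2}{R^2\eta_n^2}\Big)_+^{\lambda}\varphi(\xi_n)\varphi(\eta_n)\hat f(\xi)\hat g(\eta)e^{2\pi i x\cdot(\xi+\eta)}\,d\xi\,d\eta,\qquad \mathcal{T}^\lambda_*(f,g)(x)=\sup_{R>0}|\mathcal{T}^\lambda_R(f,g)(x)|,\] \[T^\nu_tf(x)=\int_{\mathbb{R}^n}\Big(1-\frac{|\xi'|^2}{t^2\xi_n^2}\Big)_+^{\nu}\varphi(\xi_n)\hat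 f(\xi)e^{2\pi i x\cdot\xi}\,d\xi,\] \[S^{R,t}_{j,\mu}f(x)=\int_{\mathbb{R}^n}\psi\Big(2^j\Big(1-\frac{|\xi'|^2}{R^2\xi_n^2}\Big)\Big)\varphi(\xi_n)\Big(1-\frac{|\xi'|^2}{R^2\xi_n^2}-t^2\Big)_+^{\mu-1}\hat f(\xi)e^{2\pi i x\cdot\xi}\,d\xi.\] Then the following hold. (1) For every $\lambda>0$ there is a constant $C=C(n,\varphi,\lambda)<\infty$ such that for all $f,g\in L^2(\mathbb{R}^n)$, $\mathcal{T}^\lambda_*(f,g)$ is measurable and \[\|\mathcal{T}^\lambda_*(f,g)\|_{L^1(\mathbb{R}^n)}\le C\|f\|_{L^2(\mathbb{R}^n)}\|g\|_{L^2(\mathbb{R}^n)}.\] (2) For every $\nu>-\tfrac12$ there is a constant $C=C(n,\varphi,\nu)<\infty$ such that for all integers $j\ge2$ and all $f\in L^2(\mathbb{R}^n)$ the maximal function below is measurable and \[\Big\|\sup_{R>0}\Big(\frac{1}{R\sqrt{2^{1-j}}}\int_0^{R\sqrt{2^{1-j}}}|T^\nu_tf|^2\,dt\Big)^{1/2}\Big\|_{L^2(\mathbb{R}^n)}\le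 C\|f\|_{L^2(\mathbb{R}^n)}.\] (3) For every $\mu>\tfrac12$ and $\nu>-\tfrac34$ there is a constant $C=C(n,\varphi,\psi,\mu,\nu)<\infty$ such that for all integers $j\ge2$ and all $f\in L^2(\mathbb{R}^n)$ the maximal function below is measurable and \[\Big\|\sup_{R>0}\Big(\int_0^{\sqrt{2^{1-j}}}|S^{R,t}_{j,\mu}f\;t^{2\nu+1}|^2\,dt\Big)^{1/2}\Big\|_{L^2(\mathbb{R}^n)}\le C\,2^{j/4}\,2^{-j(\mu+\nu)}\|f\|_{L^2(\mathbb{R}^n)}.\] -/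

import Mathlib

open MeasureTheory Set
open scoped ENNReal NNReal ContDiff FourierTransform

noncomputable section

/-- Frequency and physical space `ℝⁿ = ℝ^{n-1} × ℝ` with `n = d + 1`; the last coordinate is the
distinguished one. -/
abbrev ConeSpace (d : ℕ) : Type := EuclideanSpace ℝ (Fin (d + 1))

/-- `L²(ℝⁿ)` for `n = d + 1`. -/
abbrev ConeL2 (d : ℕ) : Type := Lp ℂ 2 (volume : Measure (ConeSpace d))

/-- Membership in `C_c^∞([1/2, 2])`. -/
def IsConeCutoff (φ : ℝ → ℂ) : Prop :=
  ContDiff ℝ ∞ φ ∧ tsupport φ ⊆ Icc (1 / 2) 2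

/-- The truncated power `r_+^a`, equal to `r^a` for `r > 0` and to `0` for `r ≤ 0`
(so that `r_+^0` is the indicator function of `r > 0`). -/
def truncPow (r a : ℝ) : ℝ := if 0 < r then r ^ a else 0

/-- `|ξ'|² / ξ_n²` for `ξ = (ξ', ξ_n)`. -/
def slopeSq {d : ℕ} (ξ : ConeSpace d) : ℝ :=
  (∑ i : Fin d, ξ i.castSucc ^ 2) / ξ (Fin.last d) ^ 2

/-- The character `e^{2πi x·ξ}`. -/
def coneChar {d : ℕ} (x ξ : ConeSpace d) : ℂ :=
  Complex.exp (2 * Real.pi * Complex.I * (inner ℝ x ξ : ℝ))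

/-- The bilinear cone multiplier operator `𝒯^λ_R(f, g)(x)`; `𝓕` is the Fourier transform
of `L²(ℝⁿ)`. -/
def bilinearCone {d : ℕ} (φ : ℝ → ℂ) (lam R : ℝ) (f g : ConeL2 d) (x : ConeSpace d) : ℂ :=
  ∫ p : ConeSpace d × ConeSpace d,
    (truncPow (1 - slopeSq p.1 / R ^ 2 - slopeSq p.2 / R ^ 2) lam : ℂ)
      * φ (p.1 (Fin.last d)) * φ (p.2 (Fin.last d))
      * (𝓕 f : ConeL2 d) p.1 * (𝓕 g : ConeL2 d) p.2 * coneChar x (p.1 + p.2)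

/-- The maximal bilinear cone operator `𝒯^λ_*(f, g)(x) = sup_{R > 0} |𝒯^λ_R(f, g)(x)|`. -/
def maximalBilinearCone {d : ℕ} (φ : ℝ → ℂ) (lam : ℝ) (f g : ConeL2 d) (x : ConeSpace d) :
    ℝ≥0∞ :=
  ⨆ R ∈ Ioi (0 : ℝ), ‖bilinearCone φ lam R f g x‖ₑ

/-- The linear cone multiplier operator `T^ν_t f(x)`. -/
def linearCone {d : ℕ} (φ : ℝ → ℂ) (ν t : ℝ) (f : ConeL2 d) (x : ConeSpace d) : ℂ :=
  ∫ ξ : ConeSpace d,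
    (truncPow (1 - slopeSq ξ / t ^ 2) ν : ℂ) * φ (ξ (Fin.last d))
      * (𝓕 f : ConeL2 d) ξ * coneChar x ξ

/-- `sup_{R > 0} ( (1 / (R √(2^{1-j}))) ∫_0^{R √(2^{1-j})} |T^ν_t f(x)|² dt )^{1/2}`. -/
def averagedMaximal {d : ℕ} (φ : ℝ → ℂ) (ν : ℝ) (j : ℕ) (f : ConeL2 d) (x : ConeSpace d) :
    ℝ≥0∞ :=
  ⨆ R ∈ Ioi (0 : ℝ),
    ((ENNReal.ofReal (R * √((2 : ℝ) ^ (1 - (j : ℝ)))))⁻¹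
      * ∫⁻ t in Ioc (0 : ℝ) (R * √((2 : ℝ) ^ (1 - (j : ℝ)))),
          ‖linearCone φ ν t f x‖ₑ ^ 2) ^ (1 / 2 : ℝ)

/-- The operator `S^{R,t}_{j,μ} f(x)`. -/
def localizedCone {d : ℕ} (φ ψ : ℝ → ℂ) (j : ℕ) (μ R t : ℝ) (f : ConeL2 d) (x : ConeSpace d) :
    ℂ :=
  ∫ ξ : ConeSpace d,
    ψ ((2 : ℝ) ^ j * (1 - slopeSq ξ / R ^ 2)) * φ (ξ (Fin.last d))
      * (truncPow (1 - slopeSq ξ / R ^ 2 - t ^ 2) (μ - 1) : ℂ)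
      * (𝓕 f : ConeL2 d) ξ * coneChar x ξ

/-- `sup_{R > 0} ( ∫_0^{√(2^{1-j})} |S^{R,t}_{j,μ} f(x) t^{2ν+1}|² dt )^{1/2}`. -/
def maximalSquare {d : ℕ} (φ ψ : ℝ → ℂ) (j : ℕ) (μ ν : ℝ) (f : ConeL2 d) (x : ConeSpace d) :
    ℝ≥0∞ :=
  ⨆ R ∈ Ioi (0 : ℝ),
    (∫⁻ t in Ioc (0 : ℝ) (√((2 : ℝ) ^ (1 - (j : ℝ)))),
        ‖localizedCone φ ψ j μ R t f x * ((t ^ (2 * ν + 1) : ℝ) : ℂ)‖ₑ ^ 2) ^ (1 / 2 : ℝ)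

end

noncomputable section

/-! ### Characters and inverse Fourier integrals -/

variable {d : ℕ}

/-! Write r = |ξ'|²/ξ_n². All three bounds reduce to Plancherel's inequality plus one maximal
theorem, for Gaussian averages.

Linear averages (2). With w = t² the symbol of T^ν_t is φ(ξ_n)(1-u)_+^ν at u = r/w. Since |ξ'|² =
rξ_n², the Gaussian e^{-π|ξ'|²/w} equals e^{-bu} with b = πξ_n², which lies in [π/4, 4π] on the
support of φ. The difference (1-u)_+^ν - e^{-bu} is O(u) at 0, decays exponentially, and has a
square-integrable singularity because 2ν > -1. Its square is therefore integrable against du/u,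
uniformly in b. As dw/w is dilation invariant, Plancherel controls the square function of the
difference, and the Gaussian part is controlled by its maximal function. The two together form
`coneMajorant`, which depends neither on R nor on j and has integral at most C‖f‖².

Gaussian maximal function. After linearization and duality the claim is ∫|∑ γ_{τ_k} ǔ_k|² ≤ C
∫(∑|u_k|)². The kernels are positive, and the kernel of γ_σγ_τ is dominated by the sum of those of
γ_σ² and γ_τ². With Cauchy–Schwarz, the left side at τ is at most c times the square root of the
left side at 2τ, where c² is a multiple of the right side. An a priori bound uniform under doubling
lets this inequality close on itself (`heatAdj_le`).

Bilinear operator (1). With λ = 2α + 1 and α > -1/2, the beta integral writes (1-p-q)_+^λ as a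
multiple of ∫ (1-v-p)_+^α (v-q)_+^α dv. This separates the variables, and Cauchy–Schwarz in v bounds
the operator pointwise by weighted averages of linear ones, hence by the geometric mean of two
copies of `coneMajorant`. Cauchy–Schwarz in x finishes.

Square function (3). Put δ = 2^{-j}, a = R². The factor ψ((1-r/a)/δ) is a bump of width δ, so a
local Sobolev inequality in the dilation a replaces the supremum by an energy integral with no loss
in δ. For t ≤ √δ/2 the truncated power is smooth on the bump and is absorbed into it. For larger t,
the substitution τ = a(1-t²) turns the truncated power into (τ-r)_+^{μ-1}, which no longer involves
a; Sobolev is applied to ψ alone, and the integral in τ converges because μ > 1/2. -/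

theorem continuous_coneChar_uncurry :
    Continuous fun p : ConeSpace d × ConeSpace d => coneChar p.1 p.2 := by
  unfold coneChar
  fun_prop

@[fun_prop]
theorem Continuous.coneChar' {X : Type*} [TopologicalSpace X] {f g : X → ConeSpace d}
    (hf : Continuous f) (hg : Continuous g) : Continuous fun x => coneChar (f x) (g x) :=
  continuous_coneChar_uncurry.comp (hf.prodMk hg)

@[simp]
theorem norm_coneChar (x ξ : ConeSpace d) : ‖coneChar x ξ‖ = 1 := by
  have : coneChar x ξ = Complex.exp ((2 * Real.pi * inner ℝ x ξ : ℝ) * Complex.I) := by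
    unfold coneChar
    congr 1
    push_cast
    ring
  rw [this, Complex.norm_exp_ofReal_mul_I]

theorem coneChar_comm (x ξ : ConeSpace d) : coneChar x ξ = coneChar ξ x := by
  unfold coneChar
  rw [real_inner_comm]

theorem coneChar_add (x ξ η : ConeSpace d) :
    coneChar x (ξ + η) = coneChar x ξ * coneChar x η := by
  unfold coneChar
  rw [← Complex.exp_add, inner_add_right]
  congr 1
  push_cast
  ring

theorem coneChar_sub_left (x y ξ : ConeSpace d) :
    coneChar (x - y) ξ = coneChar x ξ * (starRingEnd ℂ) (coneChar y ξ) := by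
  unfold coneChar
  rw [← Complex.exp_conj, ← Complex.exp_add, inner_sub_left]
  congr 1
  simp only [map_mul, Complex.conj_ofReal, Complex.conj_I, Complex.ofReal_sub, map_ofNat]
  ring

theorem coneChar_zero_left (ξ : ConeSpace d) : coneChar 0 ξ = 1 := by
  simp [coneChar]

/-- The inverse Fourier integral `∫ h(ξ) e^{2πi x·ξ} dξ`. -/
def invFT (h : ConeSpace d → ℂ) (x : ConeSpace d) : ℂ := ∫ ξ, h ξ * coneChar x ξ

theorem integrable_mul_coneChar_iff {h : ConeSpace d → ℂ} (x : ConeSpace d) :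
    Integrable (fun ξ => h ξ * coneChar x ξ) ↔ Integrable h := by
  have key : ∀ (g k : ConeSpace d → ℂ), Continuous k → (∀ ξ, ‖k ξ‖ = 1) → Integrable g →
      Integrable fun ξ => g ξ * k ξ := fun g k hk hk1 hg =>
    hg.mul_bdd (c := 1) hk.aestronglyMeasurable (Filter.Eventually.of_forall fun ξ => (hk1 ξ).le)
  refine ⟨fun H => ?_, fun H => key h _ (by fun_prop) (by simp) H⟩
  have := key _ (fun ξ => (starRingEnd ℂ) (coneChar x ξ))
    (Complex.continuous_conj.comp (by fun_prop)) (by simp) H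
  refine this.congr (Filter.Eventually.of_forall fun ξ => ?_)
  simp only [mul_assoc, Complex.mul_conj, Complex.normSq_eq_norm_sq, norm_coneChar]
  simp

/-- Characters are unimodular, so integrability of the integrand does not depend on x. For negative
exponents a multiplier may fail to be integrable; the operator is then identically 0 and upper
bounds for it are trivial. -/
theorem invFT_of_not_integrable {h : ConeSpace d → ℂ} (hh : ¬ Integrable h) (x : ConeSpace d) :
    invFT h x = 0 :=
  integral_undef fun H => hh ((integrable_mul_coneChar_iff x).1 H)

theorem continuous_invFT (h : ConeSpace d → ℂ) : Continuous (invFT h) := by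
  by_cases hh : Integrable h
  · refine continuous_of_dominated (bound := fun ξ => ‖h ξ‖) (fun x => ?_) (fun x => ?_) hh.norm ?_
    · exact ((integrable_mul_coneChar_iff x).2 hh).1
    · exact Filter.Eventually.of_forall fun ξ => by simp
    · exact Filter.Eventually.of_forall fun ξ => by fun_prop
  · have : invFT h = fun _ => 0 := funext fun x => invFT_of_not_integrable hh x
    rw [this]
    exact continuous_const

theorem norm_invFT_le (h : ConeSpace d → ℂ) (x : ConeSpace d) : ‖invFT h x‖ ≤ ∫ ξ, ‖h ξ‖ := by
  refine (norm_integral_le_integral_norm _).trans_eq ?_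
  simp

theorem invFT_sub {g h : ConeSpace d → ℂ} (hg : Integrable g) (hh : Integrable h)
    (x : ConeSpace d) : invFT (fun ξ => g ξ - h ξ) x = invFT g x - invFT h x := by
  unfold invFT
  rw [← integral_sub ((integrable_mul_coneChar_iff x).2 hg) ((integrable_mul_coneChar_iff x).2 hh)]
  simp only [sub_mul]

theorem invFT_const_mul (c : ℂ) (h : ConeSpace d → ℂ) (x : ConeSpace d) :
    invFT (fun ξ => c * h ξ) x = c * invFT h x := by
  unfold invFT
  rw [← integral_const_mul]
  simp only [mul_assoc]

/-- Joint strong measurability of a parametrized inverse Fourier integral. -/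
theorem stronglyMeasurable_invFT_param {Y : Type*} [MeasurableSpace Y]
    {h : Y → ConeSpace d → ℂ} (hh : Measurable (Function.uncurry h)) :
    StronglyMeasurable fun p : Y × ConeSpace d => invFT (h p.1) p.2 := by
  unfold invFT
  refine StronglyMeasurable.integral_prod_right
    (f := fun (p : Y × ConeSpace d) (ξ : ConeSpace d) => h p.1 ξ * coneChar p.2 ξ) ?_
  have h1 : Measurable fun q : (Y × ConeSpace d) × ConeSpace d => h q.1.1 q.2 :=
    hh.comp (g := Function.uncurry h) (f := fun q : (Y × ConeSpace d) × ConeSpace d => (q.1.1, q.2))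
      (by fun_prop)
  have h2 : Measurable fun q : (Y × ConeSpace d) × ConeSpace d => coneChar q.1.2 q.2 :=
    continuous_coneChar_uncurry.measurable.comp
      (f := fun q : (Y × ConeSpace d) × ConeSpace d => (q.1.2, q.2)) (by fun_prop)
  exact (h1.mul h2).stronglyMeasurable

/-- Pairing of two inverse Fourier integrals against a weight, as a double integral. -/
theorem integral_mul_invFT_mul_conj_invFT {G u v : ConeSpace d → ℂ} (hG : Integrable G)
    (hu : Integrable u) (hv : Integrable v) :
    ∫ ξ, G ξ * (invFT u ξ * (starRingEnd ℂ) (invFT v ξ)) =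
      ∫ p : ConeSpace d × ConeSpace d, u p.1 * (starRingEnd ℂ) (v p.2) * invFT G (p.1 - p.2) := by
  have hv' : Integrable fun y => (starRingEnd ℂ) (v y) :=
    hv.mono (Complex.continuous_conj.comp_aestronglyMeasurable hv.1)
      (Filter.Eventually.of_forall fun y => (RCLike.norm_conj _).le)
  have h1 : ∀ ξ, G ξ * (invFT u ξ * (starRingEnd ℂ) (invFT v ξ)) =
      ∫ p : ConeSpace d × ConeSpace d,
        G ξ * (u p.1 * (starRingEnd ℂ) (v p.2) * coneChar (p.1 - p.2) ξ) := by
    intro ξ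
    unfold invFT
    rw [← integral_conj, ← integral_prod_mul, ← integral_const_mul]
    refine integral_congr_ae (Filter.Eventually.of_forall fun p => ?_)
    simp only [coneChar_sub_left, map_mul, coneChar_comm ξ]
    ring
  simp_rw [h1]
  rw [integral_integral_swap]
  · refine integral_congr_ae (Filter.Eventually.of_forall fun p => ?_)
    simp only [invFT]
    rw [← integral_const_mul]
    refine integral_congr_ae (Filter.Eventually.of_forall fun ξ => ?_)
    simp only
    ring
  · have := (hG.mul_prod (hu.mul_prod hv')).mul_bdd (c := 1)
      (g := fun q : ConeSpace d × (ConeSpace d × ConeSpace d) => coneChar (q.2.1 - q.2.2) q.1)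
      (Continuous.aestronglyMeasurable (by fun_prop))
      (Filter.Eventually.of_forall fun ξ => by simp)
    refine this.congr (Filter.Eventually.of_forall fun q => ?_)
    simp only [Function.uncurry]
    ring

/-! ### Gaussians and Plancherel's inequality -/

/-- The diagonal Gaussian `e^{-π ∑ bᵢ ξᵢ²}`. -/
def gauss (b : Fin (d + 1) → ℝ) (ξ : ConeSpace d) : ℝ :=
  Real.exp (-(Real.pi * ∑ i, b i * ξ i ^ 2))

@[fun_prop]
theorem continuous_gauss (b : Fin (d + 1) → ℝ) : Continuous (gauss b) := by
  unfold gauss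
  fun_prop

theorem gauss_pos (b : Fin (d + 1) → ℝ) (ξ : ConeSpace d) : 0 < gauss b ξ := Real.exp_pos _

theorem gauss_le_one {b : Fin (d + 1) → ℝ} (hb : ∀ i, 0 ≤ b i) (ξ : ConeSpace d) :
    gauss b ξ ≤ 1 := by
  unfold gauss
  rw [Real.exp_le_one_iff, neg_nonpos]
  exact mul_nonneg Real.pi_pos.le (Finset.sum_nonneg fun i _ => mul_nonneg (hb i) (sq_nonneg _))

theorem gauss_mul_gauss (b c : Fin (d + 1) → ℝ) (ξ : ConeSpace d) :
    gauss b ξ * gauss c ξ = gauss (b + c) ξ := by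
  unfold gauss
  rw [← Real.exp_add]
  congr 1
  simp only [Pi.add_apply, add_mul, Finset.sum_add_distrib]
  ring

theorem gauss_anti {b c : Fin (d + 1) → ℝ} (h : ∀ i, b i ≤ c i) (ξ : ConeSpace d) :
    gauss c ξ ≤ gauss b ξ := by
  unfold gauss
  refine Real.exp_le_exp.2 (neg_le_neg (mul_le_mul_of_nonneg_left
    (Finset.sum_le_sum fun i _ => mul_le_mul_of_nonneg_right (h i) (sq_nonneg _)) Real.pi_pos.le))

theorem gauss_neg (b : Fin (d + 1) → ℝ) (ξ : ConeSpace d) : gauss b (-ξ) = gauss b ξ := by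
  simp [gauss]

/-- The Fourier transform of `gauss b`. -/
def gaussFT (b : Fin (d + 1) → ℝ) (x : ConeSpace d) : ℝ :=
  (∏ i, (√(b i))⁻¹) * gauss (fun i => (b i)⁻¹) x

theorem gaussFT_nonneg (b : Fin (d + 1) → ℝ) (x : ConeSpace d) : 0 ≤ gaussFT b x :=
  mul_nonneg (Finset.prod_nonneg fun i _ => by positivity) (gauss_pos _ _).le

@[fun_prop]
theorem continuous_gaussFT (b : Fin (d + 1) → ℝ) : Continuous (gaussFT b) := by
  unfold gaussFT
  fun_prop

theorem gaussFT_neg (b : Fin (d + 1) → ℝ) (x : ConeSpace d) : gaussFT b (-x) = gaussFT b x := by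
  simp [gaussFT, gauss_neg]

theorem gaussFT_le_prod {b : Fin (d + 1) → ℝ} (hb : ∀ i, 0 ≤ b i) (x : ConeSpace d) :
    gaussFT b x ≤ ∏ i, (√(b i))⁻¹ :=
  mul_le_of_le_one_right (Finset.prod_nonneg fun i _ => by positivity)
    (gauss_le_one (fun i => inv_nonneg.2 (hb i)) x)

theorem invFT_gauss {b : Fin (d + 1) → ℝ} (hb : ∀ i, 0 < b i) (x : ConeSpace d) :
    invFT (fun ξ => (gauss b ξ : ℂ)) x = (gaussFT b x : ℂ) := by
  have h1 := GaussianFourier.integral_cexp_neg_sum_mul_add (b := fun i => ((Real.pi * b i : ℝ) : ℂ))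
    (fun i => by simpa using mul_pos Real.pi_pos (hb i))
    (fun i => 2 * Real.pi * Complex.I * x i)
  have h2 := (EuclideanSpace.volume_preserving_symm_measurableEquiv_toLp (Fin (d + 1))).integral_comp'
    (fun v : Fin (d + 1) → ℝ => Complex.exp (-∑ i, ((Real.pi * b i : ℝ) : ℂ) * (v i : ℂ) ^ 2
      + ∑ i, 2 * Real.pi * Complex.I * x i * v i))
  rw [h1] at h2
  unfold invFT
  calc _ = _ := by
        refine Eq.trans ?_ h2
        refine integral_congr_ae (Filter.Eventually.of_forall fun ξ => ?_)
        simp only [gauss, coneChar]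
        rw [Complex.ofReal_exp, ← Complex.exp_add]
        congr 1
        rw [PiLp.inner_apply]
        simp only [RCLike.inner_apply, conj_trivial, Finset.mul_sum]
        push_cast
        rw [Finset.mul_sum (a := 2 * (Real.pi : ℂ) * Complex.I)]
        refine congrArg₂ _ (congrArg _ (Finset.sum_congr rfl fun i _ => ?_))
          (Finset.sum_congr rfl fun i _ => ?_)
        · rw [← mul_assoc]
          rfl
        · change _ = _ * (ξ i : ℂ)
          ring
    _ = _ := by
        rw [Finset.prod_mul_distrib, gaussFT, gauss, Complex.ofReal_mul, ← Complex.exp_sum]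
        congr 1
        · rw [Complex.ofReal_prod]
          refine Finset.prod_congr rfl fun i _ => ?_
          have : ((Real.pi : ℂ) / ((Real.pi * b i : ℝ) : ℂ)) = (((b i)⁻¹ : ℝ) : ℂ) := by
            have : (Real.pi : ℂ) ≠ 0 := by exact_mod_cast Real.pi_ne_zero
            push_cast
            field_simp
          rw [this, ← Real.sqrt_inv, Real.sqrt_eq_rpow, Complex.ofReal_cpow (inv_pos.2 (hb i)).le]
          norm_num
        · rw [Complex.ofReal_exp]
          congr 1
          push_cast
          rw [Finset.mul_sum, ← Finset.sum_neg_distrib]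
          refine Finset.sum_congr rfl fun i _ => ?_
          have h1 : (Real.pi : ℂ) ≠ 0 := by exact_mod_cast Real.pi_ne_zero
          have h2 : (b i : ℂ) ≠ 0 := by exact_mod_cast (hb i).ne'
          field_simp
          rw [Complex.I_sq]
          ring

theorem integral_gauss {b : Fin (d + 1) → ℝ} (hb : ∀ i, 0 < b i) :
    ∫ ξ, gauss b ξ = ∏ i, (√(b i))⁻¹ := by
  have := invFT_gauss hb 0
  simp only [invFT, coneChar_zero_left, mul_one] at this
  rw [integral_complex_ofReal] at this
  rw [Complex.ofReal_inj.1 this]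
  simp [gaussFT, gauss]

theorem integrable_gauss {b : Fin (d + 1) → ℝ} (hb : ∀ i, 0 < b i) : Integrable (gauss b) := by
  by_contra h
  have := integral_gauss hb
  rw [integral_undef h] at this
  exact (Finset.prod_pos fun i _ => inv_pos.2 (Real.sqrt_pos.2 (hb i))).ne this

theorem lintegral_gaussFT {b : Fin (d + 1) → ℝ} (hb : ∀ i, 0 < b i) :
    ∫⁻ x, ENNReal.ofReal (gaussFT b x) = 1 := by
  have hb' : ∀ i, 0 < (b i)⁻¹ := fun i => inv_pos.2 (hb i)
  have hint : Integrable (gaussFT b) := (integrable_gauss hb').const_mul _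
  rw [← ofReal_integral_eq_lintegral_ofReal hint
    (Filter.Eventually.of_forall (gaussFT_nonneg b))]
  unfold gaussFT
  rw [integral_const_mul, integral_gauss hb', ← Finset.prod_mul_distrib, Finset.prod_eq_one,
    ENNReal.ofReal_one]
  intro i _
  rw [Real.sqrt_inv, inv_inv]
  exact inv_mul_cancel₀ (Real.sqrt_pos.2 (hb i)).ne'

/-- Raising the variances from b to c only enlarges the exponential, while each normalizing factor
loses at most √2. -/
theorem gaussFT_le_of_le {b c : Fin (d + 1) → ℝ} (hb : ∀ i, 0 < b i) (h : ∀ i, b i ≤ c i)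
    (h2 : ∀ i, c i ≤ 2 * b i) (x : ConeSpace d) :
    gaussFT b x ≤ √2 ^ (d + 1) * gaussFT c x := by
  have hc : ∀ i, 0 < c i := fun i => (hb i).trans_le (h i)
  unfold gaussFT
  rw [← mul_assoc]
  refine mul_le_mul ?_ (gauss_anti (fun i => inv_anti₀ (hb i) (h i)) x) (gauss_pos _ _).le
    (by positivity)
  have : √2 ^ (d + 1) = ∏ _i : Fin (d + 1), √2 := by simp
  rw [this, ← Finset.prod_mul_distrib]
  refine Finset.prod_le_prod (fun i _ => by positivity) fun i _ => ?_
  rw [← div_eq_mul_inv, inv_le_comm₀ (Real.sqrt_pos.2 (hb i)) (by have := hc i; positivity),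
    inv_div, div_le_iff₀ (by positivity), mul_comm, ← Real.sqrt_mul (by norm_num)]
  exact Real.sqrt_le_sqrt (h2 i)

theorem ENNReal.two_mul_mul_le_add_sq (a b : ℝ≥0∞) : 2 * a * b ≤ a ^ 2 + b ^ 2 := by
  have key : ∀ a c : ℝ≥0∞, 2 * a * (a + c) ≤ a ^ 2 + (a + c) ^ 2 := fun a c =>
    calc 2 * a * (a + c) ≤ 2 * a * (a + c) + c ^ 2 := le_self_add
      _ = _ := by ring
  rcases le_total a b with h | h
  · obtain ⟨c, rfl⟩ := le_iff_exists_add.1 h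
    exact key a c
  · obtain ⟨c, rfl⟩ := le_iff_exists_add.1 h
    calc _ = _ := by ring
      _ ≤ _ := key b c
      _ = _ := by ring

/-- Schur's test for a nonnegative convolution kernel of mass one. -/
theorem lintegral_mul_mul_gaussFT_le {b : Fin (d + 1) → ℝ} (hb : ∀ i, 0 < b i)
    {f : ConeSpace d → ℝ≥0∞} (hf : AEMeasurable f) :
    ∫⁻ p : ConeSpace d × ConeSpace d, f p.1 * f p.2 * ENNReal.ofReal (gaussFT b (p.1 - p.2)) ≤
      ∫⁻ x, f x ^ 2 := by
  have hK : Measurable fun x : ConeSpace d => ENNReal.ofReal (gaussFT b x) :=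
    (continuous_gaussFT b).measurable.ennreal_ofReal
  have hKp : Measurable fun p : ConeSpace d × ConeSpace d =>
      ENNReal.ofReal (gaussFT b (p.1 - p.2)) := hK.comp (measurable_fst.sub measurable_snd)
  have hm1 : AEMeasurable (fun p : ConeSpace d × ConeSpace d =>
      f p.1 ^ 2 * ENNReal.ofReal (gaussFT b (p.1 - p.2))) (volume.prod volume) :=
    ((hf.pow_const 2).comp_quasiMeasurePreserving Measure.quasiMeasurePreserving_fst).mul
      hKp.aemeasurable
  have hm2 : AEMeasurable (fun p : ConeSpace d × ConeSpace d =>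
      f p.2 ^ 2 * ENNReal.ofReal (gaussFT b (p.1 - p.2))) (volume.prod volume) :=
    ((hf.pow_const 2).comp_quasiMeasurePreserving Measure.quasiMeasurePreserving_snd).mul
      hKp.aemeasurable
  have h1 : ∫⁻ p : ConeSpace d × ConeSpace d, f p.1 ^ 2 * ENNReal.ofReal (gaussFT b (p.1 - p.2)) =
      ∫⁻ x, f x ^ 2 := by
    rw [Measure.volume_eq_prod, lintegral_prod _ hm1]
    refine lintegral_congr fun x => ?_
    simp only
    rw [lintegral_const_mul _ (by fun_prop),
      lintegral_sub_left_eq_self (fun y => ENNReal.ofReal (gaussFT b y)), lintegral_gaussFT hb,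
      mul_one]
  have h2 : ∫⁻ p : ConeSpace d × ConeSpace d, f p.2 ^ 2 * ENNReal.ofReal (gaussFT b (p.1 - p.2)) =
      ∫⁻ x, f x ^ 2 := by
    rw [Measure.volume_eq_prod, lintegral_prod_symm _ hm2]
    refine lintegral_congr fun x => ?_
    simp only
    rw [lintegral_const_mul _ (by fun_prop),
      lintegral_sub_right_eq_self (fun y => ENNReal.ofReal (gaussFT b y)), lintegral_gaussFT hb,
      mul_one]
  have h3 : 2 * ∫⁻ p : ConeSpace d × ConeSpace d,
      f p.1 * f p.2 * ENNReal.ofReal (gaussFT b (p.1 - p.2)) ≤ 2 * ∫⁻ x, f x ^ 2 := by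
    calc _ = ∫⁻ p : ConeSpace d × ConeSpace d,
          2 * (f p.1 * f p.2 * ENNReal.ofReal (gaussFT b (p.1 - p.2))) :=
          (lintegral_const_mul' _ _ (by simp)).symm
      _ ≤ ∫⁻ p : ConeSpace d × ConeSpace d, (f p.1 ^ 2 * ENNReal.ofReal (gaussFT b (p.1 - p.2)) +
          f p.2 ^ 2 * ENNReal.ofReal (gaussFT b (p.1 - p.2))) := by
          refine lintegral_mono fun p => ?_
          rw [← add_mul, ← mul_assoc, ← mul_assoc]
          exact mul_le_mul_left (ENNReal.two_mul_mul_le_add_sq _ _) _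
      _ = _ := by
          rw [Measure.volume_eq_prod] at h1 h2 ⊢
          rw [lintegral_add_left' hm1, h1, h2, two_mul]
  exact (ENNReal.mul_le_mul_iff_right (by simp) (by simp)).1 h3

/-- The Gaussian damping legitimizes Fubini: the left side becomes a quadratic form in h with a
positive convolution kernel of mass one, to which Schur's test applies. The bound is independent of
b. -/
theorem lintegral_gauss_mul_invFT_sq_le {b : Fin (d + 1) → ℝ} (hb : ∀ i, 0 < b i)
    {h : ConeSpace d → ℂ} (hh : Integrable h) :
    ∫⁻ x, ENNReal.ofReal (gauss b x) * ‖invFT h x‖ₑ ^ 2 ≤ ∫⁻ ξ, ‖h ξ‖ₑ ^ 2 := by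
  have hint : Integrable fun x => gauss b x * ‖invFT h x‖ ^ 2 := by
    refine (integrable_gauss hb).mul_bdd (c := (∫ ξ, ‖h ξ‖) ^ 2)
      ((continuous_invFT h).norm.pow 2).aestronglyMeasurable (Filter.Eventually.of_forall fun x => ?_)
    rw [norm_pow, norm_norm]
    exact pow_le_pow_left₀ (norm_nonneg _) (norm_invFT_le h x) 2
  have key := integral_mul_invFT_mul_conj_invFT
    ((integrable_gauss hb).ofReal : Integrable fun x => (gauss b x : ℂ)) hh hh
  have e1 : ∫ x, ((gauss b x : ℝ) : ℂ) * (invFT h x * (starRingEnd ℂ) (invFT h x)) =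
      ((∫ x, gauss b x * ‖invFT h x‖ ^ 2 : ℝ) : ℂ) := by
    rw [← integral_complex_ofReal]
    refine integral_congr_ae (Filter.Eventually.of_forall fun x => ?_)
    simp only [Complex.mul_conj, Complex.normSq_eq_norm_sq]
    push_cast
    rfl
  calc _ = ENNReal.ofReal (∫ x, gauss b x * ‖invFT h x‖ ^ 2) := by
        rw [ofReal_integral_eq_lintegral_ofReal hint
          (Filter.Eventually.of_forall fun x => mul_nonneg (gauss_pos _ _).le (by positivity))]
        refine lintegral_congr fun x => ?_
        rw [ENNReal.ofReal_mul (gauss_pos _ _).le, ENNReal.ofReal_pow (norm_nonneg _),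
          ofReal_norm]
    _ = ‖((∫ x, gauss b x * ‖invFT h x‖ ^ 2 : ℝ) : ℂ)‖ₑ := by
        rw [← ofReal_norm, Complex.norm_real, Real.norm_of_nonneg]
        exact integral_nonneg fun x => mul_nonneg (gauss_pos _ _).le (by positivity)
    _ ≤ ∫⁻ p : ConeSpace d × ConeSpace d,
        ‖h p.1‖ₑ * ‖h p.2‖ₑ * ENNReal.ofReal (gaussFT b (p.1 - p.2)) := by
        rw [← e1]
        refine (congrArg _ key).trans_le ((enorm_integral_le_lintegral_enorm _).trans_eq ?_)
        refine lintegral_congr fun p => ?_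
        have := invFT_gauss hb (p.1 - p.2)
        simp only [enorm_mul, RCLike.enorm_conj]
        erw [this]
        rw [← ofReal_norm (gaussFT b (p.1 - p.2) : ℂ), Complex.norm_real,
          Real.norm_of_nonneg (gaussFT_nonneg _ _)]
    _ ≤ _ := lintegral_mul_mul_gaussFT_le hb hh.1.enorm

/-- Plancherel's inequality. -/
theorem lintegral_invFT_sq_le (h : ConeSpace d → ℂ) :
    ∫⁻ x, ‖invFT h x‖ₑ ^ 2 ≤ ∫⁻ ξ, ‖h ξ‖ₑ ^ 2 := by
  by_cases hh : Integrable h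
  swap
  · simp [invFT_of_not_integrable hh]
  have hlim : ∀ x : ConeSpace d, Filter.Tendsto
      (fun n : ℕ => ENNReal.ofReal (gauss (fun _ => 1 / ((n : ℝ) + 1)) x) * ‖invFT h x‖ₑ ^ 2)
      Filter.atTop (nhds (‖invFT h x‖ₑ ^ 2)) := by
    intro x
    have h1 : Filter.Tendsto (fun n : ℕ => gauss (fun _ => 1 / ((n : ℝ) + 1)) x) Filter.atTop
        (nhds 1) := by
      have : Filter.Tendsto (fun n : ℕ => Real.exp (-(Real.pi * ∑ i, 1 / ((n : ℝ) + 1) * x i ^ 2)))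
          Filter.atTop (nhds (Real.exp (-(Real.pi * ∑ i, 0 * x i ^ 2)))) := by
        refine (Real.continuous_exp.tendsto _).comp (Filter.Tendsto.neg
          (Filter.Tendsto.const_mul _ (tendsto_finsetSum _ fun i _ =>
            tendsto_one_div_add_atTop_nhds_zero_nat.mul_const _)))
      simpa only [zero_mul, Finset.sum_const_zero, mul_zero, neg_zero, Real.exp_zero,
        gauss] using this
    have h2 := ENNReal.Tendsto.mul_const (b := ‖invFT h x‖ₑ ^ 2) (ENNReal.tendsto_ofReal h1)
      (Or.inr (by simp))
    simpa using h2
  -- The damping is removed by Fatou's lemma, the damped bound being uniform.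
  calc _ = ∫⁻ x, Filter.liminf (fun n : ℕ =>
        ENNReal.ofReal (gauss (fun _ => 1 / ((n : ℝ) + 1)) x) * ‖invFT h x‖ₑ ^ 2) Filter.atTop :=
        lintegral_congr fun x => (hlim x).liminf_eq.symm
    _ ≤ Filter.liminf (fun n : ℕ => ∫⁻ x,
        ENNReal.ofReal (gauss (fun _ => 1 / ((n : ℝ) + 1)) x) * ‖invFT h x‖ₑ ^ 2) Filter.atTop :=
        lintegral_liminf_le fun n => (continuous_gauss _).measurable.ennreal_ofReal.mul
          ((continuous_invFT h).measurable.enorm.pow_const 2)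
    _ ≤ Filter.liminf (fun _ : ℕ => ∫⁻ ξ, ‖h ξ‖ₑ ^ 2) Filter.atTop :=
        Filter.liminf_le_liminf (Filter.Eventually.of_forall fun n =>
          lintegral_gauss_mul_invFT_sq_le (fun _ => by positivity) hh)
    _ = _ := by simp

theorem MeasureTheory.Integrable.complex_ofReal {X : Type*} [MeasurableSpace X] {μ : Measure X}
    {f : X → ℝ} (hf : Integrable f μ) : Integrable (fun x => (f x : ℂ)) μ :=
  hf.ofReal

/-! ### The L² maximal inequality for Gaussian averages -/

/-- The exponents of the Gaussian with weight `τ` in `ξ'` and `1` in `ξ_n`. -/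
def heatVec (d : ℕ) (τ : ℝ) (i : Fin (d + 1)) : ℝ := if i = Fin.last d then 1 else τ

theorem heatVec_pos {τ : ℝ} (hτ : 0 < τ) (i : Fin (d + 1)) : 0 < heatVec d τ i := by
  unfold heatVec
  split_ifs <;> simp [hτ]

theorem heatVec_mono {σ τ : ℝ} (h : σ ≤ τ) (i : Fin (d + 1)) : heatVec d σ i ≤ heatVec d τ i := by
  unfold heatVec
  split_ifs <;> simp [h]

/-- Absorption of a square root. Finiteness of a is essential, since a = ⊤ satisfies the inequality
for every nonzero c; the truncations and a priori bounds below exist to supply it. -/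
theorem ENNReal.le_sq_of_le_mul_sqrt {a c : ℝ≥0∞} (ha : a ≠ ⊤) (h : a ≤ c * a ^ (1 / 2 : ℝ)) :
    a ≤ c ^ 2 := by
  rcases eq_or_ne a 0 with rfl | h0
  · simp
  have h1 : a ^ (1 / 2 : ℝ) * a ^ (1 / 2 : ℝ) = a := by
    rw [← ENNReal.rpow_add _ _ h0 ha]
    norm_num
  have h2 : a ^ (1 / 2 : ℝ) ≤ c := by
    refine (ENNReal.mul_le_mul_iff_left (a := a ^ (1 / 2 : ℝ)) ?_ ?_).1 (h1.trans_le h)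
    · simp [h0]
    · exact (ENNReal.rpow_lt_top_of_nonneg (by norm_num) ha).ne
  calc a = a ^ (1 / 2 : ℝ) * a ^ (1 / 2 : ℝ) := h1.symm
    _ ≤ c * c := mul_le_mul' h2 h2
    _ = c ^ 2 := (sq c).symm

theorem ENNReal.lintegral_mul_le_sqrt {X : Type*} [MeasurableSpace X] {μ : Measure X}
    {f g : X → ℝ≥0∞} (hf : AEMeasurable f μ) (hg : AEMeasurable g μ) :
    ∫⁻ x, f x * g x ∂μ ≤ (∫⁻ x, f x ^ 2 ∂μ) ^ (1 / 2 : ℝ) * (∫⁻ x, g x ^ 2 ∂μ) ^ (1 / 2 : ℝ) := by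
  have := ENNReal.lintegral_mul_le_Lp_mul_Lq μ Real.HolderConjugate.two_two hf hg
  simpa using this

/-- The supremum of the sequence is finite and satisfies the same self-improving inequality, so the
square root can be absorbed there. The bound K leaves no trace in the result. -/
theorem ENNReal.le_sq_of_iterate {a : ℕ → ℝ≥0∞} {c K : ℝ≥0∞} (hK : K ≠ ⊤) (haK : ∀ i, a i ≤ K)
    (h : ∀ i, a i ≤ c * a (i + 1) ^ (1 / 2 : ℝ)) (i : ℕ) : a i ≤ c ^ 2 := by
  refine (le_iSup a i).trans (ENNReal.le_sq_of_le_mul_sqrt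
    (ne_top_of_le_ne_top hK (iSup_le haK)) (iSup_le fun j => (h j).trans ?_))
  gcongr
  exact le_iSup a (j + 1)

/-- The Gaussian double integral. -/
def gaussPair (b : Fin (d + 1) → ℝ) (f g : ConeSpace d → ℝ) : ℝ :=
  ∫ p : ConeSpace d × ConeSpace d, f p.1 * g p.2 * gaussFT b (p.1 - p.2)

theorem integrable_gaussPair {b : Fin (d + 1) → ℝ} (hb : ∀ i, 0 < b i) {f g : ConeSpace d → ℝ}
    (hf : Integrable f) (hg : Integrable g) :
    Integrable fun p : ConeSpace d × ConeSpace d => f p.1 * g p.2 * gaussFT b (p.1 - p.2) := by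
  refine (hf.mul_prod hg).mul_bdd (c := ∏ i, (√(b i))⁻¹)
    (Continuous.aestronglyMeasurable (by fun_prop)) (Filter.Eventually.of_forall fun p => ?_)
  rw [Real.norm_of_nonneg (gaussFT_nonneg _ _)]
  exact gaussFT_le_prod (fun i => (hb i).le) _

theorem gaussPair_comm (b : Fin (d + 1) → ℝ) (f g : ConeSpace d → ℝ) :
    gaussPair b f g = gaussPair b g f := by
  unfold gaussPair
  rw [Measure.volume_eq_prod, ← integral_prod_swap]
  refine integral_congr_ae (Filter.Eventually.of_forall fun p => ?_)
  simp only [Prod.fst_swap, Prod.snd_swap]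
  rw [← gaussFT_neg b (p.2 - p.1), neg_sub]
  ring

theorem ofReal_gaussPair {b : Fin (d + 1) → ℝ} (hb : ∀ i, 0 < b i) {f g : ConeSpace d → ℝ}
    (hf : Integrable f) (hg : Integrable g) :
    (gaussPair b f g : ℂ) = ∫ ξ, (gauss b ξ : ℂ) *
      (invFT (fun x => (f x : ℂ)) ξ * (starRingEnd ℂ) (invFT (fun x => (g x : ℂ)) ξ)) := by
  rw [integral_mul_invFT_mul_conj_invFT ((integrable_gauss hb).complex_ofReal) hf.complex_ofReal
    hg.complex_ofReal]
  unfold gaussPair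
  rw [← integral_complex_ofReal]
  refine integral_congr_ae (Filter.Eventually.of_forall fun p => ?_)
  simp only [invFT_gauss hb, Complex.conj_ofReal]
  push_cast
  rfl

theorem integrable_gauss_mul_invFT_mul {b : Fin (d + 1) → ℝ} (hb : ∀ i, 0 < b i)
    (u v : ConeSpace d → ℂ) :
    Integrable fun ξ => (gauss b ξ : ℂ) * (invFT u ξ * (starRingEnd ℂ) (invFT v ξ)) := by
  refine (integrable_gauss hb).complex_ofReal.mul_bdd (c := (∫ ξ, ‖u ξ‖) * ∫ ξ, ‖v ξ‖)
    (((continuous_invFT u).mul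
      (Complex.continuous_conj.comp (continuous_invFT v))).aestronglyMeasurable)
    (Filter.Eventually.of_forall fun x => ?_)
  rw [norm_mul, RCLike.norm_conj]
  exact mul_le_mul (norm_invFT_le u x) (norm_invFT_le v x) (norm_nonneg _)
    (integral_nonneg fun _ => norm_nonneg _)

/-- If σ ≤ τ then σ + τ ≤ 2τ ≤ 2(σ + τ), so the mixed kernel is comparable from above with the
diagonal one of the larger parameter. Summing both diagonal kernels makes the bound symmetric. -/
theorem gaussFT_add_le {σ τ : ℝ} (hσ : 0 < σ) (hτ : 0 < τ) (x : ConeSpace d) :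
    gaussFT (heatVec d σ + heatVec d τ) x ≤ √2 ^ (d + 1) *
      (gaussFT (heatVec d σ + heatVec d σ) x + gaussFT (heatVec d τ + heatVec d τ) x) := by
  wlog h : σ ≤ τ generalizing σ τ
  · rw [add_comm (heatVec d σ), add_comm (gaussFT _ x)]
    exact this hτ hσ (le_of_not_ge h)
  have h1 : gaussFT (heatVec d σ + heatVec d τ) x ≤
      √2 ^ (d + 1) * gaussFT (heatVec d τ + heatVec d τ) x := by
    refine gaussFT_le_of_le (fun i => add_pos (heatVec_pos hσ i) (heatVec_pos hτ i))
      (fun i => ?_) (fun i => ?_) x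
    · exact add_le_add (heatVec_mono h i) le_rfl
    · have := heatVec_pos hσ i
      simp only [Pi.add_apply]
      linarith
  refine h1.trans (mul_le_mul_of_nonneg_left ?_ (by positivity))
  linarith [gaussFT_nonneg (heatVec d σ + heatVec d σ) x]

variable {ι : Type*} [Fintype ι]

/-- `∫ |∑ₖ γ_{τₖ} ǔₖ|²`, the square of the adjoint of a linearized Gaussian maximal operator. -/
def heatAdj (τ : ι → ℝ) (u : ι → ConeSpace d → ℂ) : ℝ≥0∞ :=
  ∫⁻ ξ, ‖∑ k, (gauss (heatVec d (τ k)) ξ : ℂ) * invFT (u k) ξ‖ₑ ^ 2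

/-- Expanding the square and moving to the physical side gives double integrals against positive
kernels, so the triangle inequality can replace each u_k by its modulus. -/
theorem heatAdj_le_gaussPair {τ : ι → ℝ} (hτ : ∀ k, 0 < τ k) {u : ι → ConeSpace d → ℂ}
    (hu : ∀ k, Integrable (u k)) :
    heatAdj τ u ≤ ENNReal.ofReal (∑ k, ∑ l,
      gaussPair (heatVec d (τ k) + heatVec d (τ l)) (fun x => ‖u k x‖) (fun x => ‖u l x‖)) := by
  have hpos : ∀ k l i, 0 < (heatVec d (τ k) + heatVec d (τ l)) i := fun k l i =>
    add_pos (heatVec_pos (hτ k) i) (heatVec_pos (hτ l) i)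
  have hsq : ∀ ξ, ((‖∑ k, (gauss (heatVec d (τ k)) ξ : ℂ) * invFT (u k) ξ‖ ^ 2 : ℝ) : ℂ) =
      ∑ k, ∑ l, (gauss (heatVec d (τ k) + heatVec d (τ l)) ξ : ℂ) *
        (invFT (u k) ξ * (starRingEnd ℂ) (invFT (u l) ξ)) := by
    intro ξ
    rw [← Complex.normSq_eq_norm_sq, ← Complex.mul_conj, map_sum, Finset.sum_mul_sum]
    refine Finset.sum_congr rfl fun k _ => Finset.sum_congr rfl fun l _ => ?_
    rw [← gauss_mul_gauss, map_mul, Complex.conj_ofReal]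
    push_cast
    ring
  have hint : ∀ k l, Integrable fun ξ => (gauss (heatVec d (τ k) + heatVec d (τ l)) ξ : ℂ) *
      (invFT (u k) ξ * (starRingEnd ℂ) (invFT (u l) ξ)) := fun k l =>
    integrable_gauss_mul_invFT_mul (hpos k l) _ _
  have hintC : Integrable fun ξ =>
      ((‖∑ k, (gauss (heatVec d (τ k)) ξ : ℂ) * invFT (u k) ξ‖ ^ 2 : ℝ) : ℂ) := by
    simp_rw [hsq]
    exact integrable_finsetSum _ fun k _ => integrable_finsetSum _ fun l _ => hint k l
  have hintR : Integrable fun ξ =>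
      ‖∑ k, (gauss (heatVec d (τ k)) ξ : ℂ) * invFT (u k) ξ‖ ^ 2 := by
    have := hintC.re
    simpa only [RCLike.re_to_complex, Complex.ofReal_re] using this
  have h1 : heatAdj τ u = ENNReal.ofReal
      (∫ ξ, ‖∑ k, (gauss (heatVec d (τ k)) ξ : ℂ) * invFT (u k) ξ‖ ^ 2) := by
    rw [ofReal_integral_eq_lintegral_ofReal hintR
      (Filter.Eventually.of_forall fun ξ => by positivity)]
    refine lintegral_congr fun ξ => ?_
    rw [ENNReal.ofReal_pow (norm_nonneg _), ofReal_norm]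
  rw [h1]
  refine ENNReal.ofReal_le_ofReal ?_
  have h2 : ((∫ ξ, ‖∑ k, (gauss (heatVec d (τ k)) ξ : ℂ) * invFT (u k) ξ‖ ^ 2 : ℝ) : ℂ) =
      ∑ k, ∑ l, ∫ p : ConeSpace d × ConeSpace d, u k p.1 * (starRingEnd ℂ) (u l p.2) *
        (gaussFT (heatVec d (τ k) + heatVec d (τ l)) (p.1 - p.2) : ℂ) := by
    rw [← integral_complex_ofReal]
    simp_rw [hsq]
    rw [integral_finsetSum _ fun k _ => integrable_finsetSum _ fun l _ => hint k l]
    refine Finset.sum_congr rfl fun k _ => ?_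
    rw [integral_finsetSum _ fun l _ => hint k l]
    refine Finset.sum_congr rfl fun l _ => ?_
    rw [integral_mul_invFT_mul_conj_invFT ((integrable_gauss (hpos k l)).complex_ofReal) (hu k) (hu l)]
    simp_rw [invFT_gauss (hpos k l)]
  calc _ = ‖((∫ ξ, ‖∑ k, (gauss (heatVec d (τ k)) ξ : ℂ) * invFT (u k) ξ‖ ^ 2 : ℝ) : ℂ)‖ := by
        rw [Complex.norm_real, Real.norm_of_nonneg (integral_nonneg fun ξ => by positivity)]
    _ ≤ _ := by
        rw [h2]
        refine (norm_sum_le _ _).trans (Finset.sum_le_sum fun k _ =>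
          (norm_sum_le _ _).trans (Finset.sum_le_sum fun l _ =>
            (norm_integral_le_integral_norm _).trans_eq ?_))
        refine integral_congr_ae (Filter.Eventually.of_forall fun p => ?_)
        simp only [norm_mul, RCLike.norm_conj, Complex.norm_real,
          Real.norm_of_nonneg (gaussFT_nonneg _ _)]

/-- Removes one of the two parameters from the kernel: for nonnegative f_k the mixed kernel splits
into two diagonal ones, whose double sums agree after exchanging k and l. -/
theorem sum_gaussPair_le {τ : ι → ℝ} (hτ : ∀ k, 0 < τ k) {f : ι → ConeSpace d → ℝ}
    (hf : ∀ k, Integrable (f k)) (hf0 : ∀ k x, 0 ≤ f k x) :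
    ∑ k, ∑ l, gaussPair (heatVec d (τ k) + heatVec d (τ l)) (f k) (f l) ≤
      2 * √2 ^ (d + 1) *
        ∑ k, ∑ l, gaussPair (heatVec d (τ k) + heatVec d (τ k)) (f k) (f l) := by
  have hpos : ∀ k l i, 0 < (heatVec d (τ k) + heatVec d (τ l)) i := fun k l i =>
    add_pos (heatVec_pos (hτ k) i) (heatVec_pos (hτ l) i)
  have h1 : ∀ k l, gaussPair (heatVec d (τ k) + heatVec d (τ l)) (f k) (f l) ≤ √2 ^ (d + 1) *
      (gaussPair (heatVec d (τ k) + heatVec d (τ k)) (f k) (f l) +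
        gaussPair (heatVec d (τ l) + heatVec d (τ l)) (f l) (f k)) := by
    intro k l
    rw [gaussPair_comm _ (f l) (f k)]
    have i1 := integrable_gaussPair (hpos k k) (hf k) (hf l)
    have i2 := integrable_gaussPair (hpos l l) (hf k) (hf l)
    unfold gaussPair
    rw [← integral_add i1 i2, ← integral_const_mul]
    refine integral_mono (integrable_gaussPair (hpos k l) (hf k) (hf l))
      ((i1.add i2).const_mul _) fun p => ?_
    have := mul_le_mul_of_nonneg_left (gaussFT_add_le (hτ k) (hτ l) (p.1 - p.2))
      (mul_nonneg (hf0 k p.1) (hf0 l p.2))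
    linarith
  refine (Finset.sum_le_sum fun k _ => Finset.sum_le_sum fun l _ => h1 k l).trans_eq ?_
  simp_rw [← Finset.mul_sum, Finset.sum_add_distrib]
  rw [Finset.sum_comm (f := fun k l => gaussPair (heatVec d (τ l) + heatVec d (τ l)) (f l) (f k))]
  ring

/-- Once the kernel depends on k only, the sum over l acts on f_l alone. On the Fourier side the
form is a pairing of ∑ γ f̌_k with the transform of ∑ f_l, and Cauchy–Schwarz with Plancherel yields
the product. -/
theorem ofReal_sum_gaussPair_le {τ : ι → ℝ} (hτ : ∀ k, 0 < τ k) {f : ι → ConeSpace d → ℝ}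
    (hf : ∀ k, Integrable (f k)) :
    ENNReal.ofReal (∑ k, ∑ l, gaussPair (heatVec d (τ k) + heatVec d (τ k)) (f k) (f l)) ≤
      heatAdj (fun k => 2 * τ k) (fun k x => (f k x : ℂ)) ^ (1 / 2 : ℝ) *
        (∫⁻ x, ‖∑ k, (f k x : ℂ)‖ₑ ^ 2) ^ (1 / 2 : ℝ) := by
  have hpos : ∀ k l i, 0 < (heatVec d (τ k) + heatVec d (τ l)) i := fun k l i =>
    add_pos (heatVec_pos (hτ k) i) (heatVec_pos (hτ l) i)
  have hint : ∀ k l, Integrable fun ξ => (gauss (heatVec d (τ k) + heatVec d (τ k)) ξ : ℂ) *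
      (invFT (fun x => (f k x : ℂ)) ξ * (starRingEnd ℂ) (invFT (fun x => (f l x : ℂ)) ξ)) :=
    fun k l => integrable_gauss_mul_invFT_mul (hpos k k) _ _
  have hsum : ∀ ξ, invFT (fun x => ∑ k, (f k x : ℂ)) ξ = ∑ k, invFT (fun x => (f k x : ℂ)) ξ := by
    intro ξ
    unfold invFT
    simp_rw [Finset.sum_mul]
    exact integral_finsetSum _ fun k _ => (integrable_mul_coneChar_iff ξ).2 (hf k).complex_ofReal
  have h1 : ((∑ k, ∑ l, gaussPair (heatVec d (τ k) + heatVec d (τ k)) (f k) (f l) : ℝ) : ℂ) =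
      ∫ ξ, (∑ k, (gauss (heatVec d (τ k) + heatVec d (τ k)) ξ : ℂ) *
        invFT (fun x => (f k x : ℂ)) ξ) *
          (starRingEnd ℂ) (invFT (fun x => ∑ k, (f k x : ℂ)) ξ) := by
    push_cast
    simp_rw [ofReal_gaussPair (hpos _ _) (hf _) (hf _)]
    simp_rw [← integral_finsetSum Finset.univ fun l _ => hint _ l]
    rw [← integral_finsetSum Finset.univ fun k _ => integrable_finsetSum Finset.univ
      fun l _ => hint k l]
    refine integral_congr_ae (Filter.Eventually.of_forall fun ξ => ?_)
    simp only [hsum, map_sum, Finset.sum_mul_sum]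
    refine Finset.sum_congr rfl fun k _ => Finset.sum_congr rfl fun l _ => ?_
    ring
  calc _ ≤ ‖((∑ k, ∑ l, gaussPair (heatVec d (τ k) + heatVec d (τ k)) (f k) (f l) : ℝ) : ℂ)‖ₑ := by
        rw [← ofReal_norm, Complex.norm_real]
        exact ENNReal.ofReal_le_ofReal (le_abs_self _)
    _ ≤ ∫⁻ ξ, ‖∑ k, (gauss (heatVec d (2 * τ k)) ξ : ℂ) * invFT (fun x => (f k x : ℂ)) ξ‖ₑ *
          ‖invFT (fun x => ∑ k, (f k x : ℂ)) ξ‖ₑ := by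
        rw [h1]
        refine (enorm_integral_le_lintegral_enorm _).trans (lintegral_mono fun ξ => ?_)
        rw [enorm_mul, RCLike.enorm_conj]
        refine mul_le_mul_left ?_ _
        -- Squaring doubles the weight in ξ_n as well, from 1 to 2. The surplus factor e^{-πξ_n²}
        -- does not depend on k, so it leaves the sum and is bounded by 1.
        have hfac : ∀ k, gauss (heatVec d (τ k) + heatVec d (τ k)) ξ =
            gauss (heatVec d 0) ξ * gauss (heatVec d (2 * τ k)) ξ := by
          intro k
          rw [gauss_mul_gauss]
          congr 1
          funext i
          simp only [Pi.add_apply, heatVec]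
          split_ifs <;> ring
        simp_rw [hfac, Complex.ofReal_mul, mul_assoc]
        rw [← Finset.mul_sum, enorm_mul]
        refine mul_le_of_le_one_left' ?_
        rw [← ofReal_norm, Complex.norm_real, Real.norm_of_nonneg (gauss_pos _ _).le]
        exact ENNReal.ofReal_le_one.2 (gauss_le_one (fun i => by unfold heatVec; split_ifs <;> simp) _)
    _ ≤ _ := by
        refine (ENNReal.lintegral_mul_le_sqrt ?_ ?_).trans ?_
        · refine (Continuous.measurable ?_).enorm.aemeasurable
          exact continuous_finsetSum _ fun k _ =>
            (Complex.continuous_ofReal.comp (continuous_gauss _)).mul (continuous_invFT _)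
        · exact (continuous_invFT _).measurable.enorm.aemeasurable
        · refine mul_le_mul' le_rfl (ENNReal.rpow_le_rpow ?_ (by norm_num))
          exact lintegral_invFT_sq_le _

/-- The bound of the adjoint of the linearized maximal operator by that of a doubled one. -/
theorem heatAdj_le_sqrt {τ : ι → ℝ} (hτ : ∀ k, 0 < τ k) {u : ι → ConeSpace d → ℂ}
    (hu : ∀ k, Integrable (u k)) :
    heatAdj τ u ≤ ENNReal.ofReal (2 * √2 ^ (d + 1)) *
      (∫⁻ x, (∑ k, ‖u k x‖ₑ) ^ 2) ^ (1 / 2 : ℝ) *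
        heatAdj (fun k => 2 * τ k) (fun k x => (‖u k x‖ : ℂ)) ^ (1 / 2 : ℝ) := by
  refine (heatAdj_le_gaussPair hτ hu).trans ((ENNReal.ofReal_le_ofReal
    (sum_gaussPair_le hτ (fun k => (hu k).norm) fun k x => norm_nonneg _)).trans ?_)
  rw [ENNReal.ofReal_mul (by positivity), mul_assoc]
  refine mul_le_mul_right ((ofReal_sum_gaussPair_le hτ fun k => (hu k).norm).trans_eq ?_) _
  rw [mul_comm]
  congr 3
  funext x
  congr 1
  rw [← Complex.ofReal_sum, ← ofReal_norm, Complex.norm_real,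
    Real.norm_of_nonneg (Finset.sum_nonneg fun k _ => norm_nonneg _),
    ENNReal.ofReal_sum_of_nonneg fun k _ => norm_nonneg _]
  simp only [ofReal_norm]

/-- The crude a priori bound: ǔ_k is bounded by ‖u_k‖₁, and the Gaussians only shrink as parameters
grow. It is used solely for being finite and uniform along the doublings. -/
theorem heatAdj_bdd {σ : ι → ℝ} (hσ : ∀ k, 0 < σ k) (u : ι → ConeSpace d → ℂ) :
    ∃ K : ℝ≥0∞, K ≠ ⊤ ∧ ∀ τ : ι → ℝ, (∀ k, σ k ≤ τ k) → heatAdj τ u ≤ K := by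
  set g : ConeSpace d → ℝ := fun ξ => ∑ k, gauss (heatVec d (σ k)) ξ * ∫ x, ‖u k x‖ with hg
  have hg0 : ∀ ξ, 0 ≤ g ξ := fun ξ => Finset.sum_nonneg fun k _ =>
    mul_nonneg (gauss_pos _ _).le (integral_nonneg fun x => norm_nonneg _)
  have hgi : Integrable g := integrable_finsetSum _ fun k _ =>
    (integrable_gauss (heatVec_pos (hσ k))).mul_const _
  have hgb : ∀ ξ, ‖g ξ‖ ≤ ∑ k, ∫ x, ‖u k x‖ := by
    intro ξ
    rw [Real.norm_of_nonneg (hg0 ξ)]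
    exact Finset.sum_le_sum fun k _ => mul_le_of_le_one_left
      (integral_nonneg fun x => norm_nonneg _) (gauss_le_one (fun i => (heatVec_pos (hσ k) i).le) ξ)
  have hg2 : Integrable fun ξ => g ξ * g ξ :=
    hgi.mul_bdd hgi.1 (Filter.Eventually.of_forall hgb)
  refine ⟨_, hg2.2.ne, fun τ hτ => lintegral_mono fun ξ => ?_⟩
  rw [enorm_mul, ← sq]
  refine pow_le_pow_left' ?_ 2
  rw [← ofReal_norm, ← ofReal_norm]
  refine ENNReal.ofReal_le_ofReal ((norm_sum_le _ _).trans ?_)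
  rw [Real.norm_of_nonneg (hg0 ξ)]
  refine Finset.sum_le_sum fun k _ => ?_
  rw [norm_mul, Complex.norm_real, Real.norm_of_nonneg (gauss_pos _ _).le]
  exact mul_le_mul (gauss_anti (heatVec_mono (hτ k)) ξ) (norm_invFT_le _ _) (norm_nonneg _)
    (gauss_pos _ _).le

/-- Closes the iteration τ, 2τ, 4τ, … of the square-root inequality; the constant depends neither on
the number of parameters nor on their values. -/
theorem heatAdj_le {τ : ι → ℝ} (hτ : ∀ k, 0 < τ k) {u : ι → ConeSpace d → ℂ}
    (hu : ∀ k, Integrable (u k)) :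
    heatAdj τ u ≤ ENNReal.ofReal (2 * √2 ^ (d + 1)) ^ 2 * ∫⁻ x, (∑ k, ‖u k x‖ₑ) ^ 2 := by
  set c : ℝ≥0∞ := ENNReal.ofReal (2 * √2 ^ (d + 1)) * (∫⁻ x, (∑ k, ‖u k x‖ₑ) ^ 2) ^ (1 / 2 : ℝ)
    with hc
  have hc2 : c ^ 2 = ENNReal.ofReal (2 * √2 ^ (d + 1)) ^ 2 * ∫⁻ x, (∑ k, ‖u k x‖ₑ) ^ 2 := by
    rw [hc, mul_pow, ← ENNReal.rpow_natCast (_ ^ (1 / 2 : ℝ)), ← ENNReal.rpow_mul]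
    norm_num
  rw [← hc2]
  -- One application of the inequality replaces u by |u|, and |u| then reproduces itself. The
  -- iteration therefore runs on w, starting from index 1, and one last application returns to u.
  set w : ι → ConeSpace d → ℂ := fun k x => (‖u k x‖ : ℂ) with hw
  have hwi : ∀ k, Integrable (w k) := fun k => (hu k).norm.complex_ofReal
  obtain ⟨K, hK, hKb⟩ := heatAdj_bdd hτ w
  have hstep : ∀ i : ℕ, heatAdj (fun k => 2 ^ i * τ k) w ≤
      c * heatAdj (fun k => 2 ^ (i + 1) * τ k) w ^ (1 / 2 : ℝ) := by
    intro i
    have := heatAdj_le_sqrt (τ := fun k => 2 ^ i * τ k)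
      (fun k => mul_pos (by positivity) (hτ k)) hwi
    have e : ∀ k x, ‖w k x‖ = ‖u k x‖ := fun k x => by simp [hw]
    have e' : ∀ k x, ‖w k x‖ₑ = ‖u k x‖ₑ := fun k x => by
      rw [← ofReal_norm, e, ofReal_norm]
    simp_rw [e', e] at this
    rw [hc]
    simp only [pow_succ' (2 : ℝ) i, mul_assoc] at this ⊢
    exact this
  have hb := ENNReal.le_sq_of_iterate hK
    (fun i => hKb (fun k => 2 ^ i * τ k) fun k => le_mul_of_one_le_left (hτ k).le
      (one_le_pow₀ (by norm_num))) hstep 1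
  calc heatAdj τ u ≤ c * heatAdj (fun k => 2 * τ k) w ^ (1 / 2 : ℝ) := heatAdj_le_sqrt hτ hu
    _ ≤ c * (c ^ 2) ^ (1 / 2 : ℝ) := by
        refine mul_le_mul' le_rfl (ENNReal.rpow_le_rpow ?_ (by norm_num))
        simpa using hb
    _ = c ^ 2 := by
        rw [← ENNReal.rpow_natCast c, ← ENNReal.rpow_mul]
        norm_num
        rw [sq]

/-- The Gaussian averages `∫ γ_τ(ξ) Φ(ξ) e^{2πi x·ξ} dξ`. -/
def heatMean (Φ : ConeSpace d → ℂ) (τ : ℝ) (x : ConeSpace d) : ℂ :=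
  invFT (fun ξ => (gauss (heatVec d τ) ξ : ℂ) * Φ ξ) x

theorem integrable_gauss_mul {b : Fin (d + 1) → ℝ} (hb : ∀ i, 0 < b i) {Φ : ConeSpace d → ℂ}
    (hΦ : MemLp Φ 2) : Integrable fun ξ => (gauss b ξ : ℂ) * Φ ξ := by
  have hg : MemLp (fun ξ : ConeSpace d => (gauss b ξ : ℂ)) 2 := by
    refine (memLp_two_iff_integrable_sq_norm
      (Complex.continuous_ofReal.comp (continuous_gauss b)).aestronglyMeasurable).2 ?_
    refine (integrable_gauss (b := b + b) fun i => add_pos (hb i) (hb i)).congr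
      (Filter.Eventually.of_forall fun ξ => ?_)
    simp only [← gauss_mul_gauss, Function.comp, Complex.norm_real,
      Real.norm_of_nonneg (gauss_pos _ _).le, sq]
  exact hg.integrable_mul hΦ

theorem integral_mul_invFT_comm {u h : ConeSpace d → ℂ} (hu : Integrable u) (hh : Integrable h) :
    ∫ x, u x * invFT h x = ∫ ξ, h ξ * invFT u ξ := by
  have h1 : ∀ x, u x * invFT h x = ∫ ξ, u x * (h ξ * coneChar x ξ) := fun x =>
    (integral_const_mul _ _).symm
  have h2 : ∀ ξ, h ξ * invFT u ξ = ∫ x, u x * (h ξ * coneChar x ξ) := fun ξ => by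
    unfold invFT
    rw [← integral_const_mul]
    refine integral_congr_ae (Filter.Eventually.of_forall fun x => ?_)
    simp only [coneChar_comm ξ]
    ring
  simp_rw [h1, h2]
  refine integral_integral_swap ?_
  have := (hu.mul_prod hh).mul_bdd (c := 1)
    (g := fun q : ConeSpace d × ConeSpace d => coneChar q.1 q.2)
    (Continuous.aestronglyMeasurable (by fun_prop))
    (Filter.Eventually.of_forall fun ξ => by simp)
  refine this.congr (Filter.Eventually.of_forall fun q => ?_)
  simp only [Function.uncurry]
  ring

/-- Duality with `heatAdj_le`: testing against the maximal function itself gives I ≤ ‖Φ‖₂ · c ·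
I^{1/2} for the integral I on the left. The family is finite and the domain a ball so that I is
known to be finite and can be absorbed. -/
theorem setLIntegral_ball_heatMean_le {ι : Type*} [Fintype ι] [Nonempty ι] {τ : ι → ℝ}
    (hτ : ∀ k, 0 < τ k) {Φ : ConeSpace d → ℂ} (hΦ : MemLp Φ 2) (r : ℝ) :
    ∫⁻ x in Metric.closedBall 0 r, (⨆ k, ‖heatMean Φ (τ k) x‖ₑ) ^ 2 ≤
      ENNReal.ofReal (2 * √2 ^ (d + 1)) ^ 2 * ∫⁻ ξ, ‖Φ ξ‖ₑ ^ 2 := by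
  classical
  set B : Set (ConeSpace d) := Metric.closedBall 0 r with hB
  have hBm : MeasurableSet B := measurableSet_closedBall
  have hBf : volume B ≠ ⊤ := (isCompact_closedBall (0 : ConeSpace d) r).measure_lt_top.ne
  set A : ι → ConeSpace d → ℂ := fun k => heatMean Φ (τ k) with hA
  have hAc : ∀ k, Continuous (A k) := fun k => continuous_invFT _
  have hAi : ∀ k, Integrable fun ξ => (gauss (heatVec d (τ k)) ξ : ℂ) * Φ ξ := fun k =>
    integrable_gauss_mul (heatVec_pos (hτ k)) hΦ
  set m : ConeSpace d → ℝ := fun x => Finset.univ.sup' Finset.univ_nonempty fun k => ‖A k x‖ with hm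
  have hmc : Continuous m := Continuous.finset_sup'_apply _ fun k _ => (hAc k).norm
  have hAm : ∀ k x, ‖A k x‖ ≤ m x := fun k x =>
    Finset.le_sup' (fun k => ‖A k x‖) (Finset.mem_univ k)
  have hm0 : ∀ x, 0 ≤ m x := fun x =>
    (norm_nonneg _).trans (hAm (Classical.arbitrary ι) x)
  set N : ConeSpace d → ℝ := fun x => ∑ k, if ‖A k x‖ = m x then 1 else 0 with hN
  have hset : ∀ k, MeasurableSet {x | ‖A k x‖ = m x} := fun k =>
    (isClosed_eq (hAc k).norm hmc).measurableSet
  have hNm : Measurable N := Finset.measurable_sum _ fun k _ =>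
    Measurable.ite (hset k) measurable_const measurable_const
  have hNpos : ∀ x, 0 < N x := by
    intro x
    obtain ⟨k, -, hk⟩ := Finset.exists_mem_eq_sup' Finset.univ_nonempty fun k => ‖A k x‖
    refine Finset.sum_pos' (fun k _ => by split_ifs <;> simp) ⟨k, Finset.mem_univ _, ?_⟩
    rw [if_pos hk.symm]
    norm_num
  -- The mass at x is shared equally among the indices attaining the maximum, which linearizes the
  -- supremum without a measurable selection.
  set wt : ι → ConeSpace d → ℝ := fun k x => (if ‖A k x‖ = m x then 1 else 0) / N x with hwt
  have hwt0 : ∀ k x, 0 ≤ wt k x := fun k x =>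
    div_nonneg (by split_ifs <;> simp) (hNpos x).le
  have hwtsum : ∀ x, ∑ k, wt k x = 1 := fun x => by
    simp only [hwt]
    rw [← Finset.sum_div]
    exact div_self (hNpos x).ne'
  have hwtA : ∀ k x, wt k x * ‖A k x‖ = wt k x * m x := by
    intro k x
    simp only [hwt]
    split_ifs with h
    · rw [h]
    · simp
  have hwt1 : ∀ k x, wt k x ≤ 1 := fun k x => by
    rw [← hwtsum x]
    exact Finset.single_le_sum (f := fun k => wt k x) (fun k _ => hwt0 k x) (Finset.mem_univ k)
  have hwtm : ∀ k, Measurable (wt k) := fun k =>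
    (Measurable.ite (hset k) measurable_const measurable_const).div hNm
  -- Chosen so that ∑ u_k A_k = m² and ∑ |u_k| = m on the ball.
  set u : ι → ConeSpace d → ℂ := fun k => B.indicator fun x => (wt k x : ℂ) * (starRingEnd ℂ) (A k x)
    with hu
  have hui : ∀ k, Integrable (u k) := by
    intro k
    refine (integrable_indicator_iff hBm).2 (IntegrableOn.of_bound hBf.lt_top
      (((Complex.measurable_ofReal.comp (hwtm k)).mul
        (Complex.continuous_conj.comp (hAc k)).measurable).aestronglyMeasurable)
      (∫ ξ, ‖(gauss (heatVec d (τ k)) ξ : ℂ) * Φ ξ‖)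
      (Filter.Eventually.of_forall fun x => ?_))
    rw [norm_mul, RCLike.norm_conj, Complex.norm_real, Real.norm_of_nonneg (hwt0 k x)]
    exact (mul_le_of_le_one_left (norm_nonneg _) (hwt1 k x)).trans (norm_invFT_le _ x)
  have hmsup : ∀ x, (⨆ k, ‖A k x‖ₑ) = ENNReal.ofReal (m x) := by
    intro x
    refine le_antisymm (iSup_le fun k => ?_) ?_
    · rw [← ofReal_norm]
      exact ENNReal.ofReal_le_ofReal (hAm k x)
    · obtain ⟨k, -, hk⟩ := Finset.exists_mem_eq_sup' Finset.univ_nonempty fun k => ‖A k x‖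
      refine le_trans ?_ (le_iSup _ k)
      rw [← ofReal_norm]
      exact ENNReal.ofReal_le_ofReal hk.le
  have husum : ∀ x, ∑ k, ‖u k x‖ₑ = B.indicator (fun x => ENNReal.ofReal (m x)) x := by
    intro x
    by_cases hx : x ∈ B
    · simp only [hu, indicator_of_mem hx]
      have : ∀ k, ‖(wt k x : ℂ) * (starRingEnd ℂ) (A k x)‖ₑ = ENNReal.ofReal (wt k x * m x) := by
        intro k
        rw [← ofReal_norm, norm_mul, RCLike.norm_conj, Complex.norm_real,
          Real.norm_of_nonneg (hwt0 k x), hwtA]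
      simp_rw [this]
      rw [← ENNReal.ofReal_sum_of_nonneg fun k _ => mul_nonneg (hwt0 k x) (hm0 x),
        ← Finset.sum_mul, hwtsum, one_mul]
    · simp [hu, hx]
  have hsq : ∫⁻ x, (∑ k, ‖u k x‖ₑ) ^ 2 = ∫⁻ x in B, (⨆ k, ‖A k x‖ₑ) ^ 2 := by
    rw [← lintegral_indicator hBm]
    refine lintegral_congr fun x => ?_
    rw [husum]
    by_cases hx : x ∈ B <;> simp [hx, hmsup]
  have hm2 : IntegrableOn (fun x => m x ^ 2) B :=
    (hmc.pow 2).continuousOn.integrableOn_compact (isCompact_closedBall 0 r)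
  have hDreal : ∫⁻ x in B, (⨆ k, ‖A k x‖ₑ) ^ 2 = ENNReal.ofReal (∫ x in B, m x ^ 2) := by
    rw [ofReal_integral_eq_lintegral_ofReal hm2 (Filter.Eventually.of_forall fun x => by positivity)]
    refine lintegral_congr fun x => ?_
    rw [hmsup, ENNReal.ofReal_pow (hm0 x)]
  have hpair : ((∫ x in B, m x ^ 2 : ℝ) : ℂ) =
      ∫ ξ, Φ ξ * ∑ k, (gauss (heatVec d (τ k)) ξ : ℂ) * invFT (u k) ξ := by
    have e1 : ∀ k, ∫ x, u k x * A k x =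
        ∫ ξ, (gauss (heatVec d (τ k)) ξ : ℂ) * Φ ξ * invFT (u k) ξ := fun k =>
      integral_mul_invFT_comm (hui k) (hAi k)
    have e2 : ∀ k, Integrable fun x => u k x * A k x := fun k =>
      (hui k).mul_bdd (hAc k).aestronglyMeasurable
        (Filter.Eventually.of_forall fun x => norm_invFT_le _ x)
    have e3 : ∀ k, Integrable fun ξ => (gauss (heatVec d (τ k)) ξ : ℂ) * Φ ξ * invFT (u k) ξ :=
      fun k => (hAi k).mul_bdd (continuous_invFT _).aestronglyMeasurable
        (Filter.Eventually.of_forall fun x => norm_invFT_le _ x)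
    calc ((∫ x in B, m x ^ 2 : ℝ) : ℂ) = ∫ x, ∑ k, u k x * A k x := by
          rw [← integral_complex_ofReal, ← integral_indicator hBm]
          refine integral_congr_ae (Filter.Eventually.of_forall fun x => ?_)
          by_cases hx : x ∈ B
          · simp only [hu, indicator_of_mem hx]
            have : ∀ k, (wt k x : ℂ) * (starRingEnd ℂ) (A k x) * A k x =
                ((wt k x * m x ^ 2 : ℝ) : ℂ) := by
              intro k
              have h1 : wt k x * ‖A k x‖ ^ 2 = wt k x * m x ^ 2 := by
                rw [sq, ← mul_assoc, hwtA, mul_right_comm, hwtA]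
                ring
              rw [← h1, mul_assoc, mul_comm ((starRingEnd ℂ) (A k x)), Complex.mul_conj,
                Complex.normSq_eq_norm_sq]
              push_cast
              rfl
            simp_rw [this]
            rw [← Complex.ofReal_sum, ← Finset.sum_mul, hwtsum, one_mul]
          · simp [hu, hx]
      _ = ∑ k, ∫ x, u k x * A k x := integral_finsetSum _ fun k _ => e2 k
      _ = ∑ k, ∫ ξ, (gauss (heatVec d (τ k)) ξ : ℂ) * Φ ξ * invFT (u k) ξ :=
          Finset.sum_congr rfl fun k _ => e1 k
      _ = _ := by
          rw [← integral_finsetSum _ fun k _ => e3 k]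
          refine integral_congr_ae (Filter.Eventually.of_forall fun ξ => ?_)
          simp only [Finset.mul_sum]
          exact Finset.sum_congr rfl fun k _ => by ring
  have hle : ENNReal.ofReal (∫ x in B, m x ^ 2) ≤
      (∫⁻ ξ, ‖Φ ξ‖ₑ ^ 2) ^ (1 / 2 : ℝ) * heatAdj τ u ^ (1 / 2 : ℝ) := by
    calc _ ≤ ‖((∫ x in B, m x ^ 2 : ℝ) : ℂ)‖ₑ := by
          rw [← ofReal_norm, Complex.norm_real]
          exact ENNReal.ofReal_le_ofReal (le_abs_self _)
      _ ≤ ∫⁻ ξ, ‖Φ ξ‖ₑ * ‖∑ k, (gauss (heatVec d (τ k)) ξ : ℂ) * invFT (u k) ξ‖ₑ := by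
          rw [hpair]
          refine (enorm_integral_le_lintegral_enorm _).trans_eq ?_
          simp_rw [enorm_mul]
      _ ≤ _ := by
          refine ENNReal.lintegral_mul_le_sqrt hΦ.1.enorm ?_
          refine (Continuous.measurable ?_).enorm.aemeasurable
          exact continuous_finsetSum _ fun k _ =>
            (Complex.continuous_ofReal.comp (continuous_gauss _)).mul (continuous_invFT _)
  have hadj := heatAdj_le hτ hui
  rw [hsq, hDreal] at hadj
  change ∫⁻ x in B, (⨆ k, ‖A k x‖ₑ) ^ 2 ≤ _
  rw [hDreal]
  have hsqrt : ∀ a : ℝ≥0∞, (a ^ 2) ^ (1 / 2 : ℝ) = a := fun a => by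
    rw [← ENNReal.rpow_natCast a, ← ENNReal.rpow_mul]
    norm_num
  have hsqrt' : ∀ a : ℝ≥0∞, (a ^ (1 / 2 : ℝ)) ^ 2 = a := fun a => by
    rw [← ENNReal.rpow_natCast (a ^ (1 / 2 : ℝ)), ← ENNReal.rpow_mul]
    norm_num
  refine (ENNReal.le_sq_of_le_mul_sqrt (c := (∫⁻ ξ, ‖Φ ξ‖ₑ ^ 2) ^ (1 / 2 : ℝ) *
    ENNReal.ofReal (2 * √2 ^ (d + 1))) ENNReal.ofReal_ne_top ?_).trans_eq ?_
  · refine hle.trans ?_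
    rw [mul_assoc]
    refine mul_le_mul' le_rfl ((ENNReal.rpow_le_rpow hadj (by norm_num)).trans_eq ?_)
    rw [ENNReal.mul_rpow_of_nonneg _ _ (by norm_num), hsqrt]
  · rw [mul_pow, hsqrt', mul_comm]

theorem lintegral_iSup_heatMean_fintype_le {ι : Type*} [Fintype ι] [Nonempty ι] {τ : ι → ℝ}
    (hτ : ∀ k, 0 < τ k) {Φ : ConeSpace d → ℂ} (hΦ : MemLp Φ 2) :
    ∫⁻ x, (⨆ k, ‖heatMean Φ (τ k) x‖ₑ) ^ 2 ≤
      ENNReal.ofReal (2 * √2 ^ (d + 1)) ^ 2 * ∫⁻ ξ, ‖Φ ξ‖ₑ ^ 2 := by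
  rw [← setLIntegral_univ, ← Metric.iUnion_closedBall_nat (0 : ConeSpace d),
    setLIntegral_iUnion_of_directed]
  · exact iSup_le fun n => setLIntegral_ball_heatMean_le hτ hΦ n
  · exact (monotone_nat_of_le_succ fun n => Metric.closedBall_subset_closedBall
      (by push_cast; linarith)).directed_le

theorem measurable_heatMean (Φ : ConeSpace d → ℂ) (τ : ℝ) : Measurable (heatMean Φ τ) :=
  (continuous_invFT _).measurable

theorem lintegral_iSup_heatMean_nat_le {τ : ℕ → ℝ} (hτ : ∀ k, 0 < τ k) {Φ : ConeSpace d → ℂ}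
    (hΦ : MemLp Φ 2) :
    ∫⁻ x, (⨆ k, ‖heatMean Φ (τ k) x‖ₑ) ^ 2 ≤
      ENNReal.ofReal (2 * √2 ^ (d + 1)) ^ 2 * ∫⁻ ξ, ‖Φ ξ‖ₑ ^ 2 := by
  have h1 : ∀ x, (⨆ k, ‖heatMean Φ (τ k) x‖ₑ) ^ 2 =
      ⨆ n : ℕ, (⨆ k : Fin (n + 1), ‖heatMean Φ (τ k) x‖ₑ) ^ 2 := by
    intro x
    refine le_antisymm ?_ (iSup_le fun n => pow_le_pow_left'
      (iSup_le fun k : Fin (n + 1) => le_iSup (fun k : ℕ => ‖heatMean Φ (τ k) x‖ₑ) (k : ℕ)) 2)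
    rw [← ENNReal.iSup_pow]
    exact pow_le_pow_left' (iSup_le fun k =>
      le_iSup_of_le k (le_iSup_of_le (Fin.last k) (by simp))) 2
  simp_rw [h1]
  rw [lintegral_iSup]
  · exact iSup_le fun n => lintegral_iSup_heatMean_fintype_le
      (τ := fun k : Fin (n + 1) => τ k) (fun k => hτ k) hΦ
  · exact fun n => (Measurable.iSup fun k => (measurable_heatMean Φ _).enorm).pow_const 2
  · intro n n' hn x
    refine pow_le_pow_left' (iSup_le fun k => ?_) 2
    exact le_iSup (fun k : Fin (n' + 1) => ‖heatMean Φ (τ k) x‖ₑ)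
      ⟨k, k.2.trans_le (by omega)⟩

theorem continuous_heatMean_time {Φ : ConeSpace d → ℂ} (hΦ : MemLp Φ 2) (x : ConeSpace d) :
    Continuous fun τ : Ioi (0 : ℝ) => heatMean Φ τ x := by
  rw [continuous_iff_continuousAt]
  intro τ₀
  have hτ₀ : 0 < (τ₀ : ℝ) := τ₀.2
  refine continuousAt_of_dominated (bound := fun ξ => ‖(gauss (heatVec d (τ₀ / 2)) ξ : ℂ) * Φ ξ‖)
    ?_ ?_ ?_ ?_
  · exact Filter.Eventually.of_forall fun τ => ((integrable_mul_coneChar_iff x).2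
      (integrable_gauss_mul (heatVec_pos τ.2) hΦ)).1
  · have : ∀ᶠ τ : Ioi (0 : ℝ) in nhds τ₀, (τ₀ : ℝ) / 2 < τ :=
      continuous_subtype_val.continuousAt.eventually (lt_mem_nhds (by linarith))
    filter_upwards [this] with τ hτ
    refine Filter.Eventually.of_forall fun ξ => ?_
    rw [norm_mul, norm_coneChar, mul_one, norm_mul, norm_mul, Complex.norm_real, Complex.norm_real,
      Real.norm_of_nonneg (gauss_pos _ _).le, Real.norm_of_nonneg (gauss_pos _ _).le]
    exact mul_le_mul_of_nonneg_right (gauss_anti (heatVec_mono hτ.le) ξ) (norm_nonneg _)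
  · exact (integrable_gauss_mul (heatVec_pos (by positivity)) hΦ).norm
  · refine Filter.Eventually.of_forall fun ξ => Continuous.continuousAt ?_
    refine Continuous.mul (Continuous.mul (Complex.continuous_ofReal.comp ?_) continuous_const)
      continuous_const
    unfold gauss
    refine Real.continuous_exp.comp (Continuous.neg (Continuous.mul continuous_const
      (continuous_finsetSum _ fun i _ => Continuous.mul ?_ continuous_const)))
    unfold heatVec
    split_ifs
    · exact continuous_const
    · exact continuous_subtype_val

/-- The `L²` maximal inequality for the Gaussian averages. -/
theorem lintegral_iSup_heatMean_le {Φ : ConeSpace d → ℂ} (hΦ : MemLp Φ 2) :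
    ∫⁻ x, (⨆ τ : Ioi (0 : ℝ), ‖heatMean Φ τ x‖ₑ) ^ 2 ≤
      ENNReal.ofReal (2 * √2 ^ (d + 1)) ^ 2 * ∫⁻ ξ, ‖Φ ξ‖ₑ ^ 2 := by
  have : Nonempty (Ioi (0 : ℝ)) := ⟨⟨1, mem_Ioi.2 one_pos⟩⟩
  refine le_trans (lintegral_mono fun x => pow_le_pow_left' (iSup_le fun τ => ?_) 2)
    (lintegral_iSup_heatMean_nat_le
      (τ := fun n => (TopologicalSpace.denseSeq (Ioi (0 : ℝ)) n : ℝ)) (fun k => Subtype.property _) hΦ)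
  -- By continuity in τ, the supremum over all parameters is already that over a dense sequence.
  refine DenseRange.induction_on (TopologicalSpace.denseRange_denseSeq (Ioi (0 : ℝ))) τ
    (p := fun τ => ‖heatMean Φ τ x‖ₑ ≤ _) ?_ fun n =>
      le_iSup (fun k => ‖heatMean Φ (TopologicalSpace.denseSeq (Ioi (0 : ℝ)) k) x‖ₑ) n
  exact isClosed_le (continuous_heatMean_time hΦ x).enorm continuous_const

/-! ### The invariant measure dv/v and truncated powers -/

theorem Real.rpow_le_rpow_abs {x c : ℝ} (a : ℝ) (hc : 0 < c) (h1 : c⁻¹ ≤ x) (h2 : x ≤ c) :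
    x ^ a ≤ c ^ |a| := by
  have hx : 0 < x := (inv_pos.2 hc).trans_le h1
  rcases le_total 0 a with ha | ha
  · rw [abs_of_nonneg ha]
    exact Real.rpow_le_rpow hx.le h2 ha
  · rw [abs_of_nonpos ha]
    calc x ^ a ≤ (c⁻¹) ^ a := Real.rpow_le_rpow_of_nonpos (inv_pos.2 hc) h1 ha
      _ = c ^ (-a) := by rw [Real.inv_rpow hc.le, Real.rpow_neg hc.le]

/-- Invariance of `dv/v` under `v ↦ c v^p`. -/
theorem lintegral_comp_mul_rpow_le {c p : ℝ} (hc : 0 < c) (hp : p ≠ 0) (g : ℝ → ℝ≥0∞) :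
    ENNReal.ofReal |p| * ∫⁻ v in Ioi (0 : ℝ), g (c * v ^ p) * ENNReal.ofReal v⁻¹ ≤
      ∫⁻ w in Ioi (0 : ℝ), g w * ENNReal.ofReal w⁻¹ := by
  have himg : (fun v : ℝ => c * v ^ p) '' Ioi 0 ⊆ Ioi 0 := by
    rintro _ ⟨v, hv, rfl⟩
    exact mul_pos hc (Real.rpow_pos_of_pos hv p)
  have hinj : InjOn (fun v : ℝ => c * v ^ p) (Ioi 0) := by
    intro v hv w hw h
    exact (Real.rpow_left_injOn hp) (mem_Ioi.1 hv).le (mem_Ioi.1 hw).le (mul_left_cancel₀ hc.ne' h)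
  refine le_trans (le_of_eq ?_) (lintegral_mono_set himg)
  rw [lintegral_image_eq_lintegral_abs_deriv_mul measurableSet_Ioi
    (f' := fun v => c * (p * v ^ (p - 1)))
    (fun v hv => ((Real.hasDerivAt_rpow_const (Or.inl (ne_of_gt hv))).const_mul c).hasDerivWithinAt)
    hinj, ← lintegral_const_mul' _ _ ENNReal.ofReal_ne_top]
  refine setLIntegral_congr_fun measurableSet_Ioi fun v hv => ?_
  have hv0 : 0 < v := hv
  have hvp : 0 < v ^ p := Real.rpow_pos_of_pos hv0 p
  rw [mul_left_comm, mul_left_comm (ENNReal.ofReal _), ← ENNReal.ofReal_mul (abs_nonneg _),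
    ← ENNReal.ofReal_mul (abs_nonneg _)]
  congr 2
  rw [abs_mul, abs_mul, abs_of_pos hc, abs_of_pos (Real.rpow_pos_of_pos hv0 _),
    Real.rpow_sub_one hv0.ne']
  field_simp

theorem truncPow_of_pos {r : ℝ} (hr : 0 < r) (a : ℝ) : truncPow r a = r ^ a := if_pos hr

theorem truncPow_of_nonpos {r : ℝ} (hr : r ≤ 0) (a : ℝ) : truncPow r a = 0 := if_neg hr.not_gt

theorem truncPow_nonneg (r a : ℝ) : 0 ≤ truncPow r a := by
  unfold truncPow
  split_ifs with h
  · exact (Real.rpow_pos_of_pos h a).le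
  · exact le_rfl

theorem truncPow_sq (r a : ℝ) : truncPow r a ^ 2 = truncPow r (2 * a) := by
  unfold truncPow
  split_ifs with h
  · rw [two_mul, Real.rpow_add h, sq]
  · simp

theorem truncPow_mul {c : ℝ} (hc : 0 < c) (r a : ℝ) :
    truncPow (c * r) a = c ^ a * truncPow r a := by
  rcases le_or_gt r 0 with h | h
  · rw [truncPow_of_nonpos h, truncPow_of_nonpos (mul_nonpos_of_nonneg_of_nonpos hc.le h), mul_zero]
  · rw [truncPow_of_pos h, truncPow_of_pos (mul_pos hc h), Real.mul_rpow hc.le h.le]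

theorem measurable_truncPow (a : ℝ) : Measurable fun r => truncPow r a := by
  unfold truncPow
  exact Measurable.ite measurableSet_Ioi (measurable_id.pow_const a) measurable_const

@[fun_prop]
theorem Measurable.truncPow {X : Type*} [MeasurableSpace X] {f : X → ℝ} (hf : Measurable f)
    (a : ℝ) : Measurable fun x => truncPow (f x) a :=
  (measurable_truncPow a).comp hf

theorem lintegral_truncPow_Iic {p L : ℝ} (hp : -1 < p) (hL : 0 ≤ L) :
    ∫⁻ v in Iic L, ENNReal.ofReal (truncPow v p) = ENNReal.ofReal (L ^ (p + 1) / (p + 1)) := by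
  have h1 : ∫⁻ v in Iic L, ENNReal.ofReal (truncPow v p) =
      ∫⁻ v in Ioc 0 L, ENNReal.ofReal (v ^ p) := by
    rw [← lintegral_indicator measurableSet_Iic, ← lintegral_indicator measurableSet_Ioc]
    refine lintegral_congr fun v => ?_
    by_cases h0 : 0 < v
    · by_cases hv : v ≤ L
      · rw [indicator_of_mem (mem_Iic.2 hv), indicator_of_mem (mem_Ioc.2 ⟨h0, hv⟩),
          truncPow_of_pos h0]
      · rw [indicator_of_notMem (by simpa using hv), indicator_of_notMem (fun h => hv h.2)]
    · rw [indicator_of_notMem (s := Ioc 0 L) (fun h => h0 h.1)]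
      by_cases hv : v ≤ L
      · rw [indicator_of_mem (mem_Iic.2 hv), truncPow_of_nonpos (not_lt.1 h0), ENNReal.ofReal_zero]
      · rw [indicator_of_notMem (by simpa using hv)]
  have hint : IntegrableOn (fun v : ℝ => v ^ p) (Ioc 0 L) :=
    (intervalIntegrable_iff_integrableOn_Ioc_of_le hL).1 (intervalIntegral.intervalIntegrable_rpow' hp)
  rw [h1, ← ofReal_integral_eq_lintegral_ofReal hint
    ((ae_restrict_mem measurableSet_Ioc).mono fun v hv => Real.rpow_nonneg hv.1.le p),
    ← intervalIntegral.integral_of_le hL, integral_rpow (Or.inl hp), Real.zero_rpow (by linarith),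
    sub_zero]

theorem lintegral_truncPow_sub_left {p L c : ℝ} (hp : -1 < p) (hL : 0 ≤ L) :
    ∫⁻ v in Ici (c - L), ENNReal.ofReal (truncPow (c - v) p) =
      ENNReal.ofReal (L ^ (p + 1) / (p + 1)) := by
  rw [← lintegral_truncPow_Iic hp hL, ← lintegral_indicator measurableSet_Ici,
    ← lintegral_indicator measurableSet_Iic, ← lintegral_sub_left_eq_self _ c]
  refine lintegral_congr fun v => ?_
  simp only [indicator, mem_Ici, mem_Iic, sub_sub_cancel]
  congr 1
  rw [eq_iff_iff]
  constructor <;> intro h <;> linarith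

theorem lintegral_truncPow_sub_right {p L c : ℝ} (hp : -1 < p) (hL : 0 ≤ L) :
    ∫⁻ v in Iic (c + L), ENNReal.ofReal (truncPow (v - c) p) =
      ENNReal.ofReal (L ^ (p + 1) / (p + 1)) := by
  rw [← lintegral_truncPow_Iic hp hL, ← lintegral_indicator measurableSet_Iic,
    ← lintegral_indicator measurableSet_Iic,
    ← lintegral_sub_right_eq_self ((Iic L).indicator fun v => ENNReal.ofReal (truncPow v p)) c]
  refine lintegral_congr fun v => ?_
  simp only [indicator, mem_Iic]
  congr 1
  rw [eq_iff_iff]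
  constructor <;> intro h <;> linarith

/-! ### Semicontinuity, slabs, cutoffs and Plancherel with parameters -/

/-- Fatou's lemma as lower semicontinuity of an integral in a parameter. -/
theorem lowerSemicontinuous_lintegral {X Y : Type*} [MeasurableSpace Y] {μ : Measure Y}
    [TopologicalSpace X] [FirstCountableTopology X] {g : X → Y → ℝ≥0∞}
    (hm : ∀ x, AEMeasurable (g x) μ) (hc : ∀ y, Continuous fun x => g x y) :
    LowerSemicontinuous fun x => ∫⁻ y, g x y ∂μ := by
  rw [lowerSemicontinuous_iff_le_liminf]
  intro x
  refine le_trans (lintegral_mono fun y => ?_) (lintegral_liminf_le' hm)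
  exact ((hc y).tendsto x).liminf_eq.ge

theorem slopeSq_nonneg (ξ : ConeSpace d) : 0 ≤ slopeSq ξ :=
  div_nonneg (Finset.sum_nonneg fun _ _ => sq_nonneg _) (sq_nonneg _)

@[fun_prop]
theorem measurable_slopeSq : Measurable (slopeSq (d := d)) := by
  unfold slopeSq
  fun_prop

theorem slopeSq_mul_sq {ξ : ConeSpace d} (h : ξ (Fin.last d) ≠ 0) :
    slopeSq ξ * ξ (Fin.last d) ^ 2 = ∑ i : Fin d, ξ i.castSucc ^ 2 := by
  unfold slopeSq
  field_simp

/-- The part of the cone shell `ξ_n ∈ [1/2, 2]` with slope squared at most `R`. -/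
def coneSlab (d : ℕ) (R : ℝ) : Set (ConeSpace d) :=
  {ξ | ξ (Fin.last d) ∈ Icc (1 / 2 : ℝ) 2 ∧ slopeSq ξ ≤ R}

theorem measurableSet_coneSlab (R : ℝ) : MeasurableSet (coneSlab d R) := by
  refine MeasurableSet.inter ?_ (measurableSet_le measurable_slopeSq measurable_const)
  exact measurableSet_Icc.preimage (by fun_prop : Measurable fun ξ : ConeSpace d => ξ (Fin.last d))

theorem volume_coneSlab_lt_top (R : ℝ) : volume (coneSlab d R) < ⊤ := by
  refine lt_of_le_of_lt (measure_mono ?_)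
    (isCompact_closedBall (0 : ConeSpace d) (√(4 * R + 4))).measure_lt_top
  rintro ξ ⟨⟨h1, h2⟩, h3⟩
  rw [mem_closedBall_zero_iff, EuclideanSpace.norm_eq]
  refine Real.sqrt_le_sqrt ?_
  simp only [Real.norm_eq_abs, sq_abs]
  rw [Fin.sum_univ_castSucc, ← slopeSq_mul_sq (by linarith)]
  have h4 : ξ (Fin.last d) ^ 2 ≤ 4 := by nlinarith
  nlinarith [slopeSq_nonneg ξ, sq_nonneg (ξ (Fin.last d))]

namespace IsConeCutoff

variable {φ : ℝ → ℂ}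

theorem continuous (hφ : IsConeCutoff φ) : Continuous φ := hφ.1.continuous

theorem eq_zero (hφ : IsConeCutoff φ) {s : ℝ} (hs : s ∉ Icc (1 / 2 : ℝ) 2) : φ s = 0 :=
  image_eq_zero_of_notMem_tsupport fun h => hs (hφ.2 h)

theorem exists_bound (hφ : IsConeCutoff φ) : ∃ M : ℝ, 0 ≤ M ∧ ∀ s, ‖φ s‖ ≤ M := by
  have hc : HasCompactSupport φ := isCompact_Icc.of_isClosed_subset (isClosed_tsupport φ) hφ.2
  obtain ⟨M, hM⟩ := hc.exists_bound_of_continuous hφ.continuous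
  exact ⟨M, (norm_nonneg _).trans (hM 0), hM⟩

theorem deriv (hφ : IsConeCutoff φ) : IsConeCutoff (deriv φ) :=
  ⟨hφ.1.deriv' , (tsupport_deriv_subset).trans hφ.2⟩

theorem hasDerivAt (hφ : IsConeCutoff φ) (s : ℝ) : HasDerivAt φ (_root_.deriv φ s) s :=
  (hφ.1.differentiable (by simp)).differentiableAt.hasDerivAt

end IsConeCutoff

theorem measurable_invFT_param {Y : Type*} [MeasurableSpace Y]
    {h : Y → ConeSpace d → ℂ} (hh : Measurable (Function.uncurry h)) :
    Measurable fun p : ConeSpace d × Y => invFT (h p.2) p.1 := by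
  have h1 : Measurable fun p : Y × ConeSpace d => invFT (h p.1) p.2 :=
    (stronglyMeasurable_invFT_param hh).measurable
  generalize hG : (fun p : Y × ConeSpace d => invFT (h p.1) p.2) = G at h1
  have : (fun p : ConeSpace d × Y => invFT (h p.2) p.1) = fun p => G p.swap := by
    rw [← hG]
    rfl
  rw [this]
  exact h1.comp measurable_swap

/-- A square function bound: Plancherel's inequality integrated over parameters. -/
theorem lintegral_lintegral_invFT_sq_le {Y : Type*} [MeasurableSpace Y] {μ : Measure Y} [SFinite μ]
    {h : Y → ConeSpace d → ℂ} (hh : Measurable (Function.uncurry h)) {ρ : Y → ℝ≥0∞}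
    (hρ : Measurable ρ) :
    ∫⁻ x, ∫⁻ y, ρ y * ‖invFT (h y) x‖ₑ ^ 2 ∂μ ≤ ∫⁻ ξ, ∫⁻ y, ρ y * ‖h y ξ‖ₑ ^ 2 ∂μ := by
  have hm := (stronglyMeasurable_invFT_param hh).measurable
  have hm1 : Measurable fun p : Y × ConeSpace d => ρ p.1 * ‖invFT (h p.1) p.2‖ₑ ^ 2 :=
    (hρ.comp measurable_fst).mul (hm.enorm.pow_const 2)
  have hm2 : Measurable fun p : Y × ConeSpace d => ρ p.1 * ‖h p.1 p.2‖ₑ ^ 2 :=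
    (hρ.comp measurable_fst).mul ((hh.enorm).pow_const 2)
  rw [← lintegral_lintegral_swap (f := fun y x => ρ y * ‖invFT (h y) x‖ₑ ^ 2) hm1.aemeasurable,
    ← lintegral_lintegral_swap (f := fun y ξ => ρ y * ‖h y ξ‖ₑ ^ 2) hm2.aemeasurable]
  refine lintegral_mono fun y => ?_
  have h1 : Measurable (h y) := hh.comp (measurable_const.prodMk measurable_id)
  rw [lintegral_const_mul _ ((continuous_invFT _).measurable.enorm.pow_const 2),
    lintegral_const_mul _ (h1.enorm.pow_const 2)]
  exact mul_le_mul' le_rfl (lintegral_invFT_sq_le _)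

theorem lintegral_fourier_sq (f : ConeL2 d) :
    ∫⁻ ξ, ‖(𝓕 f : ConeL2 d) ξ‖ₑ ^ 2 = ‖f‖ₑ ^ 2 := by
  have h1 : ‖(𝓕 f : ConeL2 d)‖ₑ = ‖f‖ₑ := by
    rw [← ofReal_norm, ← ofReal_norm, Lp.norm_fourier_eq]
  rw [← h1, Lp.enorm_def, eLpNorm_eq_lintegral_rpow_enorm_toReal (by norm_num) (by norm_num),
    ← ENNReal.rpow_natCast (_ ^ _), ← ENNReal.rpow_mul]
  simp

theorem eLpNorm_two_enn {X : Type*} [MeasurableSpace X] {μ : Measure X} (g : X → ℝ≥0∞) :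
    eLpNorm g 2 μ = (∫⁻ x, g x ^ 2 ∂μ) ^ (1 / 2 : ℝ) := by
  rw [eLpNorm_eq_lintegral_rpow_enorm_toReal (by norm_num) (by norm_num)]
  simp

theorem ENNReal.add_sq_le (a b : ℝ≥0∞) : (a + b) ^ 2 ≤ 2 * a ^ 2 + 2 * b ^ 2 := by
  calc (a + b) ^ 2 = a ^ 2 + b ^ 2 + 2 * a * b := by ring
    _ ≤ a ^ 2 + b ^ 2 + (a ^ 2 + b ^ 2) :=
        add_le_add le_rfl (ENNReal.two_mul_mul_le_add_sq a b)
    _ = _ := by ring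

/-! ### Linear cone multipliers: comparison with Gaussian averages -/

theorem abs_one_sub_rpow_sub_one_le (ν : ℝ) {u : ℝ} (h0 : 0 ≤ u) (h1 : u ≤ 1 / 2) :
    |(1 - u) ^ ν - 1| ≤ |ν| * 2 ^ |ν - 1| * u := by
  have := Convex.norm_image_sub_le_of_norm_hasDerivWithin_le (𝕜 := ℝ) (s := Icc (1 / 2 : ℝ) 1)
    (f := fun y : ℝ => y ^ ν) (f' := fun y => ν * y ^ (ν - 1)) (C := |ν| * 2 ^ |ν - 1|)
    (x := 1) (y := 1 - u)
    (fun y hy => (Real.hasDerivAt_rpow_const (Or.inl (by linarith [hy.1]))).hasDerivWithinAt)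
    (fun y hy => by
      rw [Real.norm_eq_abs, abs_mul, abs_of_nonneg (Real.rpow_nonneg (by linarith [hy.1]) _)]
      exact mul_le_mul_of_nonneg_left (Real.rpow_le_rpow_abs _ two_pos
        (by linarith [hy.1]) (by linarith [hy.2])) (abs_nonneg _))
    (convex_Icc _ _) (by norm_num) ⟨by linarith, by linarith⟩
  simpa [Real.norm_eq_abs, abs_of_nonneg h0] using this

/-- Both profiles equal 1 at u = 0 with bounded slope nearby, so the difference is O(u) and beats
du/u. Away from 0 the weight is harmless: (1-u)_+^{2ν} is integrable for 2ν > -1 and the exponential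
decays. The range of b is that of πξ_n² for ξ_n in [1/2, 2]. -/
theorem lintegral_truncPow_sub_exp_le {ν : ℝ} (hν : -(1 / 2) < ν) :
    ∃ C : ℝ≥0, ∀ b ∈ Icc (Real.pi / 4) (4 * Real.pi),
      ∫⁻ u in Ioi (0 : ℝ), ENNReal.ofReal ((truncPow (1 - u) ν - Real.exp (-(b * u))) ^ 2) *
        ENNReal.ofReal u⁻¹ ≤ C := by
  set L : ℝ := |ν| * 2 ^ |ν - 1| + 4 * Real.pi with hL
  have hL0 : 0 ≤ L := by positivity
  set G : ℝ → ℝ≥0∞ := fun u => (Iic (1 : ℝ)).indicator (fun _ => ENNReal.ofReal (L ^ 2)) u +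
    (4 * ENNReal.ofReal (truncPow (1 - u) (2 * ν)) + 4 * ENNReal.ofReal (Real.exp (-u))) with hG
  have hGint : ∫⁻ u in Ioi (0 : ℝ), G u ≠ ⊤ := by
    have m1 : Measurable fun u : ℝ => (Iic (1 : ℝ)).indicator (fun _ => ENNReal.ofReal (L ^ 2)) u :=
      measurable_const.indicator measurableSet_Iic
    have m2 : Measurable fun u : ℝ => 4 * ENNReal.ofReal (truncPow (1 - u) (2 * ν)) := by fun_prop
    simp only [hG]
    rw [lintegral_add_left m1, lintegral_add_left m2]
    refine ENNReal.add_ne_top.2 ⟨?_, ENNReal.add_ne_top.2 ⟨?_, ?_⟩⟩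
    · rw [lintegral_indicator_const measurableSet_Iic, Measure.restrict_apply measurableSet_Iic,
        Iic_inter_Ioi, Real.volume_Ioc]
      exact ENNReal.mul_ne_top ENNReal.ofReal_ne_top ENNReal.ofReal_ne_top
    · rw [lintegral_const_mul' _ _ (by simp)]
      refine ENNReal.mul_ne_top (by simp) (ne_top_of_le_ne_top (b := ∫⁻ v in Ici ((1 : ℝ) - 1),
        ENNReal.ofReal (truncPow (1 - v) (2 * ν))) ?_ (lintegral_mono_set ?_))
      · rw [lintegral_truncPow_sub_left (by linarith) zero_le_one]
        exact ENNReal.ofReal_ne_top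
      · rw [sub_self]
        exact Ioi_subset_Ici_self
    · rw [lintegral_const_mul' _ _ (by simp)]
      refine ENNReal.mul_ne_top (by simp) ?_
      rw [← ofReal_integral_eq_lintegral_ofReal (integrableOn_exp_neg_Ioi 0)
        (Filter.Eventually.of_forall fun u => (Real.exp_pos _).le)]
      exact ENNReal.ofReal_ne_top
  refine ⟨(∫⁻ u in Ioi (0 : ℝ), G u).toNNReal, fun b hb => ?_⟩
  rw [ENNReal.coe_toNNReal hGint]
  refine setLIntegral_mono' measurableSet_Ioi fun u hu => ?_
  have hu0 : 0 < u := hu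
  have hb0 : 0 < b := lt_of_lt_of_le (by positivity) hb.1
  rw [← ENNReal.ofReal_mul (sq_nonneg _)]
  rcases le_or_gt u (1 / 2) with h | h
  · refine le_trans ?_ le_self_add
    rw [indicator_of_mem (mem_Iic.2 (by linarith))]
    refine ENNReal.ofReal_le_ofReal ?_
    have h1 := abs_one_sub_rpow_sub_one_le ν hu0.le h
    have h2 : |1 - Real.exp (-(b * u))| ≤ 4 * Real.pi * u := by
      rw [abs_of_nonneg (by
        rw [sub_nonneg, Real.exp_le_one_iff]
        exact neg_nonpos.2 (by positivity))]
      have := Real.add_one_le_exp (-(b * u))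
      nlinarith [hb.2]
    have h3 : |truncPow (1 - u) ν - Real.exp (-(b * u))| ≤ L * u := by
      rw [truncPow_of_pos (by linarith)]
      calc _ = |((1 - u) ^ ν - 1) + (1 - Real.exp (-(b * u)))| := by congr 1; ring
        _ ≤ _ := abs_add_le _ _
        _ ≤ _ := by rw [hL, add_mul]; exact add_le_add h1 h2
    have h4 := pow_le_pow_left₀ (abs_nonneg _) h3 2
    rw [sq_abs, mul_pow] at h4
    calc _ ≤ L ^ 2 * u ^ 2 * u⁻¹ := mul_le_mul_of_nonneg_right h4 (inv_nonneg.2 hu0.le)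
      _ = L ^ 2 * u := by field_simp
      _ ≤ L ^ 2 * 1 := mul_le_mul_of_nonneg_left (by linarith) (sq_nonneg _)
      _ = L ^ 2 := mul_one _
  · refine le_trans ?_ le_add_self
    have e4 : (4 : ℝ≥0∞) = ENNReal.ofReal 4 := by simp
    rw [e4, ← ENNReal.ofReal_mul (by norm_num), ← ENNReal.ofReal_mul (by norm_num),
      ← ENNReal.ofReal_add (mul_nonneg (by norm_num) (truncPow_nonneg _ _)) (by positivity)]
    refine ENNReal.ofReal_le_ofReal ?_
    have h1 : u⁻¹ ≤ 2 := by
      rw [inv_le_comm₀ hu0 two_pos]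
      linarith
    have h2 : Real.exp (-(b * u)) ^ 2 ≤ Real.exp (-u) := by
      rw [← Real.exp_nat_mul]
      refine Real.exp_le_exp.2 ?_
      push_cast
      have : (1 : ℝ) ≤ 2 * b := by linarith [hb.1, Real.pi_gt_three]
      nlinarith
    rw [← truncPow_sq]
    have h3 : (truncPow (1 - u) ν - Real.exp (-(b * u))) ^ 2 ≤
        2 * truncPow (1 - u) ν ^ 2 + 2 * Real.exp (-u) := by
      nlinarith [sq_nonneg (truncPow (1 - u) ν + Real.exp (-(b * u)))]
    calc _ ≤ (2 * truncPow (1 - u) ν ^ 2 + 2 * Real.exp (-u)) * 2 :=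
          mul_le_mul h3 h1 (inv_nonneg.2 hu0.le) (by positivity)
      _ = _ := by ring

/-- The multiplier of `T^ν_{√w}` applied to a frequency function `F`. -/
def coneMult (φ : ℝ → ℂ) (ν w : ℝ) (F : ConeSpace d → ℂ) (ξ : ConeSpace d) : ℂ :=
  (truncPow (1 - slopeSq ξ / w) ν : ℂ) * φ (ξ (Fin.last d)) * F ξ

/-- The difference of the cone multiplier and the Gaussian one. -/
def coneDiff (φ : ℝ → ℂ) (ν w : ℝ) (F : ConeSpace d → ℂ) (ξ : ConeSpace d) : ℂ :=
  ((truncPow (1 - slopeSq ξ / w) ν -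
    Real.exp (-(Real.pi * ξ (Fin.last d) ^ 2 * (slopeSq ξ * w⁻¹))) : ℝ) : ℂ) *
      φ (ξ (Fin.last d)) * F ξ

/-- The frequency function `φ(ξ_n) e^{πξ_n²} F(ξ)`, to which the Gaussian averages are applied. -/
def coneWeight (φ : ℝ → ℂ) (F : ConeSpace d → ℂ) (ξ : ConeSpace d) : ℂ :=
  φ (ξ (Fin.last d)) * (Real.exp (Real.pi * ξ (Fin.last d) ^ 2) : ℂ) * F ξ

/-- The square of the function that dominates the averages of `T^ν_t`. -/
def coneMajorant (φ : ℝ → ℂ) (ν : ℝ) (F : ConeSpace d → ℂ) (x : ConeSpace d) : ℝ≥0∞ :=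
  (⨆ τ : Ioi (0 : ℝ), ‖heatMean (coneWeight φ F) τ x‖ₑ) ^ 2 +
    ∫⁻ w in Ioi (0 : ℝ), ENNReal.ofReal w⁻¹ * ‖invFT (coneDiff φ ν w F) x‖ₑ ^ 2

/-- The factor e^{πξ_n²} in the weight cancels the fixed Gaussian in ξ_n; what remains is
e^{-π|ξ'|²/w}, with |ξ'|² written as slope squared times ξ_n². -/
theorem gauss_mul_coneWeight {φ : ℝ → ℂ} (hφ : IsConeCutoff φ)
    {F : ConeSpace d → ℂ} {w : ℝ} (ξ : ConeSpace d) :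
    (gauss (heatVec d w⁻¹) ξ : ℂ) * coneWeight φ F ξ =
      (Real.exp (-(Real.pi * ξ (Fin.last d) ^ 2 * (slopeSq ξ * w⁻¹))) : ℂ) *
        φ (ξ (Fin.last d)) * F ξ := by
  by_cases hs : ξ (Fin.last d) ∈ Icc (1 / 2 : ℝ) 2
  · have h0 : ξ (Fin.last d) ≠ 0 := by linarith [hs.1]
    have : gauss (heatVec d w⁻¹) ξ * Real.exp (Real.pi * ξ (Fin.last d) ^ 2) =
        Real.exp (-(Real.pi * ξ (Fin.last d) ^ 2 * (slopeSq ξ * w⁻¹))) := by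
      unfold gauss
      rw [← Real.exp_add, Fin.sum_univ_castSucc]
      congr 1
      have h1 : ∀ i : Fin d, heatVec d w⁻¹ i.castSucc = w⁻¹ := fun i =>
        if_neg (Fin.castSucc_lt_last i).ne
      have h2 : heatVec d w⁻¹ (Fin.last d) = 1 := if_pos rfl
      simp only [h1, h2]
      rw [← Finset.mul_sum, ← slopeSq_mul_sq h0]
      ring
    rw [← this]
    unfold coneWeight
    push_cast
    ring
  · simp [coneWeight, hφ.eq_zero hs]

theorem measurable_coneMult {φ : ℝ → ℂ} {F : ConeSpace d → ℂ} (hφc : Continuous φ) (hFm : Measurable F) (ν : ℝ) :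
    Measurable fun p : ℝ × ConeSpace d => coneMult φ ν p.1 F p.2 := by
  have := hφc.measurable
  unfold coneMult
  fun_prop

theorem measurable_coneDiff {φ : ℝ → ℂ} {F : ConeSpace d → ℂ} (hφc : Continuous φ) (hFm : Measurable F) (ν : ℝ) :
    Measurable fun p : ℝ × ConeSpace d => coneDiff φ ν p.1 F p.2 := by
  have := hφc.measurable
  unfold coneDiff
  fun_prop

theorem memLp_coneWeight {φ : ℝ → ℂ} (hφ : IsConeCutoff φ)
    {F : ConeSpace d → ℂ} (hF : MemLp F 2) : MemLp (coneWeight φ F) 2 := by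
  obtain ⟨M, hM0, hM⟩ := hφ.exists_bound
  refine (hF.norm.const_mul (M * Real.exp (Real.pi * 4))).mono' ?_ ?_
  · unfold coneWeight
    refine AEStronglyMeasurable.mul (Continuous.aestronglyMeasurable ?_) hF.1
    have := hφ.continuous
    fun_prop
  · refine Filter.Eventually.of_forall fun ξ => ?_
    unfold coneWeight
    rw [norm_mul]
    refine mul_le_mul_of_nonneg_right ?_ (norm_nonneg _)
    rw [norm_mul, Complex.norm_real, Real.norm_of_nonneg (Real.exp_pos _).le]
    by_cases hs : ξ (Fin.last d) ∈ Icc (1 / 2 : ℝ) 2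
    · refine mul_le_mul (hM _) (Real.exp_le_exp.2 (mul_le_mul_of_nonneg_left ?_ Real.pi_pos.le))
        (Real.exp_pos _).le hM0
      nlinarith [hs.1, hs.2]
    · rw [hφ.eq_zero hs, norm_zero, zero_mul]
      positivity

/-- The pointwise splitting of `T^ν_{√w}`. -/
theorem enorm_invFT_coneMult_sq_le {φ : ℝ → ℂ} (hφ : IsConeCutoff φ)
    {F : ConeSpace d → ℂ} (hF : MemLp F 2) (ν : ℝ) {w : ℝ} (hw : 0 < w) (x : ConeSpace d) :
    ‖invFT (coneMult φ ν w F) x‖ₑ ^ 2 ≤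
      2 * (⨆ τ : Ioi (0 : ℝ), ‖heatMean (coneWeight φ F) τ x‖ₑ) ^ 2 +
        2 * ‖invFT (coneDiff φ ν w F) x‖ₑ ^ 2 := by
  by_cases hi : Integrable (coneMult φ ν w F)
  swap
  · simp [invFT_of_not_integrable hi]
  set g : ConeSpace d → ℂ := fun ξ => (gauss (heatVec d w⁻¹) ξ : ℂ) * coneWeight φ F ξ with hg
  have hgi : Integrable g :=
    integrable_gauss_mul (heatVec_pos (inv_pos.2 hw)) (memLp_coneWeight hφ hF)
  have e1 : coneDiff φ ν w F = fun ξ => coneMult φ ν w F ξ - g ξ := by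
    funext ξ
    rw [hg]
    simp only
    rw [gauss_mul_coneWeight hφ]
    unfold coneDiff coneMult
    push_cast
    ring
  have e2 : invFT (coneMult φ ν w F) x =
      heatMean (coneWeight φ F) w⁻¹ x + invFT (coneDiff φ ν w F) x := by
    rw [e1, invFT_sub hi hgi]
    change _ = invFT g x + _
    ring
  rw [e2]
  refine (pow_le_pow_left' (enorm_add_le _ _) 2).trans ((ENNReal.add_sq_le _ _).trans ?_)
  gcongr
  exact le_iSup (fun τ : Ioi (0 : ℝ) => ‖heatMean (coneWeight φ F) τ x‖ₑ)
    ⟨w⁻¹, mem_Ioi.2 (inv_pos.2 hw)⟩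

/-- For fixed ξ, invariance of dw/w under w ↦ slope²/w reduces the fibre integral to the
one-variable estimate, with a constant independent of ξ. -/
theorem lintegral_coneDiff_le {φ : ℝ → ℂ} (hφ : IsConeCutoff φ) {ν : ℝ} (hν : -(1 / 2) < ν) :
    ∃ C : ℝ≥0, ∀ (F : ConeSpace d → ℂ) (ξ : ConeSpace d),
      ∫⁻ w in Ioi (0 : ℝ), ENNReal.ofReal w⁻¹ * ‖coneDiff φ ν w F ξ‖ₑ ^ 2 ≤ C * ‖F ξ‖ₑ ^ 2 := by
  obtain ⟨C, hC⟩ := lintegral_truncPow_sub_exp_le hν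
  obtain ⟨M, hM0, hM⟩ := hφ.exists_bound
  refine ⟨C * Real.toNNReal M ^ 2, fun F ξ => ?_⟩
  by_cases hs : ξ (Fin.last d) ∈ Icc (1 / 2 : ℝ) 2
  swap
  · simp [coneDiff, hφ.eq_zero hs]
  set b := Real.pi * ξ (Fin.last d) ^ 2 with hb
  have hb1 : b ∈ Icc (Real.pi / 4) (4 * Real.pi) := by
    have h1 : 1 / 4 ≤ ξ (Fin.last d) ^ 2 := by nlinarith [hs.1]
    have h2 : ξ (Fin.last d) ^ 2 ≤ 4 := by nlinarith [hs.1, hs.2]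
    constructor <;> nlinarith [Real.pi_pos]
  set g : ℝ → ℝ≥0∞ := fun u => ENNReal.ofReal ((truncPow (1 - u) ν - Real.exp (-(b * u))) ^ 2)
    with hg
  have h1 : ∫⁻ w in Ioi (0 : ℝ), g (slopeSq ξ * w⁻¹) * ENNReal.ofReal w⁻¹ ≤ C := by
    -- At slope zero the change of variables degenerates, but the two profiles agree at u = 0 and
    -- the integrand vanishes.
    rcases (slopeSq_nonneg ξ).eq_or_lt with h0 | h0
    · have : ∀ w : ℝ, g (slopeSq ξ * w⁻¹) = 0 := fun w => by
        rw [← h0]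
        simp [hg, truncPow]
      simp [this]
    · have := (lintegral_comp_mul_rpow_le h0 (p := -1) (by norm_num) g).trans (hC b hb1)
      simpa [Real.rpow_neg_one] using this
  have h2 : ∀ w, ‖coneDiff φ ν w F ξ‖ₑ ^ 2 ≤
      g (slopeSq ξ * w⁻¹) * ((Real.toNNReal M : ℝ≥0∞) ^ 2 * ‖F ξ‖ₑ ^ 2) := by
    intro w
    unfold coneDiff
    rw [mul_assoc, enorm_mul, mul_pow, enorm_mul, mul_pow]
    refine mul_le_mul' (le_of_eq ?_) (mul_le_mul' (pow_le_pow_left' ?_ 2) le_rfl)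
    · rw [← ofReal_norm, Complex.norm_real, ← ENNReal.ofReal_pow (norm_nonneg _), Real.norm_eq_abs,
        sq_abs, hg, div_eq_mul_inv]
    · rw [← ofReal_norm]
      exact ENNReal.ofReal_le_ofReal (hM _)
  calc _ ≤ ∫⁻ w in Ioi (0 : ℝ), (g (slopeSq ξ * w⁻¹) * ENNReal.ofReal w⁻¹) *
        ((Real.toNNReal M : ℝ≥0∞) ^ 2 * ‖F ξ‖ₑ ^ 2) := by
        refine lintegral_mono fun w => ?_
        rw [mul_right_comm, mul_comm]
        exact mul_le_mul' (h2 w) le_rfl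
    _ ≤ C * ((Real.toNNReal M : ℝ≥0∞) ^ 2 * ‖F ξ‖ₑ ^ 2) := by
        rw [lintegral_mul_const' _ _ (ENNReal.mul_ne_top (by simp) (by simp))]
        exact mul_le_mul' h1 le_rfl
    _ = _ := by
        push_cast
        rw [mul_assoc]

theorem lintegral_coneMajorant_le {φ : ℝ → ℂ} (hφ : IsConeCutoff φ) {ν : ℝ} (hν : -(1 / 2) < ν) :
    ∃ C : ℝ≥0, ∀ F : ConeSpace d → ℂ, MemLp F 2 → Measurable F →
      ∫⁻ x, coneMajorant φ ν F x ≤ C * ∫⁻ ξ, ‖F ξ‖ₑ ^ 2 := by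
  obtain ⟨C, hC⟩ := lintegral_coneDiff_le (d := d) hφ hν
  obtain ⟨M, hM0, hM⟩ := hφ.exists_bound
  refine ⟨(Real.toNNReal (2 * √2 ^ (d + 1)) ^ 2 * Real.toNNReal (M * Real.exp (Real.pi * 4)) ^ 2) + C,
    fun F hF hFm => ?_⟩
  have hjm := measurable_coneDiff hφ.continuous hFm ν
  have hm : Measurable fun x => ∫⁻ w in Ioi (0 : ℝ),
      ENNReal.ofReal w⁻¹ * ‖invFT (coneDiff φ ν w F) x‖ₑ ^ 2 := by
    refine Measurable.lintegral_prod_right'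
      (f := fun p : ConeSpace d × ℝ => ENNReal.ofReal p.2⁻¹ * ‖invFT (coneDiff φ ν p.2 F) p.1‖ₑ ^ 2) ?_
    have h2 := measurable_invFT_param (h := fun w => coneDiff φ ν w F) hjm
    exact ((measurable_snd.inv).ennreal_ofReal).mul (h2.enorm.pow_const 2)
  unfold coneMajorant
  rw [lintegral_add_right _ hm]
  push_cast
  rw [add_mul]
  refine add_le_add ?_ ?_
  · refine (lintegral_iSup_heatMean_le (memLp_coneWeight hφ hF)).trans ?_
    rw [mul_assoc]
    refine mul_le_mul' le_rfl ?_
    rw [← lintegral_const_mul' _ _ (by simp)]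
    refine lintegral_mono fun ξ => ?_
    rw [← mul_pow]
    refine pow_le_pow_left' ?_ 2
    unfold coneWeight
    rw [enorm_mul]
    refine mul_le_mul' ?_ le_rfl
    rw [← ofReal_norm]
    refine ENNReal.ofReal_le_ofReal ?_
    rw [norm_mul, Complex.norm_real, Real.norm_of_nonneg (Real.exp_pos _).le]
    by_cases hs : ξ (Fin.last d) ∈ Icc (1 / 2 : ℝ) 2
    · refine mul_le_mul (hM _) (Real.exp_le_exp.2 (mul_le_mul_of_nonneg_left ?_ Real.pi_pos.le))
        (Real.exp_pos _).le hM0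
      nlinarith [hs.1, hs.2]
    · rw [hφ.eq_zero hs, norm_zero, zero_mul]
      positivity
  · refine (lintegral_lintegral_invFT_sq_le (h := fun w => coneDiff φ ν w F) hjm
      (ρ := fun w => ENNReal.ofReal w⁻¹) (by fun_prop)).trans ?_
    rw [← lintegral_const_mul' _ _ (by simp)]
    exact lintegral_mono fun ξ => hC F ξ

theorem measurable_coneMajorant {φ : ℝ → ℂ} (hφ : IsConeCutoff φ) {F : ConeSpace d → ℂ}
    (hFm : Measurable F) (ν : ℝ) : Measurable (coneMajorant φ ν F) := by
  refine Measurable.add ?_ ?_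
  · refine Measurable.pow_const ?_ 2
    exact (lowerSemicontinuous_iSup fun τ =>
      (continuous_invFT _).enorm.lowerSemicontinuous).measurable
  · refine Measurable.lintegral_prod_right'
      (f := fun p : ConeSpace d × ℝ => ENNReal.ofReal p.2⁻¹ * ‖invFT (coneDiff φ ν p.2 F) p.1‖ₑ ^ 2) ?_
    have h2 := measurable_invFT_param (h := fun w => coneDiff φ ν w F)
      (measurable_coneDiff hφ.continuous hFm ν)
    exact ((measurable_snd.inv).ennreal_ofReal).mul (h2.enorm.pow_const 2)

theorem measurable_invFT_section {Y : Type*} [MeasurableSpace Y]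
    {h : Y → ConeSpace d → ℂ} (hh : Measurable (Function.uncurry h)) (x : ConeSpace d) :
    Measurable fun y => invFT (h y) x := by
  have h1 : Measurable fun p : ConeSpace d × Y => invFT (h p.2) p.1 := measurable_invFT_param hh
  generalize hG : (fun p : ConeSpace d × Y => invFT (h p.2) p.1) = G at h1
  have : (fun y => invFT (h y) x) = fun y => G (x, y) := by
    rw [← hG]
  rw [this]
  exact h1.comp (measurable_const.prodMk measurable_id)

theorem measurable_linearCone {φ : ℝ → ℂ} (hφ : IsConeCutoff φ) (ν : ℝ) (f : ConeL2 d)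
    (x : ConeSpace d) : Measurable fun t => linearCone φ ν t f x := by
  have h1 := measurable_invFT_section (h := fun w => coneMult φ ν w (𝓕 f : ConeL2 d))
    (measurable_coneMult hφ.continuous (Lp.stronglyMeasurable _).measurable ν) x
  exact h1.comp (measurable_id.pow_const 2)

/-- The supremum is uncountable, but each average is lower semicontinuous in x (Fatou, with an
integrand continuous in x), and suprema preserve this. -/
theorem measurable_averagedMaximal {φ : ℝ → ℂ} (hφ : IsConeCutoff φ) (ν : ℝ) (j : ℕ)
    (f : ConeL2 d) : Measurable (averagedMaximal φ ν j f) := by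
  refine LowerSemicontinuous.measurable ?_
  unfold averagedMaximal
  refine lowerSemicontinuous_biSup fun R hR => ?_
  have hR0 : 0 < R := hR
  have hρ : (ENNReal.ofReal (R * √((2 : ℝ) ^ (1 - (j : ℝ)))))⁻¹ ≠ ⊤ := by
    rw [ENNReal.inv_ne_top]
    exact (ENNReal.ofReal_pos.2 (by positivity)).ne'
  refine Continuous.comp_lowerSemicontinuous
    (g := fun y => ((ENNReal.ofReal (R * √((2 : ℝ) ^ (1 - (j : ℝ)))))⁻¹ * y) ^ (1 / 2 : ℝ))
    (ENNReal.continuous_rpow_const.comp (ENNReal.continuous_const_mul hρ)) ?_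
    (fun y z h => ENNReal.rpow_le_rpow (mul_le_mul' le_rfl h) (by norm_num))
  refine lowerSemicontinuous_lintegral (fun x => ?_) fun t => ?_
  · exact ((measurable_linearCone hφ ν f x).enorm.pow_const 2).aemeasurable
  · exact (ENNReal.continuous_pow 2).comp (continuous_invFT _).enorm

/-- On (0, ρ] one has 1/ρ ≤ 1/t, so the average of the difference term is dominated by its dt/t
integral, and w = t² gives dw/w. Only the length ρ enters, so the bound is uniform in R and j. -/
theorem average_linearCone_le {φ : ℝ → ℂ} (hφ : IsConeCutoff φ) (ν : ℝ) (f : ConeL2 d)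
    (x : ConeSpace d) {ρ : ℝ} (hρ : 0 < ρ) :
    (ENNReal.ofReal ρ)⁻¹ * ∫⁻ t in Ioc 0 ρ, ‖linearCone φ ν t f x‖ₑ ^ 2 ≤
      2 * coneMajorant φ ν (𝓕 f : ConeL2 d) x := by
  set F : ConeSpace d → ℂ := ⇑(𝓕 f : ConeL2 d) with hF
  have hFL : MemLp F 2 := Lp.memLp _
  set S : ℝ≥0∞ := ⨆ τ : Ioi (0 : ℝ), ‖heatMean (coneWeight φ F) τ x‖ₑ with hS
  set D : ℝ → ℝ≥0∞ := fun w => ‖invFT (coneDiff φ ν w F) x‖ₑ ^ 2 with hD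
  have hρ0 : ENNReal.ofReal ρ ≠ 0 := (ENNReal.ofReal_pos.2 hρ).ne'
  have h1 : ∫⁻ t in Ioc 0 ρ, ‖linearCone φ ν t f x‖ₑ ^ 2 ≤
      2 * S ^ 2 * ENNReal.ofReal ρ + 2 * ∫⁻ t in Ioc 0 ρ, D (t ^ 2) := by
    calc _ ≤ ∫⁻ t in Ioc 0 ρ, (2 * S ^ 2 + 2 * D (t ^ 2)) :=
          setLIntegral_mono' measurableSet_Ioc fun t ht =>
            enorm_invFT_coneMult_sq_le hφ hFL ν (pow_pos ht.1 2) x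
      _ = _ := by
          rw [lintegral_add_left measurable_const, setLIntegral_const, Real.volume_Ioc, sub_zero,
            lintegral_const_mul' 2 _ (by simp)]
  have h2 : (ENNReal.ofReal ρ)⁻¹ * ∫⁻ t in Ioc 0 ρ, D (t ^ 2) ≤
      ∫⁻ t in Ioi (0 : ℝ), D (t ^ 2) * ENNReal.ofReal t⁻¹ := by
    rw [← lintegral_const_mul' _ _ (ENNReal.inv_ne_top.2 hρ0)]
    refine le_trans (setLIntegral_mono' measurableSet_Ioc fun t ht => ?_)
      (lintegral_mono_set Ioc_subset_Ioi_self)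
    rw [mul_comm]
    refine mul_le_mul' le_rfl ?_
    rw [← ENNReal.ofReal_inv_of_pos hρ]
    exact ENNReal.ofReal_le_ofReal (inv_anti₀ ht.1 ht.2)
  have h3 : ∫⁻ t in Ioi (0 : ℝ), D (t ^ 2) * ENNReal.ofReal t⁻¹ ≤
      ∫⁻ w in Ioi (0 : ℝ), ENNReal.ofReal w⁻¹ * D w := by
    have := lintegral_comp_mul_rpow_le one_pos (two_ne_zero (α := ℝ)) D
    simp only [one_mul, Real.rpow_two, abs_two] at this
    refine le_trans (le_mul_of_one_le_left' ?_) (this.trans_eq ?_)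
    · simp
    · exact lintegral_congr fun w => mul_comm _ _
  calc _ ≤ (ENNReal.ofReal ρ)⁻¹ * (2 * S ^ 2 * ENNReal.ofReal ρ + 2 * ∫⁻ t in Ioc 0 ρ, D (t ^ 2)) :=
        mul_le_mul' le_rfl h1
    _ = 2 * S ^ 2 * ((ENNReal.ofReal ρ)⁻¹ * ENNReal.ofReal ρ) +
          2 * ((ENNReal.ofReal ρ)⁻¹ * ∫⁻ t in Ioc 0 ρ, D (t ^ 2)) := by ring
    _ ≤ 2 * S ^ 2 + 2 * ∫⁻ w in Ioi (0 : ℝ), ENNReal.ofReal w⁻¹ * D w := by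
        rw [ENNReal.inv_mul_cancel hρ0 ENNReal.ofReal_ne_top, mul_one]
        exact add_le_add le_rfl (mul_le_mul' le_rfl (h2.trans h3))
    _ = _ := by
        unfold coneMajorant
        rw [mul_add]

theorem ENNReal.sq_rpow_half (a : ℝ≥0∞) : (a ^ 2) ^ (1 / 2 : ℝ) = a := by
  rw [← ENNReal.rpow_natCast a, ← ENNReal.rpow_mul]
  norm_num

theorem ENNReal.rpow_half_sq (a : ℝ≥0∞) : (a ^ (1 / 2 : ℝ)) ^ 2 = a := by
  rw [← ENNReal.rpow_natCast (a ^ (1 / 2 : ℝ)), ← ENNReal.rpow_mul]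
  norm_num

theorem exists_averagedMaximal_bound {φ : ℝ → ℂ} (hφ : IsConeCutoff φ) {ν : ℝ}
    (hν : -(1 / 2) < ν) : ∃ C : ℝ≥0, ∀ (j : ℕ) (f : ConeL2 d),
      eLpNorm (averagedMaximal φ ν j f) 2 volume ≤ C * ‖f‖ₑ := by
  obtain ⟨C, hC⟩ := lintegral_coneMajorant_le (d := d) hφ hν
  refine ⟨NNReal.sqrt (2 * C), fun j f => ?_⟩
  have h1 : ∀ x, averagedMaximal φ ν j f x ^ 2 ≤ 2 * coneMajorant φ ν (𝓕 f : ConeL2 d) x := by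
    intro x
    rw [← ENNReal.rpow_half_sq (2 * _)]
    refine pow_le_pow_left' (iSup₂_le fun R hR => ENNReal.rpow_le_rpow ?_ (by norm_num)) 2
    have hR0 : 0 < R := hR
    exact average_linearCone_le hφ ν f x (by positivity)
  rw [eLpNorm_two_enn]
  calc _ ≤ (2 * (C * ‖f‖ₑ ^ 2)) ^ (1 / 2 : ℝ) := by
        refine ENNReal.rpow_le_rpow ((lintegral_mono h1).trans ?_) (by norm_num)
        rw [lintegral_const_mul' _ _ (by simp), ← lintegral_fourier_sq]
        exact mul_le_mul' le_rfl (hC _ (Lp.memLp _) (Lp.stronglyMeasurable _).measurable)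
    _ = _ := by
        rw [← mul_assoc, ENNReal.mul_rpow_of_nonneg _ _ (by norm_num), ENNReal.sq_rpow_half]
        congr 1
        rw [NNReal.sqrt_eq_rpow, ENNReal.coe_rpow_of_nonneg _ (by norm_num)]
        push_cast
        rfl

/-! ### The beta integral and the bilinear operator -/

/-- Weighted averages of `T^ν_{√(av)}`. -/
theorem weighted_average_coneMult_le {φ : ℝ → ℂ} (hφ : IsConeCutoff φ) (ν : ℝ)
    {F : ConeSpace d → ℂ} (hF : MemLp F 2) (x : ConeSpace d) {a γ : ℝ} (ha : 0 < a)
    (hγ : -1 < γ) :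
    ∫⁻ v in Ioo (0 : ℝ) 1, ENNReal.ofReal (v ^ γ) * ‖invFT (coneMult φ ν (a * v) F) x‖ₑ ^ 2 ≤
      ENNReal.ofReal (2 / (γ + 1) + 2) * coneMajorant φ ν F x := by
  set S : ℝ≥0∞ := ⨆ τ : Ioi (0 : ℝ), ‖heatMean (coneWeight φ F) τ x‖ₑ with hS
  set D : ℝ → ℝ≥0∞ := fun w => ‖invFT (coneDiff φ ν w F) x‖ₑ ^ 2 with hD
  have hγ1 : 0 < γ + 1 := by linarith
  have h1 : ∫⁻ v in Ioo (0 : ℝ) 1, ENNReal.ofReal (v ^ γ) ≤ ENNReal.ofReal (1 / (γ + 1)) := by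
    have := lintegral_truncPow_Iic hγ zero_le_one
    rw [Real.one_rpow] at this
    rw [← this]
    refine le_trans (setLIntegral_mono' (g := fun v => ENNReal.ofReal (truncPow v γ))
      measurableSet_Ioo fun v hv => ?_) (lintegral_mono_set fun v hv => hv.2.le)
    rw [truncPow_of_pos hv.1]
  have h2 : ∫⁻ v in Ioo (0 : ℝ) 1, D (a * v) * ENNReal.ofReal v⁻¹ ≤
      ∫⁻ w in Ioi (0 : ℝ), ENNReal.ofReal w⁻¹ * D w := by
    have := lintegral_comp_mul_rpow_le ha one_ne_zero D
    simp only [Real.rpow_one, abs_one, ENNReal.ofReal_one, one_mul] at this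
    refine (lintegral_mono_set Ioo_subset_Ioi_self).trans (this.trans_eq ?_)
    exact lintegral_congr fun w => mul_comm _ _
  calc _ ≤ ∫⁻ v in Ioo (0 : ℝ) 1,
        (2 * S ^ 2 * ENNReal.ofReal (v ^ γ) + 2 * (D (a * v) * ENNReal.ofReal v⁻¹)) := by
        refine setLIntegral_mono' measurableSet_Ioo fun v hv => ?_
        refine (mul_le_mul' le_rfl (enorm_invFT_coneMult_sq_le hφ hF ν (mul_pos ha hv.1) x)).trans ?_
        rw [mul_add, mul_comm, mul_left_comm, mul_comm _ (D _)]
        refine add_le_add le_rfl (mul_le_mul' le_rfl (mul_le_mul' le_rfl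
          (ENNReal.ofReal_le_ofReal ?_)))
        -- On (0, 1) the weight v^γ with γ > -1 is at most v^{-1}, so the invariant integral
        -- dominates the difference term.
        rw [← Real.rpow_neg_one]
        exact Real.rpow_le_rpow_of_exponent_ge hv.1 hv.2.le hγ.le
    _ = 2 * S ^ 2 * (∫⁻ v in Ioo (0 : ℝ) 1, ENNReal.ofReal (v ^ γ)) +
          2 * ∫⁻ v in Ioo (0 : ℝ) 1, D (a * v) * ENNReal.ofReal v⁻¹ := by
        rw [lintegral_add_left (by fun_prop), lintegral_const_mul _ (by fun_prop),
          lintegral_const_mul' _ _ (by simp)]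
    _ ≤ 2 * S ^ 2 * ENNReal.ofReal (1 / (γ + 1)) +
          2 * ∫⁻ w in Ioi (0 : ℝ), ENNReal.ofReal w⁻¹ * D w :=
        add_le_add (mul_le_mul' le_rfl h1) (mul_le_mul' le_rfl h2)
    _ = ENNReal.ofReal (2 / (γ + 1)) * S ^ 2 + ENNReal.ofReal 2 *
          ∫⁻ w in Ioi (0 : ℝ), ENNReal.ofReal w⁻¹ * D w := by
        congr 1
        · rw [mul_right_comm, ← mul_one_div (2 : ℝ), ENNReal.ofReal_mul (by norm_num)]
          simp
        · simp
    _ ≤ _ := by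
        unfold coneMajorant
        rw [mul_add]
        refine add_le_add (mul_le_mul' (ENNReal.ofReal_le_ofReal ?_) le_rfl)
          (mul_le_mul' (ENNReal.ofReal_le_ofReal ?_) le_rfl)
        · linarith
        · have : 0 < 2 / (γ + 1) := by positivity
          linarith

/-- Separates the singularities at 0 and 1: on each half of the interval the factor that stays in
[1/2, 1] is bounded. Taking min 0 α treats both signs of α together. -/
theorem rpow_mul_one_sub_rpow_le (α : ℝ) {v : ℝ} (h0 : 0 < v) (h1 : v < 1) :
    (1 - v) ^ α * v ^ α ≤ 2 ^ |α| * (v ^ min 0 α + (1 - v) ^ min 0 α) := by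
  have key : ∀ u : ℝ, 0 < u → u ≤ 1 / 2 → (1 - u) ^ α * u ^ α ≤ 2 ^ |α| * u ^ min 0 α := by
    intro u hu hu2
    refine mul_le_mul (Real.rpow_le_rpow_abs α two_pos (by linarith) (by linarith)) ?_
      (Real.rpow_nonneg hu.le _) (by positivity)
    exact Real.rpow_le_rpow_of_exponent_ge hu (by linarith) (min_le_right _ _)
  have p1 : 0 ≤ v ^ min 0 α := Real.rpow_nonneg h0.le _
  have p2 : 0 ≤ (1 - v) ^ min 0 α := Real.rpow_nonneg (by linarith) _
  have p3 : (0 : ℝ) ≤ 2 ^ |α| := by positivity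
  rcases le_or_gt v (1 / 2) with h | h
  · refine (key v h0 h).trans (mul_le_mul_of_nonneg_left ?_ p3)
    linarith
  · have := key (1 - v) (by linarith) (by linarith)
    rw [sub_sub_cancel, mul_comm] at this
    refine this.trans (mul_le_mul_of_nonneg_left ?_ p3)
    linarith

theorem integrable_truncPow_beta {α : ℝ} (hα : -1 < α) :
    Integrable fun v : ℝ => truncPow (1 - v) α * truncPow v α := by
  set G : ℝ → ℝ := fun v => 2 ^ |α| * ((Iic (1 : ℝ)).indicator (fun v => truncPow v (min 0 α)) v +
    (Ici (0 : ℝ)).indicator (fun v => truncPow (1 - v) (min 0 α)) v) with hG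
  have hm : -1 < min 0 α := lt_min (by norm_num) hα
  have i1 : IntegrableOn (fun v => truncPow v (min 0 α)) (Iic (1 : ℝ)) := by
    refine ⟨(measurable_truncPow _).aestronglyMeasurable, ?_⟩
    rw [hasFiniteIntegral_iff_ofReal (Filter.Eventually.of_forall fun v => truncPow_nonneg _ _),
      lintegral_truncPow_Iic hm zero_le_one]
    exact ENNReal.ofReal_lt_top
  have i2 : IntegrableOn (fun v => truncPow (1 - v) (min 0 α)) (Ici (0 : ℝ)) := by
    refine ⟨((measurable_const.sub measurable_id).truncPow _).aestronglyMeasurable, ?_⟩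
    have := lintegral_truncPow_sub_left (c := 1) hm zero_le_one
    rw [sub_self] at this
    rw [hasFiniteIntegral_iff_ofReal (Filter.Eventually.of_forall fun v => truncPow_nonneg _ _), this]
    exact ENNReal.ofReal_lt_top
  have hGi : Integrable G :=
    (((integrable_indicator_iff measurableSet_Iic).2 i1).add
      ((integrable_indicator_iff measurableSet_Ici).2 i2)).const_mul _
  refine hGi.mono' ?_ (Filter.Eventually.of_forall fun v => ?_)
  · exact (((measurable_const.sub measurable_id).truncPow _).mul
      (measurable_truncPow _)).aestronglyMeasurable
  · rw [Real.norm_of_nonneg (mul_nonneg (truncPow_nonneg _ _) (truncPow_nonneg _ _))]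
    by_cases h0 : 0 < v
    · by_cases h1 : v < 1
      · have h1' : 0 < 1 - v := by linarith
        rw [hG]
        simp only [indicator_of_mem (mem_Iic.2 h1.le), indicator_of_mem (mem_Ici.2 h0.le)]
        rw [truncPow_of_pos h0, truncPow_of_pos h1', truncPow_of_pos h0, truncPow_of_pos h1']
        exact rpow_mul_one_sub_rpow_le α h0 h1
      · rw [truncPow_of_nonpos (by linarith : 1 - v ≤ 0), zero_mul]
        exact mul_nonneg (by positivity) (add_nonneg
          (indicator_nonneg (fun _ _ => truncPow_nonneg _ _) _)
          (indicator_nonneg (fun _ _ => truncPow_nonneg _ _) _))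
    · rw [truncPow_of_nonpos (by linarith : v ≤ 0), mul_zero]
      exact mul_nonneg (by positivity) (add_nonneg
        (indicator_nonneg (fun _ _ => truncPow_nonneg _ _) _)
        (indicator_nonneg (fun _ _ => truncPow_nonneg _ _) _))

/-- The beta integral `B(α + 1, α + 1)`. -/
def betaConst (α : ℝ) : ℝ := ∫ v : ℝ, truncPow (1 - v) α * truncPow v α

theorem betaConst_pos {α : ℝ} (hα : -1 < α) : 0 < betaConst α := by
  unfold betaConst
  rw [integral_pos_iff_support_of_nonneg
    (fun v => mul_nonneg (truncPow_nonneg _ _) (truncPow_nonneg _ _)) (integrable_truncPow_beta hα)]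
  refine lt_of_lt_of_le ?_ (measure_mono (s := Ioo (0 : ℝ) 1) fun v hv => ?_)
  · simp
  · have h1 : 0 < 1 - v := by linarith [hv.2]
    rw [Function.mem_support, truncPow_of_pos hv.1, truncPow_of_pos h1]
    exact (mul_pos (Real.rpow_pos_of_pos h1 _) (Real.rpow_pos_of_pos hv.1 _)).ne'

/-- The product lives on q < v < 1 - p; the affine change to the unit interval exposes the factor
(1-p-q)^{2α}, and the Jacobian later raises the exponent to 2α + 1. -/
theorem truncPow_mul_truncPow_scaled (α : ℝ) {p q : ℝ} (h : 0 < 1 - p - q) (v : ℝ) :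
    truncPow (1 - v - p) α * truncPow (v - q) α = (1 - p - q) ^ (2 * α) *
      (truncPow (1 - (v - q) / (1 - p - q)) α * truncPow ((v - q) / (1 - p - q)) α) := by
  have e1 : 1 - v - p = (1 - p - q) * (1 - (v - q) / (1 - p - q)) := by
    field_simp
    ring
  have e2 : v - q = (1 - p - q) * ((v - q) / (1 - p - q)) := by
    field_simp
  rw [e1, truncPow_mul h]
  nth_rw 2 [e2]
  rw [truncPow_mul h, two_mul, Real.rpow_add h]
  ring

theorem truncPow_mul_truncPow_eq_zero (α : ℝ) {p q : ℝ} (h : 1 - p - q ≤ 0) (v : ℝ) :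
    truncPow (1 - v - p) α * truncPow (v - q) α = 0 := by
  rcases le_or_gt v q with hv | hv
  · rw [truncPow_of_nonpos (by linarith : v - q ≤ 0), mul_zero]
  · rw [truncPow_of_nonpos (by linarith : 1 - v - p ≤ 0), zero_mul]

theorem integrable_truncPow_mul_truncPow {α : ℝ} (hα : -1 < α) (p q : ℝ) :
    Integrable fun v : ℝ => truncPow (1 - v - p) α * truncPow (v - q) α := by
  rcases le_or_gt (1 - p - q) 0 with h | h
  · simp_rw [truncPow_mul_truncPow_eq_zero α h]
    exact integrable_zero _ _ _
  · simp_rw [truncPow_mul_truncPow_scaled α h]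
    exact (((integrable_truncPow_beta hα).comp_div h.ne').comp_sub_right q).const_mul _

theorem integral_truncPow_mul_truncPow (α p q : ℝ) :
    ∫ v : ℝ, truncPow (1 - v - p) α * truncPow (v - q) α =
      betaConst α * truncPow (1 - p - q) (2 * α + 1) := by
  rcases le_or_gt (1 - p - q) 0 with h | h
  · simp_rw [truncPow_mul_truncPow_eq_zero α h, truncPow_of_nonpos h]
    simp
  · simp_rw [truncPow_mul_truncPow_scaled α h]
    rw [integral_const_mul, integral_sub_right_eq_self (fun v =>
      truncPow (1 - v / (1 - p - q)) α * truncPow (v / (1 - p - q)) α) q,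
      Measure.integral_comp_div (fun v => truncPow (1 - v) α * truncPow v α), abs_of_pos h,
      truncPow_of_pos h, Real.rpow_add h, Real.rpow_one, smul_eq_mul]
    unfold betaConst
    ring

theorem lintegral_one_sub_Ioo (g : ℝ → ℝ≥0∞) :
    ∫⁻ v in Ioo (0 : ℝ) 1, g (1 - v) = ∫⁻ v in Ioo (0 : ℝ) 1, g v := by
  rw [← lintegral_indicator measurableSet_Ioo, ← lintegral_indicator measurableSet_Ioo,
    ← lintegral_sub_left_eq_self _ (1 : ℝ)]
  refine lintegral_congr fun v => ?_
  simp only [indicator, mem_Ioo, sub_sub_cancel]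
  congr 1
  rw [eq_iff_iff]
  constructor <;> rintro ⟨h1, h2⟩ <;> constructor <;> linarith

/-- The Cauchy–Schwarz step for the beta representation. -/
theorem lintegral_beta_mul_le (α : ℝ) {p q : ℝ → ℝ≥0∞} (hp : Measurable p) (hq : Measurable q) :
    ∫⁻ v in Ioo (0 : ℝ) 1, ENNReal.ofReal ((1 - v) ^ α * v ^ α) * (p (1 - v) * q v) ≤
      ENNReal.ofReal (2 * 2 ^ |α|) *
        ((∫⁻ v in Ioo (0 : ℝ) 1, ENNReal.ofReal (v ^ (2 * min 0 α)) * p v ^ 2) ^ (1 / 2 : ℝ) *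
          (∫⁻ v in Ioo (0 : ℝ) 1, ENNReal.ofReal (v ^ (2 * min 0 α)) * q v ^ 2) ^ (1 / 2 : ℝ)) := by
  set β : ℝ := min 0 α with hβ
  have hβ0 : β ≤ 0 := min_le_left _ _
  -- The whole singular weight goes to the factor q. The factor p(1-v) stays unweighted, and v^{2β}
  -- ≥ 1 may then be inserted freely since β ≤ 0. The other singularity follows by reflection.
  have key : ∀ p q : ℝ → ℝ≥0∞, Measurable p → Measurable q →
      ∫⁻ v in Ioo (0 : ℝ) 1, ENNReal.ofReal (v ^ β) * (p (1 - v) * q v) ≤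
        (∫⁻ v in Ioo (0 : ℝ) 1, ENNReal.ofReal (v ^ (2 * β)) * p v ^ 2) ^ (1 / 2 : ℝ) *
          (∫⁻ v in Ioo (0 : ℝ) 1, ENNReal.ofReal (v ^ (2 * β)) * q v ^ 2) ^ (1 / 2 : ℝ) := by
    intro p q hp hq
    calc _ = ∫⁻ v in Ioo (0 : ℝ) 1, p (1 - v) * (ENNReal.ofReal (v ^ β) * q v) :=
          lintegral_congr fun v => by ring
      _ ≤ (∫⁻ v in Ioo (0 : ℝ) 1, p (1 - v) ^ 2) ^ (1 / 2 : ℝ) *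
          (∫⁻ v in Ioo (0 : ℝ) 1, (ENNReal.ofReal (v ^ β) * q v) ^ 2) ^ (1 / 2 : ℝ) :=
          ENNReal.lintegral_mul_le_sqrt (by fun_prop) (by fun_prop)
      _ ≤ _ := by
          refine mul_le_mul' (ENNReal.rpow_le_rpow ?_ (by norm_num))
            (ENNReal.rpow_le_rpow ?_ (by norm_num))
          · rw [lintegral_one_sub_Ioo fun v => p v ^ 2]
            refine setLIntegral_mono' measurableSet_Ioo fun v hv => le_mul_of_one_le_left' ?_
            rw [ENNReal.one_le_ofReal]
            exact Real.one_le_rpow_of_pos_of_le_one_of_nonpos hv.1 hv.2.le (by linarith)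
          · refine setLIntegral_mono' measurableSet_Ioo fun v hv => ?_
            rw [mul_pow, ← ENNReal.ofReal_pow (Real.rpow_nonneg hv.1.le _), ← Real.rpow_mul_natCast
              hv.1.le, mul_comm β]
            norm_num
  have h2 : ∫⁻ v in Ioo (0 : ℝ) 1, ENNReal.ofReal ((1 - v) ^ β) * (p (1 - v) * q v) ≤
      (∫⁻ v in Ioo (0 : ℝ) 1, ENNReal.ofReal (v ^ (2 * β)) * p v ^ 2) ^ (1 / 2 : ℝ) *
          (∫⁻ v in Ioo (0 : ℝ) 1, ENNReal.ofReal (v ^ (2 * β)) * q v ^ 2) ^ (1 / 2 : ℝ) := by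
    rw [← lintegral_one_sub_Ioo, mul_comm (_ ^ (1 / 2 : ℝ))]
    simp only [sub_sub_cancel]
    simp_rw [mul_comm (p _)]
    exact key q p hq hp
  calc _ ≤ ∫⁻ v in Ioo (0 : ℝ) 1, ENNReal.ofReal (2 ^ |α|) *
        (ENNReal.ofReal (v ^ β) * (p (1 - v) * q v) +
          ENNReal.ofReal ((1 - v) ^ β) * (p (1 - v) * q v)) := by
        refine setLIntegral_mono' measurableSet_Ioo fun v hv => ?_
        rw [← add_mul, ← mul_assoc (ENNReal.ofReal (2 ^ |α|)),
          ← ENNReal.ofReal_add (Real.rpow_nonneg hv.1.le _)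
          (Real.rpow_nonneg (by linarith [hv.2]) _), ← ENNReal.ofReal_mul (by positivity)]
        exact mul_le_mul' (ENNReal.ofReal_le_ofReal (rpow_mul_one_sub_rpow_le α hv.1 hv.2)) le_rfl
    _ ≤ _ := by
        rw [lintegral_const_mul' _ _ ENNReal.ofReal_ne_top, lintegral_add_left (by fun_prop),
          mul_comm (2 : ℝ), ENNReal.ofReal_mul (by positivity), mul_assoc]
        refine mul_le_mul' le_rfl ((add_le_add (key p q hp hq) h2).trans_eq ?_)
        rw [← two_mul]
        simp

/-- The multiplier of `𝒯^λ_{√a}` applied to two frequency functions. -/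
def bilinearMult (φ : ℝ → ℂ) (lam a : ℝ) (F G : ConeSpace d → ℂ)
    (p : ConeSpace d × ConeSpace d) : ℂ :=
  (truncPow (1 - slopeSq p.1 / a - slopeSq p.2 / a) lam : ℂ)
      * φ (p.1 (Fin.last d)) * φ (p.2 (Fin.last d)) * F p.1 * G p.2

theorem bilinearCone_eq (φ : ℝ → ℂ) (lam R : ℝ) (f g : ConeL2 d) (x : ConeSpace d) :
    bilinearCone φ lam R f g x = ∫ p : ConeSpace d × ConeSpace d,
      bilinearMult φ lam (R ^ 2) (𝓕 f : ConeL2 d) (𝓕 g : ConeL2 d) p * coneChar x (p.1 + p.2) := rfl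

theorem integrableOn_coneSlab {F : ConeSpace d → ℂ} (hF : MemLp F 2) (a : ℝ) :
    IntegrableOn F (coneSlab d a) := by
  have : IsFiniteMeasure (volume.restrict (coneSlab d a)) :=
    ⟨by rw [Measure.restrict_apply_univ]; exact volume_coneSlab_lt_top a⟩
  exact (hF.restrict _).integrable (by norm_num)

theorem integrable_bilinearMult {φ : ℝ → ℂ} (hφ : IsConeCutoff φ) {lam a : ℝ} (hlam : 0 < lam)
    (ha : 0 < a) {F G : ConeSpace d → ℂ} (hF : MemLp F 2) (hG : MemLp G 2) (hFm : Measurable F)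
    (hGm : Measurable G) : Integrable (bilinearMult φ lam a F G) := by
  obtain ⟨M, hM0, hM⟩ := hφ.exists_bound
  have hS := measurableSet_coneSlab (d := d) a
  have hφm := hφ.continuous.measurable
  have i1 := ((integrable_indicator_iff hS).2 (integrableOn_coneSlab hF a)).norm
  have i2 := ((integrable_indicator_iff hS).2 (integrableOn_coneSlab hG a)).norm
  refine ((i1.mul_prod i2).const_mul (M * M)).mono' ?_ (Filter.Eventually.of_forall fun p => ?_)
  · refine Measurable.aestronglyMeasurable ?_
    unfold bilinearMult
    fun_prop
  have hr1 : 0 ≤ slopeSq p.1 / a := div_nonneg (slopeSq_nonneg _) ha.le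
  have hr2 : 0 ≤ slopeSq p.2 / a := div_nonneg (slopeSq_nonneg _) ha.le
  have hnn : 0 ≤ M * M * (‖(coneSlab d a).indicator F p.1‖ * ‖(coneSlab d a).indicator G p.2‖) := by
    positivity
  unfold bilinearMult
  by_cases hpos : 0 < 1 - slopeSq p.1 / a - slopeSq p.2 / a
  swap
  · rw [truncPow_of_nonpos (not_lt.1 hpos)]
    simpa using hnn
  by_cases h1 : p.1 (Fin.last d) ∈ Icc (1 / 2 : ℝ) 2
  swap
  · rw [hφ.eq_zero h1]
    simpa using hnn
  by_cases h2 : p.2 (Fin.last d) ∈ Icc (1 / 2 : ℝ) 2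
  swap
  · rw [hφ.eq_zero h2]
    simpa using hnn
  have m1 : p.1 ∈ coneSlab d a := ⟨h1, (div_le_one ha).1 (by linarith)⟩
  have m2 : p.2 ∈ coneSlab d a := ⟨h2, (div_le_one ha).1 (by linarith)⟩
  rw [indicator_of_mem m1, indicator_of_mem m2, norm_mul, norm_mul, norm_mul, norm_mul,
    Complex.norm_real, Real.norm_of_nonneg (truncPow_nonneg _ _), truncPow_of_pos hpos, ← mul_assoc]
  refine mul_le_mul_of_nonneg_right (mul_le_mul_of_nonneg_right ?_ (norm_nonneg _)) (norm_nonneg _)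
  refine mul_le_mul ?_ (hM _) (norm_nonneg _) hM0
  refine (mul_le_of_le_one_left (norm_nonneg _) ?_).trans (hM _)
  exact Real.rpow_le_one hpos.le (by linarith) hlam.le

theorem continuous_bilinearCone {φ : ℝ → ℂ} (hφ : IsConeCutoff φ) {lam R : ℝ} (hlam : 0 < lam)
    (hR : 0 < R) (f g : ConeL2 d) : Continuous (bilinearCone φ lam R f g) := by
  have hi := integrable_bilinearMult hφ hlam (pow_pos hR 2) (Lp.memLp (𝓕 f : ConeL2 d))
    (Lp.memLp (𝓕 g : ConeL2 d)) (Lp.stronglyMeasurable _).measurable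
    (Lp.stronglyMeasurable _).measurable
  have : bilinearCone φ lam R f g = fun x => ∫ p : ConeSpace d × ConeSpace d,
      bilinearMult φ lam (R ^ 2) (𝓕 f : ConeL2 d) (𝓕 g : ConeL2 d) p * coneChar x (p.1 + p.2) := rfl
  rw [this]
  refine continuous_of_dominated (bound := fun p =>
    ‖bilinearMult φ lam (R ^ 2) (𝓕 f : ConeL2 d) (𝓕 g : ConeL2 d) p‖) (fun x => ?_) (fun x => ?_)
    hi.norm ?_
  · exact hi.1.mul (Continuous.aestronglyMeasurable (by fun_prop))
  · exact Filter.Eventually.of_forall fun p => by simp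
  · exact Filter.Eventually.of_forall fun p => by fun_prop

theorem measurable_maximalBilinearCone {φ : ℝ → ℂ} (hφ : IsConeCutoff φ) {lam : ℝ}
    (hlam : 0 < lam) (f g : ConeL2 d) : Measurable (maximalBilinearCone φ lam f g) := by
  refine LowerSemicontinuous.measurable ?_
  unfold maximalBilinearCone
  exact lowerSemicontinuous_biSup fun R hR =>
    (continuous_bilinearCone hφ hlam hR f g).enorm.lowerSemicontinuous

/-- The half-multiplier of the beta representation. -/
def halfMult (φ : ℝ → ℂ) (α a v : ℝ) (F : ConeSpace d → ℂ) (ξ : ConeSpace d) : ℂ :=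
  (truncPow (v - slopeSq ξ / a) α : ℂ) * φ (ξ (Fin.last d)) * F ξ

theorem halfMult_eq_zero (φ : ℝ → ℂ) (α : ℝ) {a v : ℝ} (ha : 0 < a) (hv : v ≤ 0)
    (F : ConeSpace d → ℂ) : halfMult φ α a v F = fun _ => 0 := by
  funext ξ
  have : 0 ≤ slopeSq ξ / a := div_nonneg (slopeSq_nonneg _) ha.le
  simp [halfMult, truncPow_of_nonpos (by linarith : v - slopeSq ξ / a ≤ 0)]

theorem invFT_halfMult (φ : ℝ → ℂ) (α : ℝ) {a v : ℝ} (hv : 0 < v) (F : ConeSpace d → ℂ)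
    (x : ConeSpace d) :
    invFT (halfMult φ α a v F) x = ((v ^ α : ℝ) : ℂ) * invFT (coneMult φ α (a * v) F) x := by
  rw [← invFT_const_mul]
  congr 1
  funext ξ
  have : v - slopeSq ξ / a = v * (1 - slopeSq ξ / (a * v)) := by
    rw [mul_sub, mul_one]
    congr 1
    rcases eq_or_ne a 0 with rfl | h
    · simp
    · field_simp
  unfold halfMult coneMult
  rw [this, truncPow_mul hv]
  push_cast
  ring

/-- Stein's beta-integral representation of the bilinear cone operator. -/
theorem betaConst_mul_bilinear {φ : ℝ → ℂ} (hφ : IsConeCutoff φ) {α a : ℝ} (hα : -(1 / 2) < α)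
    (ha : 0 < a) {F G : ConeSpace d → ℂ} (hF : MemLp F 2) (hG : MemLp G 2) (hFm : Measurable F)
    (hGm : Measurable G) (x : ConeSpace d) :
    (betaConst α : ℂ) * ∫ p : ConeSpace d × ConeSpace d,
        bilinearMult φ (2 * α + 1) a F G p * coneChar x (p.1 + p.2) =
      ∫ v : ℝ, invFT (halfMult φ α a (1 - v) F) x * invFT (halfMult φ α a v G) x := by
  set K : ConeSpace d × ConeSpace d → ℂ := fun p =>
    φ (p.1 (Fin.last d)) * φ (p.2 (Fin.last d)) * F p.1 * G p.2 * coneChar x (p.1 + p.2) with hK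
  set T : ConeSpace d × ConeSpace d → ℝ → ℝ := fun p v =>
    truncPow (1 - v - slopeSq p.1 / a) α * truncPow (v - slopeSq p.2 / a) α with hT
  have hα1 : -1 < α := by linarith
  have hφm := hφ.continuous.measurable
  have hchar : Measurable fun p : ConeSpace d × ConeSpace d => coneChar x (p.1 + p.2) :=
    Continuous.measurable (by fun_prop)
  have hKm : Measurable K := by
    fun_prop
  have hTm : Measurable fun q : (ConeSpace d × ConeSpace d) × ℝ => T q.1 q.2 := by
    fun_prop
  have hTm' : Measurable fun q : (ConeSpace d × ConeSpace d) × ℝ => (T q.1 q.2 : ℂ) := by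
    fun_prop
  have hKm' : Measurable fun q : (ConeSpace d × ConeSpace d) × ℝ => K q.1 := by
    fun_prop
  have hT0 : ∀ p v, 0 ≤ T p v := fun p v => mul_nonneg (truncPow_nonneg _ _) (truncPow_nonneg _ _)
  have hTi : ∀ p, Integrable (T p) := fun p => integrable_truncPow_mul_truncPow hα1 _ _
  have hTint : ∀ p, ∫ v, T p v = betaConst α *
      truncPow (1 - slopeSq p.1 / a - slopeSq p.2 / a) (2 * α + 1) := fun p =>
    integral_truncPow_mul_truncPow α _ _
  have hBK : ∀ p, ((∫ v, T p v : ℝ) : ℂ) * K p =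
      betaConst α * (bilinearMult φ (2 * α + 1) a F G p * coneChar x (p.1 + p.2)) := by
    intro p
    rw [hTint, hK]
    unfold bilinearMult
    push_cast
    ring
  -- As T ≥ 0, integrating the norm over v first gives a constant times the norm of the bilinear
  -- multiplier of positive order 2α + 1, which is integrable. Individual v-slices need not be.
  have hjoint : Integrable (fun q : (ConeSpace d × ConeSpace d) × ℝ => (T q.1 q.2 : ℂ) * K q.1)
      (volume.prod volume) := by
    have hsec : ∀ p, Integrable fun v => (T p v : ℂ) * K p := fun p =>
      Integrable.mul_const (f := fun v => (T p v : ℂ)) (hTi p).complex_ofReal (K p)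
    have hmeas := hTm'.mul hKm'
    refine (integrable_prod_iff hmeas.aestronglyMeasurable).2
      ⟨Filter.Eventually.of_forall hsec, ?_⟩
    have hb := (integrable_bilinearMult hφ (lam := 2 * α + 1) (by linarith) ha hF hG hFm hGm).norm
    refine (hb.const_mul (betaConst α)).congr (Filter.Eventually.of_forall fun p => ?_)
    have h1 : ∀ v, ‖(T p v : ℂ) * K p‖ = T p v * ‖K p‖ := fun v => by
      rw [norm_mul, Complex.norm_real, Real.norm_of_nonneg (hT0 p v)]
    change _ = ∫ v, ‖(T p v : ℂ) * K p‖
    simp_rw [h1]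
    rw [integral_mul_const]
    have h2 := congrArg norm (hBK p)
    rw [norm_mul, Complex.norm_real, Real.norm_of_nonneg (integral_nonneg fun v => hT0 p v),
      norm_mul (betaConst α : ℂ), norm_mul (bilinearMult φ (2 * α + 1) a F G p),
      Complex.norm_real, Real.norm_of_nonneg (betaConst_pos hα1).le,
      norm_coneChar, mul_one] at h2
    exact h2.symm
  calc _ = ∫ p, ∫ v, (T p v : ℂ) * K p := by
        rw [← integral_const_mul]
        refine integral_congr_ae (Filter.Eventually.of_forall fun p => ?_)
        simp only
        rw [integral_mul_const, integral_complex_ofReal, hBK]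
    _ = ∫ v, ∫ p, (T p v : ℂ) * K p := integral_integral_swap hjoint
    _ = _ := by
        refine integral_congr_ae (Filter.Eventually.of_forall fun v => ?_)
        simp only [invFT]
        rw [← integral_prod_mul]
        refine integral_congr_ae (Filter.Eventually.of_forall fun p => ?_)
        simp only [hK, hT, halfMult, coneChar_add]
        push_cast
        ring

theorem measurable_invFT_coneMult_mul {φ : ℝ → ℂ} (hφ : IsConeCutoff φ) {F : ConeSpace d → ℂ}
    (hFm : Measurable F) (α a : ℝ) (x : ConeSpace d) :
    Measurable fun v => invFT (coneMult φ α (a * v) F) x := by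
  have h1 := measurable_invFT_section (h := fun w => coneMult φ α w F)
    (measurable_coneMult hφ.continuous hFm α) x
  exact h1.comp (measurable_const.mul measurable_id)

/-- The half-multipliers are v^α times linear cone multipliers at w = av, so the beta
representation, Cauchy–Schwarz in v and the weighted averages give a pointwise bound free of a,
which therefore survives the supremum over R. -/
theorem enorm_bilinear_le {φ : ℝ → ℂ} (hφ : IsConeCutoff φ) {α : ℝ} (hα : -(1 / 2) < α) :
    ∃ C : ℝ≥0, ∀ (a : ℝ), 0 < a → ∀ F G : ConeSpace d → ℂ, MemLp F 2 → MemLp G 2 → Measurable F →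
      Measurable G → ∀ x, ‖∫ p : ConeSpace d × ConeSpace d,
        bilinearMult φ (2 * α + 1) a F G p * coneChar x (p.1 + p.2)‖ₑ ≤
        C * (coneMajorant φ α F x ^ (1 / 2 : ℝ) * coneMajorant φ α G x ^ (1 / 2 : ℝ)) := by
  set γ : ℝ := 2 * min 0 α with hγ
  -- Squaring in Cauchy–Schwarz doubles the exponent; integrability of v^γ is exactly where α > -1/2
  -- enters.
  have hγ1 : -1 < γ := by
    rcases min_choice 0 α with h | h <;> rw [hγ, h] <;> linarith
  have hB := betaConst_pos (α := α) (by linarith)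
  set A : ℝ≥0 := Real.toNNReal (2 / (γ + 1) + 2) with hA
  refine ⟨Real.toNNReal (betaConst α)⁻¹ * (Real.toNNReal (2 * 2 ^ |α|) * A),
    fun a ha F G hF hG hFm hGm x => ?_⟩
  set p : ℝ → ℝ≥0∞ := fun v => ‖invFT (coneMult φ α (a * v) F) x‖ₑ with hp
  set q : ℝ → ℝ≥0∞ := fun v => ‖invFT (coneMult φ α (a * v) G) x‖ₑ with hq
  have hpm : Measurable p := (measurable_invFT_coneMult_mul hφ hFm α a x).enorm
  have hqm : Measurable q := (measurable_invFT_coneMult_mul hφ hGm α a x).enorm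
  have key := betaConst_mul_bilinear hφ hα ha hF hG hFm hGm x
  set I := ∫ p : ConeSpace d × ConeSpace d,
        bilinearMult φ (2 * α + 1) a F G p * coneChar x (p.1 + p.2) with hI
  have h1 : I = ((betaConst α)⁻¹ : ℝ) *
      ∫ v : ℝ, invFT (halfMult φ α a (1 - v) F) x * invFT (halfMult φ α a v G) x := by
    rw [← key, ← mul_assoc, ← Complex.ofReal_mul, inv_mul_cancel₀ hB.ne', Complex.ofReal_one, one_mul]
  have h2 : ‖∫ v : ℝ, invFT (halfMult φ α a (1 - v) F) x * invFT (halfMult φ α a v G) x‖ₑ ≤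
      ∫⁻ v in Ioo (0 : ℝ) 1, ENNReal.ofReal ((1 - v) ^ α * v ^ α) * (p (1 - v) * q v) := by
    refine (enorm_integral_le_lintegral_enorm _).trans ?_
    rw [← lintegral_indicator measurableSet_Ioo]
    refine lintegral_mono fun v => ?_
    by_cases h0 : 0 < v
    · by_cases h1 : v < 1
      · have h1' : 0 < 1 - v := by linarith
        rw [indicator_of_mem (mem_Ioo.2 ⟨h0, h1⟩), invFT_halfMult φ α h0, invFT_halfMult φ α h1', enorm_mul,
          enorm_mul, enorm_mul, ENNReal.ofReal_mul (Real.rpow_nonneg h1'.le _)]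
        have e : ∀ r : ℝ, 0 ≤ r → ‖(r : ℂ)‖ₑ = ENNReal.ofReal r := fun r hr => by
          rw [← ofReal_norm, Complex.norm_real, Real.norm_of_nonneg hr]
        rw [e _ (Real.rpow_nonneg h0.le _), e _ (Real.rpow_nonneg h1'.le _)]
        exact le_of_eq (by ring)
      · rw [halfMult_eq_zero φ α ha (by linarith : 1 - v ≤ 0)]
        simp [invFT]
    · rw [halfMult_eq_zero φ α ha (by linarith : v ≤ 0)]
      simp [invFT]
  have h3 : ∀ H : ConeSpace d → ℂ, MemLp H 2 →
      (∫⁻ v in Ioo (0 : ℝ) 1, ENNReal.ofReal (v ^ γ) *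
        ‖invFT (coneMult φ α (a * v) H) x‖ₑ ^ 2) ^ (1 / 2 : ℝ) ≤
      (A : ℝ≥0∞) ^ (1 / 2 : ℝ) * coneMajorant φ α H x ^ (1 / 2 : ℝ) := by
    intro H hH
    rw [← ENNReal.mul_rpow_of_nonneg _ _ (by norm_num)]
    exact ENNReal.rpow_le_rpow (weighted_average_coneMult_le hφ α hH x ha hγ1) (by norm_num)
  have hA2 : (A : ℝ≥0∞) ^ (1 / 2 : ℝ) * (A : ℝ≥0∞) ^ (1 / 2 : ℝ) = A := by
    rw [← sq, ENNReal.rpow_half_sq]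
  rw [h1, enorm_mul]
  push_cast
  rw [mul_assoc]
  refine mul_le_mul' (le_of_eq ?_) (h2.trans ((lintegral_beta_mul_le α hpm hqm).trans ?_))
  · rw [← Complex.ofReal_inv, ← ofReal_norm, Complex.norm_real,
      Real.norm_of_nonneg (inv_nonneg.2 hB.le)]
    rfl
  · rw [mul_assoc]
    refine mul_le_mul' le_rfl ((mul_le_mul' (h3 F hF) (h3 G hG)).trans_eq ?_)
    rw [mul_mul_mul_comm, hA2]

theorem exists_maximalBilinearCone_bound {φ : ℝ → ℂ} (hφ : IsConeCutoff φ) {lam : ℝ}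
    (hlam : 0 < lam) : ∃ C : ℝ≥0, ∀ f g : ConeL2 d,
      eLpNorm (maximalBilinearCone φ lam f g) 1 volume ≤ C * ‖f‖ₑ * ‖g‖ₑ := by
  -- Chosen so that 2α + 1 = λ; the condition λ > 0 becomes α > -1/2.
  set α : ℝ := (lam - 1) / 2 with hα
  have hα1 : -(1 / 2) < α := by rw [hα]; linarith
  have hl : lam = 2 * α + 1 := by rw [hα]; ring
  obtain ⟨C, hC⟩ := enorm_bilinear_le (d := d) hφ hα1
  obtain ⟨C', hC'⟩ := lintegral_coneMajorant_le (d := d) hφ hα1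
  refine ⟨C * C', fun f g => ?_⟩
  have hm : ∀ h : ConeL2 d, Measurable (𝓕 h : ConeL2 d) := fun h =>
    (Lp.stronglyMeasurable _).measurable
  have h1 : ∀ h : ConeL2 d, (∫⁻ x, (coneMajorant φ α (𝓕 h : ConeL2 d) x ^ (1 / 2 : ℝ)) ^ 2) ^
      (1 / 2 : ℝ) ≤ (C' : ℝ≥0∞) ^ (1 / 2 : ℝ) * ‖h‖ₑ := by
    intro h
    simp_rw [ENNReal.rpow_half_sq]
    refine (ENNReal.rpow_le_rpow (hC' _ (Lp.memLp _) (hm h)) (by norm_num)).trans_eq ?_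
    rw [lintegral_fourier_sq, ENNReal.mul_rpow_of_nonneg _ _ (by norm_num), ENNReal.sq_rpow_half]
  have hA2 : (C' : ℝ≥0∞) ^ (1 / 2 : ℝ) * (C' : ℝ≥0∞) ^ (1 / 2 : ℝ) = C' := by
    rw [← sq, ENNReal.rpow_half_sq]
  rw [eLpNorm_one_eq_lintegral_enorm]
  calc _ ≤ ∫⁻ x, C * (coneMajorant φ α (𝓕 f : ConeL2 d) x ^ (1 / 2 : ℝ) *
        coneMajorant φ α (𝓕 g : ConeL2 d) x ^ (1 / 2 : ℝ)) := by
        refine lintegral_mono fun x => iSup₂_le fun R hR => ?_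
        rw [hl, bilinearCone_eq]
        exact hC _ (pow_pos hR 2) _ _ (Lp.memLp _) (Lp.memLp _) (hm f) (hm g) x
    _ ≤ C * (((C' : ℝ≥0∞) ^ (1 / 2 : ℝ) * ‖f‖ₑ) * ((C' : ℝ≥0∞) ^ (1 / 2 : ℝ) * ‖g‖ₑ)) := by
        rw [lintegral_const_mul' _ _ (by simp)]
        refine mul_le_mul' le_rfl ((ENNReal.lintegral_mul_le_sqrt ?_ ?_).trans
          (mul_le_mul' (h1 f) (h1 g)))
        · exact ((measurable_coneMajorant hφ (hm f) α).pow_const _).aemeasurable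
        · exact ((measurable_coneMajorant hφ (hm g) α).pow_const _).aemeasurable
    _ = _ := by
        rw [mul_mul_mul_comm, hA2]
        push_cast
        ring

/-! ### Scaled bumps and a Sobolev inequality in the dilation parameter -/

/-- `Θ` is differentiable with derivative `Θ'`, both live on `[δ/2, 2δ]`, with `|Θ| ≤ K` and
`|Θ'| ≤ K/δ`. -/
structure IsScaledBump (δ K : ℝ) (Θ Θ' : ℝ → ℂ) : Prop where
  hasDerivAt : ∀ u, HasDerivAt Θ (Θ' u) u
  measurable' : Measurable Θ'
  norm_le : ∀ u, ‖Θ u‖ ≤ K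
  norm_le' : ∀ u, ‖Θ' u‖ ≤ K / δ
  eq_zero : ∀ u, u ∉ Icc (δ / 2) (2 * δ) → Θ u = 0
  eq_zero' : ∀ u, u ∉ Icc (δ / 2) (2 * δ) → Θ' u = 0

/-- A frequency function supported in `ξ_n ∈ [1/2, 2]` and integrable on all slabs. -/
structure IsSlabIntegrable (h : ConeSpace d → ℂ) : Prop where
  measurable : Measurable h
  integrableOn : ∀ N, IntegrableOn h (coneSlab d N)
  eq_zero : ∀ ξ, ξ (Fin.last d) ∉ Icc (1 / 2 : ℝ) 2 → h ξ = 0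

/-- The dilated multiplier operator with symbol `Θ(1 - slope²/b)`. -/
def bumpOp (Θ : ℝ → ℂ) (h : ConeSpace d → ℂ) (b : ℝ) (x : ConeSpace d) : ℂ :=
  invFT (fun ξ => Θ (1 - slopeSq ξ / b) * h ξ) x

/-- The derivative of `bumpOp` in the dilation parameter. -/
def bumpOp' (Θ' : ℝ → ℂ) (h : ConeSpace d → ℂ) (b : ℝ) (x : ConeSpace d) : ℂ :=
  invFT (fun ξ => Θ' (1 - slopeSq ξ / b) * ((slopeSq ξ / b ^ 2 : ℝ) : ℂ) * h ξ) x

/-- The Sobolev energy density of `b ↦ bumpOp Θ h b x`. -/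
def bumpEnergy (δ : ℝ) (Θ Θ' : ℝ → ℂ) (h : ConeSpace d → ℂ) (b : ℝ) (x : ConeSpace d) : ℝ≥0∞ :=
  ENNReal.ofReal (4 / (δ * b)) * ‖bumpOp Θ h b x‖ₑ ^ 2 +
    ENNReal.ofReal (2 * (δ * b)) * ‖bumpOp' Θ' h b x‖ₑ ^ 2

namespace IsScaledBump

variable {δ K : ℝ} {Θ Θ' : ℝ → ℂ}

theorem continuous (hΘ : IsScaledBump δ K Θ Θ') : Continuous Θ :=
  continuous_iff_continuousAt.2 fun u => (hΘ.hasDerivAt u).continuousAt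

theorem nonneg (hΘ : IsScaledBump δ K Θ Θ') : 0 ≤ K := (norm_nonneg _).trans (hΘ.norm_le 0)

theorem integrable_symbol_mul (hδ : 0 < δ) (hΘ : IsScaledBump δ K Θ Θ') {h : ConeSpace d → ℂ}
    (hh : IsSlabIntegrable h) {b : ℝ} (hb : 0 < b) :
    Integrable fun ξ => Θ (1 - slopeSq ξ / b) * h ξ := by
  have hS := measurableSet_coneSlab (d := d) b
  refine ((((integrable_indicator_iff hS).2 (hh.integrableOn b)).norm).const_mul K).mono' ?_
    (Filter.Eventually.of_forall fun ξ => ?_)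
  · exact ((hΘ.continuous.measurable.comp (by fun_prop)).mul hh.measurable).aestronglyMeasurable
  have hnn : 0 ≤ K * ‖(coneSlab d b).indicator h ξ‖ := mul_nonneg hΘ.nonneg (norm_nonneg _)
  by_cases h1 : ξ (Fin.last d) ∈ Icc (1 / 2 : ℝ) 2
  swap
  · rw [hh.eq_zero ξ h1]
    simpa using hnn
  by_cases h2 : 1 - slopeSq ξ / b ∈ Icc (δ / 2) (2 * δ)
  swap
  · rw [hΘ.eq_zero _ h2]
    simpa using hnn
  have hm : ξ ∈ coneSlab d b := ⟨h1, (div_le_one hb).1 (by linarith [h2.1])⟩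
  rw [indicator_of_mem hm, norm_mul]
  exact mul_le_mul_of_nonneg_right (hΘ.norm_le _) (norm_nonneg _)

theorem norm_symbol'_le (hδ : 0 < δ) (hΘ : IsScaledBump δ K Θ Θ') {h : ConeSpace d → ℂ}
    (hh : IsSlabIntegrable h) {a b c : ℝ} (ha : 0 < a) (hac : a ≤ c) (hcb : c ≤ b)
    (ξ : ConeSpace d) :
    ‖Θ' (1 - slopeSq ξ / c) * ((slopeSq ξ / c ^ 2 : ℝ) : ℂ) * h ξ‖ ≤
      K / δ * a⁻¹ * ‖(coneSlab d b).indicator h ξ‖ := by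
  have hc : 0 < c := ha.trans_le hac
  have hK := hΘ.nonneg
  have hnn : 0 ≤ K / δ * a⁻¹ * ‖(coneSlab d b).indicator h ξ‖ := by positivity
  by_cases h1 : ξ (Fin.last d) ∈ Icc (1 / 2 : ℝ) 2
  swap
  · rw [hh.eq_zero ξ h1]
    simpa using hnn
  by_cases h2 : 1 - slopeSq ξ / c ∈ Icc (δ / 2) (2 * δ)
  swap
  · rw [hΘ.eq_zero' _ h2]
    simpa using hnn
  have hr : slopeSq ξ ≤ c := (div_le_one hc).1 (by linarith [h2.1])
  have hm : ξ ∈ coneSlab d b := ⟨h1, hr.trans hcb⟩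
  rw [indicator_of_mem hm, norm_mul, norm_mul, Complex.norm_real,
    Real.norm_of_nonneg (div_nonneg (slopeSq_nonneg _) (sq_nonneg _))]
  refine mul_le_mul_of_nonneg_right (mul_le_mul (hΘ.norm_le' _) ?_
    (div_nonneg (slopeSq_nonneg _) (sq_nonneg _)) (by positivity)) (norm_nonneg _)
  calc slopeSq ξ / c ^ 2 ≤ c / c ^ 2 := by gcongr
    _ = c⁻¹ := by field_simp
    _ ≤ a⁻¹ := inv_anti₀ ha hac

theorem integral_symbol' (hΘ : IsScaledBump δ K Θ Θ') {a b : ℝ} (ha : 0 < a) (hab : a ≤ b) (r : ℝ) :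
    ∫ c in Ioc a b, Θ' (1 - r / c) * ((r / c ^ 2 : ℝ) : ℂ) =
      Θ (1 - r / b) - Θ (1 - r / a) := by
  rw [← intervalIntegral.integral_of_le hab]
  refine intervalIntegral.integral_eq_sub_of_hasDerivAt (f := fun c => Θ (1 - r / c)) ?_ ?_
  · intro c hc
    rw [uIcc_of_le hab] at hc
    have hc0 : c ≠ 0 := (ha.trans_le hc.1).ne'
    have h1 : HasDerivAt (fun c : ℝ => 1 - r / c) (r / c ^ 2) c := by
      have := ((hasDerivAt_inv hc0).const_mul r).const_sub 1
      refine this.congr_deriv ?_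
      field_simp
    have := (hΘ.hasDerivAt (1 - r / c)).scomp c h1
    rw [Complex.real_smul, mul_comm] at this
    exact this
  · rw [intervalIntegrable_iff_integrableOn_Ioc_of_le hab]
    refine Measure.integrableOn_of_bounded (M := K / δ * (|r| / a ^ 2)) measure_Ioc_lt_top.ne ?_ ?_
    · exact ((hΘ.measurable'.comp (by fun_prop)).mul (by fun_prop)).aestronglyMeasurable
    · refine (ae_restrict_mem measurableSet_Ioc).mono fun c hc => ?_
      have hc0 : 0 < c := ha.trans hc.1
      rw [norm_mul, Complex.norm_real, Real.norm_eq_abs, abs_div, abs_of_nonneg (sq_nonneg c)]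
      refine mul_le_mul (hΘ.norm_le' _) ?_ (by positivity) ((norm_nonneg _).trans (hΘ.norm_le' 0))
      gcongr
      exact hc.1.le

/-- The fundamental theorem of calculus for the symbol, passed through the Fourier integral by
Fubini; all symbols with c ≤ b live on a single slab, on which h is integrable. -/
theorem bumpOp_sub (hδ : 0 < δ) (hΘ : IsScaledBump δ K Θ Θ') {h : ConeSpace d → ℂ}
    (hh : IsSlabIntegrable h) {a b : ℝ} (ha : 0 < a) (hab : a ≤ b) (x : ConeSpace d) :
    bumpOp Θ h b x - bumpOp Θ h a x = ∫ c in Ioc a b, bumpOp' Θ' h c x := by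
  have hb : 0 < b := ha.trans_le hab
  have hS := measurableSet_coneSlab (d := d) b
  unfold bumpOp bumpOp'
  rw [← invFT_sub (hΘ.integrable_symbol_mul hδ hh hb) (hΘ.integrable_symbol_mul hδ hh ha)]
  unfold invFT
  have hdom : Integrable (fun q : ℝ × ConeSpace d =>
      1 * (K / δ * a⁻¹ * ‖(coneSlab d b).indicator h q.2‖))
      ((volume.restrict (Ioc a b)).prod volume) :=
    Integrable.mul_prod (f := fun _ : ℝ => (1 : ℝ))
      (g := fun ξ => K / δ * a⁻¹ * ‖(coneSlab d b).indicator h ξ‖) (integrable_const 1)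
      ((((integrable_indicator_iff hS).2 (hh.integrableOn b)).norm).const_mul _)
  have hm : Measurable fun q : ℝ × ConeSpace d =>
      Θ' (1 - slopeSq q.2 / q.1) * ((slopeSq q.2 / q.1 ^ 2 : ℝ) : ℂ) * h q.2 * coneChar x q.2 := by
    have h1 := hΘ.measurable'
    have h2 := hh.measurable
    have h3 : Measurable (coneChar x) := Continuous.measurable (by fun_prop)
    fun_prop
  rw [integral_integral_swap]
  · refine integral_congr_ae (Filter.Eventually.of_forall fun ξ => ?_)
    simp only
    rw [integral_mul_const, integral_mul_const, hΘ.integral_symbol' ha hab]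
    ring
  · refine hdom.mono' hm.aestronglyMeasurable ?_
    have : ∀ᵐ q : ℝ × ConeSpace d ∂((volume.restrict (Ioc a b)).prod volume), q.1 ∈ Ioc a b :=
      Measure.quasiMeasurePreserving_fst.ae (ae_restrict_mem measurableSet_Ioc)
    filter_upwards [this] with q hq
    rw [one_mul]
    change ‖Θ' (1 - slopeSq q.2 / q.1) * ((slopeSq q.2 / q.1 ^ 2 : ℝ) : ℂ) * h q.2 *
      coneChar x q.2‖ ≤ _
    rw [norm_mul _ (coneChar x q.2), norm_coneChar, mul_one]
    exact hΘ.norm_symbol'_le hδ hh ha hq.1.le hq.2 q.2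

theorem measurable_bumpOp (hΘ : Measurable Θ) {h : ConeSpace d → ℂ} (hh : Measurable h)
    (x : ConeSpace d) : Measurable fun b => bumpOp Θ h b x := by
  unfold bumpOp
  refine measurable_invFT_section (h := fun b ξ => Θ (1 - slopeSq ξ / b) * h ξ) ?_ x
  unfold Function.uncurry
  fun_prop

theorem measurable_bumpOp' (hΘ : Measurable Θ') {h : ConeSpace d → ℂ} (hh : Measurable h)
    (x : ConeSpace d) : Measurable fun b => bumpOp' Θ' h b x := by
  unfold bumpOp'
  refine measurable_invFT_section
    (h := fun b ξ => Θ' (1 - slopeSq ξ / b) * ((slopeSq ξ / b ^ 2 : ℝ) : ℂ) * h ξ) ?_ x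
  unfold Function.uncurry
  fun_prop

/-- A local Sobolev inequality in the dilation parameter. -/
theorem enorm_bumpOp_sq_le (hδ : 0 < δ) (hδ1 : δ ≤ 1) (hΘ : IsScaledBump δ K Θ Θ')
    {h : ConeSpace d → ℂ} (hh : IsSlabIntegrable h) {a : ℝ} (ha : 0 < a) (x : ConeSpace d) :
    ‖bumpOp Θ h a x‖ₑ ^ 2 ≤ ∫⁻ b in Ioi a, bumpEnergy δ Θ Θ' h b x := by
  set ℓ : ℝ := δ * a with hℓ
  have hℓ0 : 0 < ℓ := mul_pos hδ ha
  -- The length δa is the scale on which a bump of relative width δ varies, so averaging over I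
  -- balances the function against its derivative.
  set I : Set ℝ := Ioc a (a + ℓ) with hI
  have hIvol : volume I = ENNReal.ofReal ℓ := by rw [hI, Real.volume_Ioc, add_sub_cancel_left]
  set V : ℝ → ℝ≥0∞ := fun b => ‖bumpOp Θ h b x‖ₑ with hV
  set W : ℝ → ℝ≥0∞ := fun b => ‖bumpOp' Θ' h b x‖ₑ with hW
  have hVm : Measurable V := (measurable_bumpOp hΘ.continuous.measurable hh.measurable x).enorm
  have hWm : Measurable W := (measurable_bumpOp' hΘ.measurable' hh.measurable x).enorm
  have hCS : (∫⁻ c in I, W c) ^ 2 ≤ ENNReal.ofReal ℓ * ∫⁻ c in I, W c ^ 2 := by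
    have := ENNReal.lintegral_mul_le_sqrt (μ := volume.restrict I) (f := fun _ => 1) (g := W)
      aemeasurable_const hWm.aemeasurable
    simp only [one_mul, one_pow, lintegral_const, Measure.restrict_apply_univ, hIvol] at this
    refine (pow_le_pow_left' this 2).trans_eq ?_
    rw [mul_pow, ENNReal.rpow_half_sq, ENNReal.rpow_half_sq]
  have hpt : ∀ b ∈ I, V a ^ 2 ≤ 2 * V b ^ 2 + 2 * (ENNReal.ofReal ℓ * ∫⁻ c in I, W c ^ 2) := by
    intro b hb
    have h1 : V a ≤ V b + ∫⁻ c in I, W c := by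
      have e : bumpOp Θ h a x = bumpOp Θ h b x - ∫ c in Ioc a b, bumpOp' Θ' h c x := by
        rw [← hΘ.bumpOp_sub hδ hh ha hb.1.le x]
        ring
      simp only [hV]
      rw [e]
      refine enorm_sub_le.trans (add_le_add le_rfl ?_)
      refine (enorm_integral_le_lintegral_enorm _).trans (lintegral_mono_set ?_)
      exact Ioc_subset_Ioc_right hb.2
    refine (pow_le_pow_left' h1 2).trans ((ENNReal.add_sq_le _ _).trans ?_)
    exact add_le_add le_rfl (mul_le_mul' le_rfl hCS)
  have hav : ENNReal.ofReal ℓ * V a ^ 2 ≤ 2 * (∫⁻ b in I, V b ^ 2) +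
      2 * (ENNReal.ofReal ℓ * ∫⁻ c in I, W c ^ 2) * ENNReal.ofReal ℓ := by
    calc ENNReal.ofReal ℓ * V a ^ 2 = ∫⁻ _ in I, V a ^ 2 := by
          rw [setLIntegral_const, hIvol, mul_comm]
      _ ≤ ∫⁻ b in I, (2 * V b ^ 2 + 2 * (ENNReal.ofReal ℓ * ∫⁻ c in I, W c ^ 2)) :=
          setLIntegral_mono' measurableSet_Ioc hpt
      _ = _ := by
          rw [lintegral_add_right _ measurable_const, setLIntegral_const, hIvol,
            lintegral_const_mul' _ _ (by simp)]
  have hℓe : ENNReal.ofReal ℓ ≠ 0 := (ENNReal.ofReal_pos.2 hℓ0).ne'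
  have hmain : V a ^ 2 ≤ (ENNReal.ofReal ℓ)⁻¹ * (2 * ∫⁻ b in I, V b ^ 2) +
      2 * (ENNReal.ofReal ℓ * ∫⁻ c in I, W c ^ 2) := by
    refine (ENNReal.mul_le_mul_iff_right hℓe ENNReal.ofReal_ne_top).1 (hav.trans_eq ?_)
    rw [mul_add, ← mul_assoc (ENNReal.ofReal ℓ) (ENNReal.ofReal ℓ)⁻¹,
      ENNReal.mul_inv_cancel hℓe ENNReal.ofReal_ne_top, one_mul,
      mul_comm (ENNReal.ofReal ℓ) (2 * _)]
  refine hmain.trans (le_trans ?_ (lintegral_mono_set (s := I) fun b hb => hb.1))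
  unfold bumpEnergy
  rw [lintegral_add_left (by
    have := measurable_bumpOp hΘ.continuous.measurable hh.measurable x
    fun_prop)]
  refine add_le_add ?_ ?_
  · rw [← ENNReal.ofReal_inv_of_pos hℓ0, ← mul_assoc, ← lintegral_const_mul _ (hVm.pow_const 2)]
    refine setLIntegral_mono' measurableSet_Ioc fun b hb => mul_le_mul' ?_ le_rfl
    rw [← ENNReal.ofReal_ofNat 2, ← ENNReal.ofReal_mul (inv_nonneg.2 hℓ0.le)]
    refine ENNReal.ofReal_le_ofReal ?_
    have hb0 : 0 < b := ha.trans hb.1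
    -- Since δ ≤ 1 the whole interval lies below 2a, so 2/(δa) ≤ 4/(δb); this is the source of the 4
    -- in the energy.
    have hb2 : b ≤ 2 * a := by
      have := hb.2
      nlinarith
    rw [inv_mul_eq_div, div_le_div_iff₀ hℓ0 (mul_pos hδ hb0), hℓ]
    nlinarith
  · rw [← mul_assoc, ← lintegral_const_mul _ (hWm.pow_const 2)]
    refine setLIntegral_mono' measurableSet_Ioc fun b hb => mul_le_mul' ?_ le_rfl
    rw [← ENNReal.ofReal_ofNat 2, ← ENNReal.ofReal_mul (by norm_num)]
    refine ENNReal.ofReal_le_ofReal ?_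
    rw [hℓ]
    have := hb.1
    gcongr

/-- The Sobolev energy on the Fourier side. -/
theorem lintegral_bumpEnergy_le (hδ : 0 < δ) (hδ1 : δ ≤ 1 / 4) (hΘ : IsScaledBump δ K Θ Θ')
    {h : ConeSpace d → ℂ} (hh : Measurable h) {a : ℝ} (ha : 0 ≤ a) :
    ∫⁻ x, ∫⁻ b in Ioi a, bumpEnergy δ Θ Θ' h b x ≤
      ∫⁻ ξ, ({ξ | a ≤ slopeSq ξ * (1 + 4 * δ)} : Set (ConeSpace d)).indicator
        (fun ξ => ENNReal.ofReal (24 * K ^ 2) * ‖h ξ‖ₑ ^ 2) ξ := by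
  have hK := hΘ.nonneg
  have hΘm := hΘ.continuous.measurable
  have hΘm' := hΘ.measurable'
  have hj : Measurable (Function.uncurry fun (b : ℝ) (ξ : ConeSpace d) =>
      Θ (1 - slopeSq ξ / b) * h ξ) := by
    unfold Function.uncurry
    fun_prop
  have hj' : Measurable (Function.uncurry fun (b : ℝ) (ξ : ConeSpace d) =>
      Θ' (1 - slopeSq ξ / b) * ((slopeSq ξ / b ^ 2 : ℝ) : ℂ) * h ξ) := by
    unfold Function.uncurry
    fun_prop
  have h1 := lintegral_lintegral_invFT_sq_le (μ := volume.restrict (Ioi a)) hj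
    (ρ := fun b => ENNReal.ofReal (4 / (δ * b))) (by fun_prop)
  have h2 := lintegral_lintegral_invFT_sq_le (μ := volume.restrict (Ioi a)) hj'
    (ρ := fun b => ENNReal.ofReal (2 * (δ * b))) (by fun_prop)
  have hmE : ∀ x, Measurable fun b => ENNReal.ofReal (4 / (δ * b)) * ‖bumpOp Θ h b x‖ₑ ^ 2 := by
    intro x
    have := measurable_bumpOp hΘm hh x
    fun_prop
  have hmX : Measurable fun x => ∫⁻ b in Ioi a,
      ENNReal.ofReal (4 / (δ * b)) * ‖bumpOp Θ h b x‖ₑ ^ 2 := by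
    refine Measurable.lintegral_prod_right' (f := fun p : ConeSpace d × ℝ =>
      ENNReal.ofReal (4 / (δ * p.2)) * ‖bumpOp Θ h p.2 p.1‖ₑ ^ 2) ?_
    have := measurable_invFT_param hj
    exact (Measurable.ennreal_ofReal (by fun_prop)).mul (this.enorm.pow_const 2)
  have hmξ : ∀ ξ, Measurable fun b => ENNReal.ofReal (4 / (δ * b)) *
      ‖Θ (1 - slopeSq ξ / b) * h ξ‖ₑ ^ 2 := by
    intro ξ
    fun_prop
  have hmΞ : Measurable fun ξ => ∫⁻ b in Ioi a,
      ENNReal.ofReal (4 / (δ * b)) * ‖Θ (1 - slopeSq ξ / b) * h ξ‖ₑ ^ 2 := by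
    refine Measurable.lintegral_prod_right' (f := fun p : ConeSpace d × ℝ =>
      ENNReal.ofReal (4 / (δ * p.2)) * ‖Θ (1 - slopeSq p.1 / p.2) * h p.1‖ₑ ^ 2) ?_
    fun_prop
  unfold bumpEnergy
  simp_rw [lintegral_add_left (hmE _)]
  rw [lintegral_add_left hmX]
  refine (add_le_add h1 h2).trans ?_
  rw [← lintegral_add_left hmΞ]
  simp_rw [← lintegral_add_left (hmξ _)]
  refine lintegral_mono fun ξ => ?_
  set r := slopeSq ξ with hr
  have hr0 : 0 ≤ r := slopeSq_nonneg ξ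
  -- The bump forces r ≤ b ≤ r/(1-2δ) ≤ r(1+4δ), using δ ≤ 1/4. The integrand is at most 6K²/(δr) on
  -- an interval of length 4δr, whence 24K² with no power of δ.
  have hpt : ∀ b ∈ Ioi a, ENNReal.ofReal (4 / (δ * b)) * ‖Θ (1 - r / b) * h ξ‖ₑ ^ 2 +
      ENNReal.ofReal (2 * (δ * b)) * ‖Θ' (1 - r / b) * ((r / b ^ 2 : ℝ) : ℂ) * h ξ‖ₑ ^ 2 ≤
      (Icc r (r + 4 * δ * r)).indicator
        (fun _ => ENNReal.ofReal (6 * K ^ 2 / (δ * r)) * ‖h ξ‖ₑ ^ 2) b := by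
    intro b hb
    have hb0 : 0 < b := ha.trans_lt hb
    by_cases hu : 1 - r / b ∈ Icc (δ / 2) (2 * δ)
    swap
    · rw [hΘ.eq_zero _ hu, hΘ.eq_zero' _ hu]
      simp
    have hrb : r ≤ b := (div_le_one hb0).1 (by linarith [hu.1])
    have hbr : b * (1 - 2 * δ) ≤ r := by
      have h3 : 1 - 2 * δ ≤ r / b := by linarith [hu.2]
      rwa [le_div_iff₀ hb0, mul_comm] at h3
    have hbr2 : b ≤ r + 4 * δ * r := by nlinarith
    have hrpos : 0 < r := by nlinarith
    rw [indicator_of_mem (mem_Icc.2 ⟨hrb, hbr2⟩), enorm_mul, mul_pow, enorm_mul _ (h ξ), mul_pow,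
      ← mul_assoc, ← mul_assoc, ← add_mul]
    refine mul_le_mul' ?_ le_rfl
    rw [← ofReal_norm, ← ofReal_norm, ← ENNReal.ofReal_pow (norm_nonneg _),
      ← ENNReal.ofReal_pow (norm_nonneg _), ← ENNReal.ofReal_mul (by positivity),
      ← ENNReal.ofReal_mul (by positivity), ← ENNReal.ofReal_add (by positivity) (by positivity)]
    refine ENNReal.ofReal_le_ofReal ?_
    have e1 : ‖Θ (1 - r / b)‖ ^ 2 ≤ K ^ 2 := pow_le_pow_left₀ (norm_nonneg _) (hΘ.norm_le _) 2
    have e2 : ‖Θ' (1 - r / b) * ((r / b ^ 2 : ℝ) : ℂ)‖ ^ 2 ≤ (K / δ * b⁻¹) ^ 2 := by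
      refine pow_le_pow_left₀ (norm_nonneg _) ?_ 2
      rw [norm_mul, Complex.norm_real, Real.norm_of_nonneg (by positivity)]
      refine mul_le_mul (hΘ.norm_le' _) ?_ (by positivity) (by positivity)
      calc r / b ^ 2 ≤ b / b ^ 2 := by gcongr
        _ = b⁻¹ := by field_simp
    calc _ ≤ 4 / (δ * b) * K ^ 2 + 2 * (δ * b) * (K / δ * b⁻¹) ^ 2 :=
          add_le_add (mul_le_mul_of_nonneg_left e1 (by positivity))
            (mul_le_mul_of_nonneg_left e2 (by positivity))
      _ = 6 * K ^ 2 / (δ * b) := by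
          field_simp
          ring
      _ ≤ 6 * K ^ 2 / (δ * r) := by gcongr
  -- If the lower limit exceeds r(1+4δ) the integral is empty. Recording this restriction later
  -- localizes τ near r.
  by_cases har : a ≤ r * (1 + 4 * δ)
  swap
  · rw [indicator_of_notMem (by exact har)]
    refine le_of_eq (setLIntegral_eq_zero measurableSet_Ioi fun b hb => ?_)
    refine le_antisymm ((hpt b hb).trans_eq ?_) bot_le
    refine indicator_of_notMem (fun hmem => ?_) _
    have := hmem.2
    have := mem_Ioi.1 hb
    linarith
  · rw [indicator_of_mem (by exact har)]
    refine (setLIntegral_mono' measurableSet_Ioi hpt).trans ((setLIntegral_le_lintegral _ _).trans ?_)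
    rw [lintegral_indicator_const measurableSet_Icc, Real.volume_Icc, mul_right_comm]
    refine mul_le_mul' ?_ le_rfl
    rcases hr0.eq_or_lt with h0 | h0
    · rw [← h0]
      simp
    · rw [← ENNReal.ofReal_mul (by positivity)]
      refine ENNReal.ofReal_le_ofReal (le_of_eq ?_)
      field_simp
      ring

end IsScaledBump

theorem measurable_bumpEnergy_param (δ : ℝ) {Θ Θ' : ℝ → ℝ → ℂ} {h : ℝ → ConeSpace d → ℂ}
    (hΘ : Measurable (Function.uncurry Θ)) (hΘ' : Measurable (Function.uncurry Θ'))
    (hh : Measurable (Function.uncurry h)) :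
    Measurable fun q : ConeSpace d × ℝ × ℝ =>
      bumpEnergy δ (Θ q.2.1) (Θ' q.2.1) (h q.2.1) q.2.2 q.1 := by
  unfold bumpEnergy bumpOp bumpOp'
  have h1 := measurable_invFT_param (d := d)
    (h := fun (y : ℝ × ℝ) ξ => Θ y.1 (1 - slopeSq ξ / y.2) * h y.1 ξ) (by
      unfold Function.uncurry
      refine Measurable.mul ?_ ?_
      · exact hΘ.comp (g := Function.uncurry Θ)
          (f := fun p : (ℝ × ℝ) × ConeSpace d => (p.1.1, 1 - slopeSq p.2 / p.1.2)) (by fun_prop)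
      · exact hh.comp (g := Function.uncurry h)
          (f := fun p : (ℝ × ℝ) × ConeSpace d => (p.1.1, p.2)) (by fun_prop))
  have h2 := measurable_invFT_param (d := d)
    (h := fun (y : ℝ × ℝ) ξ => Θ' y.1 (1 - slopeSq ξ / y.2) *
      ((slopeSq ξ / y.2 ^ 2 : ℝ) : ℂ) * h y.1 ξ) (by
      unfold Function.uncurry
      refine Measurable.mul (Measurable.mul ?_ (by fun_prop)) ?_
      · exact hΘ'.comp (g := Function.uncurry Θ')
          (f := fun p : (ℝ × ℝ) × ConeSpace d => (p.1.1, 1 - slopeSq p.2 / p.1.2)) (by fun_prop)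
      · exact hh.comp (g := Function.uncurry h)
          (f := fun p : (ℝ × ℝ) × ConeSpace d => (p.1.1, p.2)) (by fun_prop))
  refine Measurable.add (Measurable.mul ?_ (h1.enorm.pow_const 2))
    (Measurable.mul ?_ (h2.enorm.pow_const 2))
  · exact Measurable.ennreal_ofReal (by fun_prop)
  · exact Measurable.ennreal_ofReal (by fun_prop)

theorem measurable_lintegral_bumpEnergy_param (δ : ℝ) {Θ Θ' : ℝ → ℝ → ℂ}
    {h : ℝ → ConeSpace d → ℂ} (hΘ : Measurable (Function.uncurry Θ))
    (hΘ' : Measurable (Function.uncurry Θ')) (hh : Measurable (Function.uncurry h)) {a : ℝ → ℝ}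
    (ha : Measurable a) : Measurable fun q : ConeSpace d × ℝ =>
      ∫⁻ b in Ioi (a q.2), bumpEnergy δ (Θ q.2) (Θ' q.2) (h q.2) b q.1 := by
  simp_rw [← lintegral_indicator measurableSet_Ioi]
  have h1 : Measurable fun p : (ConeSpace d × ℝ) × ℝ =>
      bumpEnergy δ (Θ p.1.2) (Θ' p.1.2) (h p.1.2) p.2 p.1.1 :=
    (measurable_bumpEnergy_param δ hΘ hΘ' hh).comp
      (f := fun p : (ConeSpace d × ℝ) × ℝ => (p.1.1, p.1.2, p.2)) (by fun_prop)
  refine Measurable.lintegral_prod_right' (f := fun p : (ConeSpace d × ℝ) × ℝ =>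
    (Ioi (a p.1.2)).indicator
      (fun b => bumpEnergy δ (Θ p.1.2) (Θ' p.1.2) (h p.1.2) b p.1.1) p.2) ?_
  have hs : MeasurableSet {p : (ConeSpace d × ℝ) × ℝ | a p.1.2 < p.2} :=
    measurableSet_lt (by fun_prop) (by fun_prop)
  exact h1.indicator hs

theorem lintegral_lintegral_bumpEnergy_le {δ K : ℝ} (hδ : 0 < δ) (hδ1 : δ ≤ 1 / 4)
    {Θ Θ' : ℝ → ℝ → ℂ} {h : ℝ → ConeSpace d → ℂ} (hΘ : Measurable (Function.uncurry Θ))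
    (hΘ' : Measurable (Function.uncurry Θ')) (hh : Measurable (Function.uncurry h)) {a : ℝ → ℝ}
    (ha : Measurable a) {ρ : ℝ → ℝ≥0∞} (hρ : Measurable ρ) {S : Set ℝ} (hS : MeasurableSet S)
    (hb : ∀ σ ∈ S, 0 ≤ a σ ∧ IsScaledBump δ K (Θ σ) (Θ' σ)) :
    ∫⁻ x, ∫⁻ σ in S, ρ σ * ∫⁻ b in Ioi (a σ), bumpEnergy δ (Θ σ) (Θ' σ) (h σ) b x ≤
      ∫⁻ σ in S, ρ σ * ∫⁻ ξ, ({ξ | a σ ≤ slopeSq ξ * (1 + 4 * δ)} : Set (ConeSpace d)).indicator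
        (fun ξ => ENNReal.ofReal (24 * K ^ 2) * ‖h σ ξ‖ₑ ^ 2) ξ := by
  have hm := measurable_lintegral_bumpEnergy_param δ hΘ hΘ' hh ha
  rw [lintegral_lintegral_swap ((hρ.comp measurable_snd).mul hm).aemeasurable]
  refine setLIntegral_mono' hS fun σ hσ => ?_
  have hmx : Measurable fun x => ∫⁻ b in Ioi (a σ), bumpEnergy δ (Θ σ) (Θ' σ) (h σ) b x :=
    hm.comp (f := fun x : ConeSpace d => (x, σ)) (by fun_prop)
  rw [lintegral_const_mul _ hmx]
  have h1 : Measurable (h σ) := hh.comp (f := fun ξ : ConeSpace d => (σ, ξ)) (by fun_prop)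
  exact mul_le_mul' le_rfl ((hb σ hσ).2.lintegral_bumpEnergy_le hδ hδ1 h1 (hb σ hσ).1)

/-- A rescaled cutoff is a scaled bump. -/
theorem IsConeCutoff.exists_isScaledBump {ψ : ℝ → ℂ} (hψ : IsConeCutoff ψ) :
    ∃ K : ℝ, 0 ≤ K ∧ ∀ δ : ℝ, 0 < δ →
      IsScaledBump δ K (fun u => ψ (u / δ)) fun u => _root_.deriv ψ (u / δ) / δ := by
  obtain ⟨M, hM0, hM⟩ := hψ.exists_bound
  obtain ⟨M', hM0', hM'⟩ := hψ.deriv.exists_bound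
  have hsupp : ∀ δ : ℝ, 0 < δ → ∀ u, u ∉ Icc (δ / 2) (2 * δ) → u / δ ∉ Icc (1 / 2 : ℝ) 2 := by
    intro δ hδ u hu h
    refine hu ⟨?_, ?_⟩
    · have := (le_div_iff₀ hδ).1 h.1
      linarith
    · exact (div_le_iff₀ hδ).1 h.2
  refine ⟨M + M', by positivity, fun δ hδ => ⟨fun u => ?_, ?_, fun u => ?_, fun u => ?_,
    fun u hu => ?_, fun u hu => ?_⟩⟩
  · have h1 : HasDerivAt (fun u : ℝ => u / δ) (1 / δ) u := (hasDerivAt_id u).div_const δ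
    refine ((hψ.hasDerivAt (u / δ)).scomp u h1).congr_deriv ?_
    rw [Complex.real_smul]
    push_cast
    ring
  · have := hψ.deriv.continuous.measurable
    fun_prop
  · linarith [hM (u / δ)]
  · rw [norm_div, Complex.norm_real, Real.norm_of_nonneg hδ.le]
    gcongr
    linarith [hM' (u / δ)]
  · exact hψ.eq_zero (hsupp δ hδ u hu)
  · rw [hψ.deriv.eq_zero (hsupp δ hδ u hu), zero_div]

/-- For s ≤ δ/4 the difference u - s stays between δ/4 and 2δ, so its powers of either sign are
comparable to those of δ. -/
theorem truncPow_le_scaled {δ s u : ℝ} (p : ℝ) (hδ : 0 < δ) (hs0 : 0 ≤ s) (hs : s ≤ δ / 4)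
    (hu : u ∈ Icc (δ / 2) (2 * δ)) : truncPow (u - s) p ≤ (4 : ℝ) ^ |p| * δ ^ p := by
  have hpos : 0 < u - s := by linarith [hu.1]
  have h1 : ((u - s) / δ) ^ p ≤ (4 : ℝ) ^ |p| := by
    refine Real.rpow_le_rpow_abs p (by norm_num) ?_ ?_
    · rw [le_div_iff₀ hδ]
      linarith [hu.1]
    · rw [div_le_iff₀ hδ]
      linarith [hu.2]
  rw [truncPow_of_pos hpos]
  rw [Real.div_rpow hpos.le hδ.le, div_le_iff₀ (Real.rpow_pos_of_pos hδ p)] at h1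
  exact h1

/-- A rescaled cutoff times a truncated power singular away from its support. -/
theorem IsConeCutoff.exists_isScaledBump_truncPow {ψ : ℝ → ℂ} (hψ : IsConeCutoff ψ) (p : ℝ) :
    ∃ K : ℝ, 0 ≤ K ∧ ∀ δ s : ℝ, 0 < δ → 0 ≤ s → s ≤ δ / 4 →
      IsScaledBump δ (K * δ ^ p) (fun u => ψ (u / δ) * (truncPow (u - s) p : ℂ))
        fun u => _root_.deriv ψ (u / δ) / δ * (truncPow (u - s) p : ℂ) +
          ψ (u / δ) * ((p * truncPow (u - s) (p - 1) : ℝ) : ℂ) := by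
  obtain ⟨K, hK0, hK⟩ := hψ.exists_isScaledBump
  set A : ℝ := (4 : ℝ) ^ |p| with hA
  set B : ℝ := (4 : ℝ) ^ |p - 1| with hB
  have hA0 : 0 ≤ A := by positivity
  have hB0 : 0 ≤ B := by positivity
  refine ⟨K * (A + |p| * B), by positivity, fun δ s hδ hs0 hs => ?_⟩
  have hΘ := hK δ hδ
  have hδp : 0 < δ ^ p := Real.rpow_pos_of_pos hδ p
  have hnn : 0 ≤ K * (A + |p| * B) * δ ^ p := by positivity
  refine ⟨fun u => ?_, ?_, fun u => ?_, fun u => ?_, fun u hu => ?_, fun u hu => ?_⟩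
  · rcases lt_or_ge s u with hsu | hsu
    · have h1 : HasDerivAt (fun u => truncPow (u - s) p) (p * truncPow (u - s) (p - 1)) u := by
        rw [truncPow_of_pos (sub_pos.2 hsu)]
        have h2 : HasDerivAt (fun u : ℝ => (u - s) ^ p) (p * (u - s) ^ (p - 1)) u := by
          have := ((hasDerivAt_id u).sub_const s).rpow_const (p := p)
            (Or.inl (sub_pos.2 hsu).ne')
          simpa using this
        refine h2.congr_of_eventuallyEq ?_
        filter_upwards [lt_mem_nhds hsu] with v hv
        exact truncPow_of_pos (sub_pos.2 hv) p
      exact (hΘ.hasDerivAt u).mul h1.ofReal_comp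
    · have hu : u < δ / 2 := by linarith
      have hu' : u ∉ Icc (δ / 2) (2 * δ) := fun h => absurd h.1 (not_le.2 hu)
      have e1 := hΘ.eq_zero u hu'
      have e2 := hΘ.eq_zero' u hu'
      rw [e1, e2, zero_mul, zero_mul, add_zero]
      refine (hasDerivAt_const u (0 : ℂ)).congr_of_eventuallyEq ?_
      filter_upwards [gt_mem_nhds hu] with v hv
      have := hΘ.eq_zero v fun h => absurd h.1 (not_le.2 hv)
      rw [this, zero_mul]
  · have h1 := hψ.continuous.measurable
    have h2 := hψ.deriv.continuous.measurable
    fun_prop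
  · by_cases hu : u ∈ Icc (δ / 2) (2 * δ)
    swap
    · have := hΘ.eq_zero u hu
      rw [this, zero_mul, norm_zero]
      exact hnn
    rw [norm_mul, Complex.norm_real, Real.norm_of_nonneg (truncPow_nonneg _ _)]
    calc _ ≤ K * (A * δ ^ p) := mul_le_mul (hΘ.norm_le u) (truncPow_le_scaled p hδ hs0 hs hu)
          (truncPow_nonneg _ _) hK0
      _ ≤ K * ((A + |p| * B) * δ ^ p) := by
          gcongr
          exact le_add_of_nonneg_right (by positivity)
      _ = _ := by ring
  · by_cases hu : u ∈ Icc (δ / 2) (2 * δ)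
    swap
    · have e1 := hΘ.eq_zero u hu
      have e2 := hΘ.eq_zero' u hu
      rw [e1, e2, zero_mul, zero_mul, add_zero, norm_zero]
      positivity
    refine (norm_add_le _ _).trans ?_
    rw [norm_mul, norm_mul (ψ _), Complex.norm_real, Complex.norm_real,
      Real.norm_of_nonneg (truncPow_nonneg _ _), Real.norm_eq_abs, abs_mul,
      abs_of_nonneg (truncPow_nonneg _ _)]
    calc _ ≤ K / δ * (A * δ ^ p) + K * (|p| * (B * δ ^ (p - 1))) := by
          refine add_le_add (mul_le_mul (hΘ.norm_le' u) (truncPow_le_scaled p hδ hs0 hs hu)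
            (truncPow_nonneg _ _) (by positivity)) (mul_le_mul (hΘ.norm_le u) ?_
            (mul_nonneg (abs_nonneg _) (truncPow_nonneg _ _)) hK0)
          exact mul_le_mul_of_nonneg_left (truncPow_le_scaled _ hδ hs0 hs hu) (abs_nonneg _)
      _ = _ := by
          rw [Real.rpow_sub_one hδ.ne']
          ring
  · have := hΘ.eq_zero u hu
    rw [this, zero_mul]
  · have e1 := hΘ.eq_zero u hu
    have e2 := hΘ.eq_zero' u hu
    rw [e1, e2, zero_mul, zero_mul, add_zero]

/-! ### The square function: measurability and small t -/

theorem measurable_localizedCone {φ ψ : ℝ → ℂ} (hφ : IsConeCutoff φ) (hψ : IsConeCutoff ψ) (j : ℕ)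
    (μ R : ℝ) (f : ConeL2 d) (x : ConeSpace d) :
    Measurable fun t => localizedCone φ ψ j μ R t f x := by
  refine measurable_invFT_section (h := fun t ξ =>
    ψ ((2 : ℝ) ^ j * (1 - slopeSq ξ / R ^ 2)) * φ (ξ (Fin.last d))
      * (truncPow (1 - slopeSq ξ / R ^ 2 - t ^ 2) (μ - 1) : ℂ) * (𝓕 f : ConeL2 d) ξ) ?_ x
  have h1 := hφ.continuous.measurable
  have h2 := hψ.continuous.measurable
  have h3 : Measurable (⇑(𝓕 f : ConeL2 d)) := (Lp.stronglyMeasurable _).measurable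
  unfold Function.uncurry
  fun_prop

theorem measurable_maximalSquare {φ ψ : ℝ → ℂ} (hφ : IsConeCutoff φ) (hψ : IsConeCutoff ψ) (j : ℕ)
    (μ ν : ℝ) (f : ConeL2 d) : Measurable (maximalSquare φ ψ j μ ν f) := by
  refine LowerSemicontinuous.measurable ?_
  unfold maximalSquare
  refine lowerSemicontinuous_biSup fun R hR => ?_
  refine Continuous.comp_lowerSemicontinuous (g := fun y : ℝ≥0∞ => y ^ (1 / 2 : ℝ))
    ENNReal.continuous_rpow_const ?_ (fun y z h => ENNReal.rpow_le_rpow h (by norm_num))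
  refine lowerSemicontinuous_lintegral (fun x => ?_) fun t => ?_
  · have := measurable_localizedCone hφ hψ j μ R f x
    fun_prop
  · exact (ENNReal.continuous_pow 2).comp
      (((continuous_invFT (fun ξ => ψ ((2 : ℝ) ^ j * (1 - slopeSq ξ / R ^ 2)) * φ (ξ (Fin.last d))
      * (truncPow (1 - slopeSq ξ / R ^ 2 - t ^ 2) (μ - 1) : ℂ)
      * (𝓕 f : ConeL2 d) ξ)).mul continuous_const).enorm)

/-- The symbol of `S^{R,t}_{j,μ}` with `δ = 2^{-j}`, `a = R²`, applied to a frequency function. -/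
def squareMult (φ ψ : ℝ → ℂ) (δ μ a t : ℝ) (F : ConeSpace d → ℂ) (ξ : ConeSpace d) : ℂ :=
  ψ ((1 - slopeSq ξ / a) / δ) * φ (ξ (Fin.last d))
    * (truncPow (1 - slopeSq ξ / a - t ^ 2) (μ - 1) : ℂ) * F ξ

theorem localizedCone_eq (φ ψ : ℝ → ℂ) (j : ℕ) (μ R t : ℝ) (f : ConeL2 d) (x : ConeSpace d) :
    localizedCone φ ψ j μ R t f x =
      invFT (squareMult φ ψ ((2 : ℝ) ^ j)⁻¹ μ (R ^ 2) t (𝓕 f : ConeL2 d)) x := by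
  unfold localizedCone invFT squareMult
  simp only [div_inv_eq_mul, mul_comm ((2 : ℝ) ^ j)]

theorem IsConeCutoff.isSlabIntegrable_mul {φ : ℝ → ℂ} (hφ : IsConeCutoff φ) {F : ConeSpace d → ℂ}
    (hFm : Measurable F) (hF : ∀ N, IntegrableOn F (coneSlab d N)) :
    IsSlabIntegrable fun ξ => φ (ξ (Fin.last d)) * F ξ := by
  obtain ⟨M, hM0, hM⟩ := hφ.exists_bound
  have hφm := hφ.continuous.measurable
  refine ⟨by fun_prop, fun N => ?_, fun ξ hξ => ?_⟩
  · refine ((hF N).norm.const_mul M).mono' (by fun_prop) (Filter.Eventually.of_forall fun ξ => ?_)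
    rw [norm_mul]
    exact mul_le_mul_of_nonneg_right (hM _) (norm_nonneg _)
  · rw [hφ.eq_zero hξ, zero_mul]

theorem lintegral_rpow_Ioc_le {p L : ℝ} (hp : -1 < p) (hL : 0 ≤ L) :
    ∫⁻ t in Ioc 0 L, ENNReal.ofReal (t ^ p) ≤ ENNReal.ofReal (L ^ (p + 1) / (p + 1)) := by
  rw [← lintegral_truncPow_Iic hp hL]
  refine le_trans (setLIntegral_mono' (g := fun v => ENNReal.ofReal (truncPow v p))
    measurableSet_Ioc fun v hv => ?_) (lintegral_mono_set fun v hv => hv.2)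
  rw [truncPow_of_pos hv.1]

theorem enorm_mul_sq_le {M : ℝ} {z w : ℂ} (hz : ‖z‖ ≤ M) :
    ‖z * w‖ₑ ^ 2 ≤ ENNReal.ofReal (M ^ 2) * ‖w‖ₑ ^ 2 := by
  rw [enorm_mul, mul_pow, ← ofReal_norm z, ← ENNReal.ofReal_pow (norm_nonneg _)]
  gcongr

theorem sqrt_rpow_eq {δ : ℝ} (hδ : 0 < δ) (p : ℝ) : √δ ^ p = δ ^ (p / 2) := by
  rw [Real.sqrt_eq_rpow, ← Real.rpow_mul hδ.le]
  congr 1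
  ring

/-- The range `t ≤ √δ/2`, where the truncated power is smooth on the support of the cutoff. -/
theorem exists_majorant_small {φ ψ : ℝ → ℂ} (hφ : IsConeCutoff φ) (hψ : IsConeCutoff ψ) (μ : ℝ)
    {ν : ℝ} (hν : -(3 / 4) < ν) :
    ∃ C : ℝ, ∀ δ : ℝ, 0 < δ → δ ≤ 1 / 4 → ∀ F : ConeSpace d → ℂ, MemLp F 2 → Measurable F →
      ∃ H : ConeSpace d → ℝ≥0∞, Measurable H ∧
        (∀ a, 0 < a → ∀ x, ∫⁻ t in Ioc 0 (√δ / 2), ENNReal.ofReal (t ^ (4 * ν + 2)) *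
          ‖invFT (squareMult φ ψ δ μ a t F) x‖ₑ ^ 2 ≤ H x) ∧
        ∫⁻ x, H x ≤
          ENNReal.ofReal (C * δ ^ (2 * μ + 2 * ν - 1 / 2)) * ∫⁻ ξ, ‖F ξ‖ₑ ^ 2 := by
  obtain ⟨K, hK0, hK⟩ := hψ.exists_isScaledBump_truncPow (μ - 1)
  obtain ⟨M, hM0, hM⟩ := hφ.exists_bound
  have hφm := hφ.continuous.measurable
  have hψm := hψ.continuous.measurable
  have hψm' := hψ.deriv.continuous.measurable
  refine ⟨24 * K ^ 2 * M ^ 2 / (4 * ν + 3), fun δ hδ hδ1 F hF hFm => ?_⟩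
  set Θ : ℝ → ℝ → ℂ := fun t u => ψ (u / δ) * (truncPow (u - t ^ 2) (μ - 1) : ℂ) with hΘ
  set Θ' : ℝ → ℝ → ℂ := fun t u => _root_.deriv ψ (u / δ) / δ * (truncPow (u - t ^ 2) (μ - 1) : ℂ) +
          ψ (u / δ) * (((μ - 1) * truncPow (u - t ^ 2) (μ - 1 - 1) : ℝ) : ℂ) with hΘ'
  set h : ConeSpace d → ℂ := fun ξ => φ (ξ (Fin.last d)) * F ξ with hh
  have hhS : IsSlabIntegrable h := hφ.isSlabIntegrable_mul hFm (integrableOn_coneSlab hF)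
  have hb : ∀ t ∈ Ioc 0 (√δ / 2), IsScaledBump δ (K * δ ^ (μ - 1)) (Θ t) (Θ' t) := by
    intro t ht
    refine hK δ (t ^ 2) hδ (sq_nonneg t) ?_
    calc t ^ 2 ≤ (√δ / 2) ^ 2 := pow_le_pow_left₀ ht.1.le ht.2 2
      _ = δ / 4 := by
          rw [div_pow, Real.sq_sqrt hδ.le]
          norm_num
  have hΘm : Measurable (Function.uncurry Θ) := by
    rw [hΘ]
    unfold Function.uncurry
    fun_prop
  have hΘm' : Measurable (Function.uncurry Θ') := by
    rw [hΘ']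
    unfold Function.uncurry
    fun_prop
  have hhm : Measurable (Function.uncurry fun _ : ℝ => h) := hhS.measurable.comp measurable_snd
  have hρ : Measurable fun t : ℝ => ENNReal.ofReal (t ^ (4 * ν + 2)) := by fun_prop
  -- The energy over all b > 0 does not involve a, so this majorant serves every R.
  refine ⟨fun x => ∫⁻ t in Ioc 0 (√δ / 2), ENNReal.ofReal (t ^ (4 * ν + 2)) *
    ∫⁻ b in Ioi 0, bumpEnergy δ (Θ t) (Θ' t) h b x, ?_, fun a ha x => ?_, ?_⟩
  · have h1 := measurable_lintegral_bumpEnergy_param δ hΘm hΘm' hhm (a := fun _ => 0)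
      measurable_const
    exact Measurable.lintegral_prod_right' (f := fun q : ConeSpace d × ℝ =>
      ENNReal.ofReal (q.2 ^ (4 * ν + 2)) * ∫⁻ b in Ioi 0, bumpEnergy δ (Θ q.2) (Θ' q.2) h b q.1)
      ((hρ.comp measurable_snd).mul h1)
  · refine setLIntegral_mono' measurableSet_Ioc fun t ht => mul_le_mul' le_rfl ?_
    have e : invFT (squareMult φ ψ δ μ a t F) x = bumpOp (Θ t) h a x := by
      unfold bumpOp
      congr 1
      funext ξ
      simp only [squareMult, hΘ, hh]
      ring
    rw [e]
    exact ((hb t ht).enorm_bumpOp_sq_le hδ (hδ1.trans (by norm_num)) hhS ha x).trans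
      (lintegral_mono_set (Ioi_subset_Ioi ha.le))
  · refine (lintegral_lintegral_bumpEnergy_le hδ hδ1 hΘm hΘm' hhm (a := fun _ => 0)
      measurable_const hρ measurableSet_Ioc fun t ht => ⟨le_rfl, hb t ht⟩).trans ?_
    set E : ℝ≥0∞ := ∫⁻ ξ, ‖F ξ‖ₑ ^ 2 with hE
    have hν3 : 0 < 4 * ν + 3 := by linarith
    have h1 : ∀ t : ℝ, ∫⁻ ξ, ({ξ | (0 : ℝ) ≤ slopeSq ξ * (1 + 4 * δ)} : Set (ConeSpace d)).indicator
        (fun ξ => ENNReal.ofReal (24 * (K * δ ^ (μ - 1)) ^ 2) * ‖h ξ‖ₑ ^ 2) ξ ≤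
        ENNReal.ofReal (24 * (K * δ ^ (μ - 1)) ^ 2) * (ENNReal.ofReal (M ^ 2) * E) := by
      intro t
      rw [hE, ← lintegral_const_mul' _ _ ENNReal.ofReal_ne_top,
        ← lintegral_const_mul' _ _ ENNReal.ofReal_ne_top]
      refine lintegral_mono fun ξ => (indicator_le_self _ _ ξ).trans ?_
      exact mul_le_mul' le_rfl (enorm_mul_sq_le (hM _))
    calc _ ≤ ∫⁻ t in Ioc 0 (√δ / 2), ENNReal.ofReal (t ^ (4 * ν + 2)) *
          (ENNReal.ofReal (24 * (K * δ ^ (μ - 1)) ^ 2) * (ENNReal.ofReal (M ^ 2) * E)) :=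
          lintegral_mono fun t => mul_le_mul' le_rfl (h1 t)
      _ ≤ ENNReal.ofReal (√δ ^ (4 * ν + 3) / (4 * ν + 3)) *
          (ENNReal.ofReal (24 * (K * δ ^ (μ - 1)) ^ 2) * (ENNReal.ofReal (M ^ 2) * E)) := by
          rw [lintegral_mul_const _ hρ]
          refine mul_le_mul' ?_ le_rfl
          refine (lintegral_mono_set (Ioc_subset_Ioc_right
            (half_le_self (Real.sqrt_nonneg δ)))).trans ?_
          refine (lintegral_rpow_Ioc_le (by linarith) (Real.sqrt_nonneg δ)).trans_eq ?_
          rw [show 4 * ν + 2 + 1 = 4 * ν + 3 by ring]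
      _ = _ := by
          rw [← mul_assoc, ← mul_assoc, ← ENNReal.ofReal_mul (by positivity),
            ← ENNReal.ofReal_mul (by positivity), sqrt_rpow_eq hδ, mul_pow, ← Real.rpow_two (δ ^ _),
            ← Real.rpow_mul hδ.le]
          congr 2
          -- The t-integral contributes √δ^{4ν+3}, convergent because ν > -3/4, and the squared size
          -- of the bump contributes δ^{2(μ-1)}.
          rw [show 2 * μ + 2 * ν - 1 / 2 = (4 * ν + 3) / 2 + (μ - 1) * 2 by ring, Real.rpow_add hδ]
          ring

/-! ### The square function: large t -/

/-- The Riesz-type symbol `(τ - slope²)_+^{μ-1} φ(ξ_n)` applied to a frequency function. -/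
def rieszMult (φ : ℝ → ℂ) (μ : ℝ) (F : ConeSpace d → ℂ) (τ : ℝ) (ξ : ConeSpace d) : ℂ :=
  φ (ξ (Fin.last d)) * ((truncPow (τ - slopeSq ξ) (μ - 1) : ℂ) * F ξ)

theorem measurable_rieszMult {φ : ℝ → ℂ} (hφ : IsConeCutoff φ) (μ : ℝ) {F : ConeSpace d → ℂ}
    (hFm : Measurable F) : Measurable (Function.uncurry (rieszMult φ μ F)) := by
  have hφm := hφ.continuous.measurable
  unfold Function.uncurry rieszMult
  fun_prop

/-- For μ < 1 the singularity on τ = slope² may destroy integrability for particular τ. By Tonelli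
this happens only on a null set, which is enough because the estimate is integrated in τ. -/
theorem ae_integrableOn_truncPow_mul {μ : ℝ} (hμ : 0 < μ) {F : ConeSpace d → ℂ} (hF : MemLp F 2)
    (hFm : Measurable F) : ∀ᵐ τ : ℝ, ∀ N,
      IntegrableOn (fun ξ => (truncPow (τ - slopeSq ξ) (μ - 1) : ℂ) * F ξ) (coneSlab d N) := by
  have hm : Measurable fun q : ℝ × ConeSpace d =>
      ‖(truncPow (q.1 - slopeSq q.2) (μ - 1) : ℂ) * F q.2‖ₑ := by fun_prop
  have key : ∀ n : ℕ, ∀ᵐ τ : ℝ, τ ∈ Iic (n : ℝ) →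
      ∫⁻ ξ in coneSlab d n, ‖(truncPow (τ - slopeSq ξ) (μ - 1) : ℂ) * F ξ‖ₑ < ⊤ := by
    intro n
    rw [← ae_restrict_iff' measurableSet_Iic]
    refine ae_lt_top (Measurable.lintegral_prod_right' hm) (ne_top_of_le_ne_top ?_
      (?_ : ∫⁻ τ in Iic (n : ℝ), ∫⁻ ξ in coneSlab d n,
        ‖(truncPow (τ - slopeSq ξ) (μ - 1) : ℂ) * F ξ‖ₑ ≤
        ENNReal.ofReal ((n : ℝ) ^ (μ - 1 + 1) / (μ - 1 + 1)) * ∫⁻ ξ in coneSlab d n, ‖F ξ‖ₑ))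
    · exact ENNReal.mul_ne_top ENNReal.ofReal_ne_top (integrableOn_coneSlab hF n).2.ne
    · rw [lintegral_lintegral_swap hm.aemeasurable,
        ← lintegral_const_mul' _ _ ENNReal.ofReal_ne_top]
      refine lintegral_mono fun ξ => ?_
      simp_rw [enorm_mul]
      rw [lintegral_mul_const _ (by fun_prop)]
      refine mul_le_mul' ?_ le_rfl
      have hr := slopeSq_nonneg ξ
      rw [← lintegral_truncPow_sub_right (c := slopeSq ξ) (by linarith) n.cast_nonneg]
      refine le_trans (le_of_eq ?_) (lintegral_mono_set (Iic_subset_Iic.2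
        (le_add_of_nonneg_left hr)))
      refine lintegral_congr fun τ => ?_
      rw [← ofReal_norm, Complex.norm_real, Real.norm_of_nonneg (truncPow_nonneg _ _)]
  filter_upwards [ae_all_iff.2 key] with τ hτ N
  obtain ⟨n, hn⟩ := exists_nat_ge (max τ N)
  have h1 : IntegrableOn (fun ξ => (truncPow (τ - slopeSq ξ) (μ - 1) : ℂ) * F ξ) (coneSlab d n) :=
    ⟨Measurable.aestronglyMeasurable (by fun_prop), hτ n ((le_max_left _ _).trans hn)⟩
  exact h1.mono_set fun ξ hξ => ⟨hξ.1, hξ.2.trans ((le_max_right _ _).trans hn)⟩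

/-- The integrand lives on r < τ ≤ r(1+4δ), where τ is comparable to r. The integral is thus about
r^{1-2μ}(4δr)^{2μ-1}/(2μ-1), in which r cancels; convergence at τ = r requires μ > 1/2. -/
theorem lintegral_fibre_le {r δ μ : ℝ} (hr : 0 ≤ r) (hδ : 0 < δ) (hδ1 : δ ≤ 1 / 4)
    (hμ : 1 / 2 < μ) :
    ∫⁻ τ in Ioi (0 : ℝ), (Iic (r * (1 + 4 * δ))).indicator (fun τ =>
      ENNReal.ofReal (τ ^ (1 - 2 * μ)) * ENNReal.ofReal (truncPow (τ - r) (2 * (μ - 1)))) τ ≤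
    ENNReal.ofReal ((2 : ℝ) ^ |1 - 2 * μ| * ((4 : ℝ) ^ (2 * μ - 1) / (2 * μ - 1)) *
      δ ^ (2 * μ - 1)) := by
  have hp : 0 < 2 * μ - 1 := by linarith
  rcases hr.eq_or_lt with h0 | h0
  · rw [← h0, zero_mul]
    refine le_trans (le_of_eq ?_) bot_le
    refine setLIntegral_eq_zero measurableSet_Ioi fun τ hτ => ?_
    exact indicator_of_notMem (fun h => absurd (mem_Iic.1 h) (not_le.2 hτ)) _
  have hpt : ∀ τ : ℝ, (Iic (r * (1 + 4 * δ))).indicator (fun τ =>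
      ENNReal.ofReal (τ ^ (1 - 2 * μ)) * ENNReal.ofReal (truncPow (τ - r) (2 * (μ - 1)))) τ ≤
      ENNReal.ofReal ((2 : ℝ) ^ |1 - 2 * μ| * r ^ (1 - 2 * μ)) *
        (Iic (r + 4 * δ * r)).indicator
          (fun τ => ENNReal.ofReal (truncPow (τ - r) (2 * (μ - 1)))) τ := by
    intro τ
    have er : r * (1 + 4 * δ) = r + 4 * δ * r := by ring
    rw [er]
    by_cases hτ : τ ∈ Iic (r + 4 * δ * r)
    swap
    · rw [indicator_of_notMem hτ]
      exact bot_le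
    rw [indicator_of_mem hτ, indicator_of_mem hτ]
    rcases le_or_gt τ r with h | h
    · rw [truncPow_of_nonpos (sub_nonpos.2 h)]
      simp
    refine mul_le_mul' (ENNReal.ofReal_le_ofReal ?_) le_rfl
    have h2 : (τ / r) ^ (1 - 2 * μ) ≤ (2 : ℝ) ^ |1 - 2 * μ| := by
      refine Real.rpow_le_rpow_abs _ two_pos ?_ ?_
      · rw [le_div_iff₀ h0]
        linarith
      · rw [div_le_iff₀ h0]
        have := mem_Iic.1 hτ
        nlinarith
    rwa [Real.div_rpow (h0.trans h).le h0.le, div_le_iff₀ (Real.rpow_pos_of_pos h0 _)] at h2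
  refine (lintegral_mono fun τ => hpt τ).trans ((setLIntegral_le_lintegral _ _).trans ?_)
  rw [lintegral_const_mul' _ _ ENNReal.ofReal_ne_top, lintegral_indicator measurableSet_Iic,
    lintegral_truncPow_sub_right (by linarith) (by positivity),
    ← ENNReal.ofReal_mul (by positivity)]
  refine ENNReal.ofReal_le_ofReal (le_of_eq ?_)
  rw [show 2 * (μ - 1) + 1 = 2 * μ - 1 by ring, Real.mul_rpow (by positivity) h0.le,
    Real.mul_rpow (by norm_num) hδ.le, show 1 - 2 * μ = -(2 * μ - 1) by ring, Real.rpow_neg h0.le,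
    abs_neg]
  have : 0 < r ^ (2 * μ - 1) := Real.rpow_pos_of_pos h0 _
  field_simp

/-- Factoring 1/a out of 1 - r/a - t² leaves τ - r with τ = a(1-t²). Once τ is the variable, a
enters the symbol only through the smooth bump, and the truncated power is never differentiated. -/
theorem invFT_squareMult (φ ψ : ℝ → ℂ) (δ μ : ℝ) {a : ℝ} (ha : 0 < a) (t : ℝ)
    (F : ConeSpace d → ℂ) (x : ConeSpace d) :
    invFT (squareMult φ ψ δ μ a t F) x = ((a ^ (1 - μ) : ℝ) : ℂ) *
      bumpOp (fun u => ψ (u / δ)) (rieszMult φ μ F (a * (1 - t ^ 2))) a x := by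
  unfold bumpOp
  rw [← invFT_const_mul]
  congr 1
  funext ξ
  have e : truncPow (1 - slopeSq ξ / a - t ^ 2) (μ - 1) =
      a ^ (1 - μ) * truncPow (a * (1 - t ^ 2) - slopeSq ξ) (μ - 1) := by
    have h1 : 1 - slopeSq ξ / a - t ^ 2 = a⁻¹ * (a * (1 - t ^ 2) - slopeSq ξ) := by
      field_simp
      ring
    rw [h1, truncPow_mul (inv_pos.2 ha), Real.inv_rpow ha.le, ← Real.rpow_neg ha.le, neg_sub]
  simp only [squareMult, rieszMult, e]
  push_cast
  ring

/-- The substitution `τ = a(1 - t²)`. -/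
theorem lintegral_comp_one_sub_sq_le {a : ℝ} (ha : 0 < a) {S : Set ℝ} (hS : MeasurableSet S)
    (hSs : ∀ t ∈ S, 0 < t ∧ t ^ 2 ≤ 1 / 2) (V : ℝ → ℝ≥0∞) :
    ∫⁻ t in S, ENNReal.ofReal (2 * a * t) * V (a * (1 - t ^ 2)) ≤ ∫⁻ τ in Icc (a / 2) a, V τ := by
  have hinj : InjOn (fun t : ℝ => a * (1 - t ^ 2)) S := by
    intro t ht s hs h
    have h1 : t ^ 2 = s ^ 2 := by
      have := mul_left_cancel₀ ha.ne' h
      linarith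
    exact (pow_left_inj₀ (hSs t ht).1.le (hSs s hs).1.le two_ne_zero).1 h1
  have himg : (fun t : ℝ => a * (1 - t ^ 2)) '' S ⊆ Icc (a / 2) a := by
    rintro _ ⟨t, ht, rfl⟩
    have := (hSs t ht).2
    have := sq_nonneg t
    exact ⟨by simp only; nlinarith, by simp only; nlinarith⟩
  refine le_trans (le_of_eq ?_) (lintegral_mono_set himg)
  rw [lintegral_image_eq_lintegral_abs_deriv_mul hS (f' := fun t => a * (-(2 * t)))
    (fun t _ => ?_) hinj]
  · refine setLIntegral_congr_fun hS fun t ht => ?_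
    have ht0 := (hSs t ht).1
    congr 2
    rw [abs_mul, abs_neg, abs_of_pos ha, abs_of_pos (by linarith)]
    ring
  · have h1 : HasDerivAt (fun t : ℝ => t ^ 2) (2 * t) t := by simpa using hasDerivAt_pow 2 t
    exact ((h1.const_sub 1).const_mul a).hasDerivWithinAt

/-- The range `t ≥ √δ/2`, where `dt` is comparable to `dτ`, `τ = a(1 - t²)`. -/
theorem exists_majorant_large {φ ψ : ℝ → ℂ} (hφ : IsConeCutoff φ) (hψ : IsConeCutoff ψ) {μ : ℝ}
    (hμ : 1 / 2 < μ) (ν : ℝ) :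
    ∃ C : ℝ, ∀ δ : ℝ, 0 < δ → δ ≤ 1 / 4 → ∀ F : ConeSpace d → ℂ, MemLp F 2 → Measurable F →
      ∃ H : ConeSpace d → ℝ≥0∞, Measurable H ∧
        (∀ a, 0 < a → ∀ x, ∫⁻ t in Ioc (√δ / 2) √(2 * δ), ENNReal.ofReal (t ^ (4 * ν + 2)) *
          ‖invFT (squareMult φ ψ δ μ a t F) x‖ₑ ^ 2 ≤ H x) ∧
        ∫⁻ x, H x ≤
          ENNReal.ofReal (C * δ ^ (2 * μ + 2 * ν - 1 / 2)) * ∫⁻ ξ, ‖F ξ‖ₑ ^ 2 := by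
  obtain ⟨K, hK0, hK⟩ := hψ.exists_isScaledBump
  obtain ⟨M, hM0, hM⟩ := hφ.exists_bound
  have hψm := hψ.continuous.measurable
  have hψm' := hψ.deriv.continuous.measurable
  set A : ℝ := (2 : ℝ) ^ |4 * ν + 1| with hA
  set B : ℝ := (2 : ℝ) ^ |1 - 2 * μ| with hB
  set D : ℝ := B * ((4 : ℝ) ^ (2 * μ - 1) / (2 * μ - 1)) with hD
  have hA0 : 0 ≤ A := by positivity
  have hB0 : 0 ≤ B := by positivity
  have hμ1 : 0 < 2 * μ - 1 := by linarith
  have hD0 : 0 ≤ D := by positivity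
  refine ⟨A * B * (24 * K ^ 2 * M ^ 2 * D), fun δ hδ hδ1 F hF hFm => ?_⟩
  have hΘ := hK δ hδ
  set Θ : ℝ → ℂ := fun u => ψ (u / δ) with hΘdef
  set Θ' : ℝ → ℂ := fun u => _root_.deriv ψ (u / δ) / δ with hΘdef'
  set h : ℝ → ConeSpace d → ℂ := rieszMult φ μ F with hh
  have hhm : Measurable (Function.uncurry h) := measurable_rieszMult hφ μ hFm
  have hΘm : Measurable (Function.uncurry fun _ : ℝ => Θ) :=
    hΘ.continuous.measurable.comp measurable_snd
  have hΘm' : Measurable (Function.uncurry fun _ : ℝ => Θ') := hΘ.measurable'.comp measurable_snd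
  have hρ : Measurable fun τ : ℝ => ENNReal.ofReal (τ ^ (1 - 2 * μ)) := by fun_prop
  set J : ℝ → ConeSpace d → ℝ≥0∞ := fun τ x => ∫⁻ b in Ioi τ, bumpEnergy δ Θ Θ' (h τ) b x with hJ
  have hJm : Measurable fun q : ConeSpace d × ℝ => J q.2 q.1 :=
    measurable_lintegral_bumpEnergy_param δ hΘm hΘm' hhm measurable_id
  set q : ℝ := 2 * ν + 1 / 2 with hq
  have hδq : 0 < δ ^ q := Real.rpow_pos_of_pos hδ q
  have hslab : ∀ᵐ τ : ℝ, IsSlabIntegrable (h τ) := by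
    filter_upwards [ae_integrableOn_truncPow_mul (d := d) (by linarith : 0 < μ) hF hFm] with τ hτ
    exact hφ.isSlabIntegrable_mul (by fun_prop) hτ
  refine ⟨fun x => ENNReal.ofReal (A * B * δ ^ q) *
    ∫⁻ τ in Ioi 0, ENNReal.ofReal (τ ^ (1 - 2 * μ)) * J τ x, ?_, fun a ha x => ?_, ?_⟩
  · exact (Measurable.lintegral_prod_right' (f := fun p : ConeSpace d × ℝ =>
      ENNReal.ofReal (p.2 ^ (1 - 2 * μ)) * J p.2 p.1)
      ((hρ.comp measurable_snd).mul hJm)).const_mul _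
  · set V : ℝ → ℝ≥0∞ := fun τ => ‖bumpOp Θ (h τ) a x‖ₑ ^ 2 with hV
    have hsq : 0 < √δ := Real.sqrt_pos.2 hδ
    have hS : ∀ t ∈ Ioc (√δ / 2) √(2 * δ), 0 < t ∧ t ^ 2 ≤ 1 / 2 := by
      intro t ht
      have ht0 : 0 < t := (half_pos hsq).trans ht.1
      refine ⟨ht0, ?_⟩
      have := (Real.le_sqrt ht0.le (by positivity)).1 ht.2
      linarith
    have h1 : ∀ t ∈ Ioc (√δ / 2) √(2 * δ), ENNReal.ofReal (t ^ (4 * ν + 2)) *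
        ‖invFT (squareMult φ ψ δ μ a t F) x‖ₑ ^ 2 ≤ ENNReal.ofReal (A * δ ^ q * a ^ (1 - 2 * μ)) *
          (ENNReal.ofReal (2 * a * t) * V (a * (1 - t ^ 2))) := by
      intro t ht
      have ht0 : 0 < t := (hS t ht).1
      have hapos : 0 < a ^ (1 - 2 * μ) := Real.rpow_pos_of_pos ha _
      rw [invFT_squareMult φ ψ δ μ ha, enorm_mul, mul_pow, ← mul_assoc, ← mul_assoc]
      refine mul_le_mul' ?_ le_rfl
      rw [← ofReal_norm, Complex.norm_real, Real.norm_of_nonneg (Real.rpow_nonneg ha.le _),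
        ← ENNReal.ofReal_pow (Real.rpow_nonneg ha.le _), ← ENNReal.ofReal_mul (by positivity),
        ← ENNReal.ofReal_mul (by positivity)]
      refine ENNReal.ofReal_le_ofReal ?_
      have e1 : (a ^ (1 - μ)) ^ 2 = a * a ^ (1 - 2 * μ) := by
        rw [← Real.rpow_two, ← Real.rpow_mul ha.le]
        nth_rewrite 2 [← Real.rpow_one a]
        rw [← Real.rpow_add ha]
        congr 1
        ring
      -- Here t/√δ lies in [1/2, 2], so t^{4ν+1} is at most a constant times δ^{2ν+1/2}; one factor
      -- t is kept for dτ = 2at dt, up to orientation.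
      have e2 : t ^ (4 * ν + 2) ≤ A * δ ^ q * t := by
        have h2 : (t / √δ) ^ (4 * ν + 1) ≤ A := by
          refine Real.rpow_le_rpow_abs _ two_pos ?_ ?_
          · rw [le_div_iff₀ hsq]
            linarith [ht.1]
          · rw [div_le_iff₀ hsq]
            refine ht.2.trans ?_
            rw [Real.sqrt_mul (by norm_num)]
            refine mul_le_mul_of_nonneg_right ?_ hsq.le
            rw [Real.sqrt_le_left (by norm_num)]
            norm_num
        rw [Real.div_rpow ht0.le hsq.le, sqrt_rpow_eq hδ,
          div_le_iff₀ (Real.rpow_pos_of_pos hδ _),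
          show (4 * ν + 1) / 2 = q by rw [hq]; ring] at h2
        rw [show 4 * ν + 2 = 4 * ν + 1 + 1 by ring, Real.rpow_add_one ht0.ne']
        exact mul_le_mul_of_nonneg_right h2 ht0.le
      rw [e1]
      calc t ^ (4 * ν + 2) * (a * a ^ (1 - 2 * μ)) ≤ A * δ ^ q * t * (a * a ^ (1 - 2 * μ)) :=
            mul_le_mul_of_nonneg_right e2 (by positivity)
        _ ≤ 2 * (A * δ ^ q * t * (a * a ^ (1 - 2 * μ))) :=
            le_mul_of_one_le_left (by positivity) one_le_two
        _ = _ := by ring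
    have h2 : ∀ᵐ τ : ℝ, τ ∈ Icc (a / 2) a → ENNReal.ofReal (a ^ (1 - 2 * μ)) * V τ ≤
        ENNReal.ofReal B * (ENNReal.ofReal (τ ^ (1 - 2 * μ)) * J τ x) := by
      filter_upwards [hslab] with τ hτS hτ
      have hτ0 : 0 < τ := (half_pos ha).trans_le hτ.1
      rw [← mul_assoc, ← ENNReal.ofReal_mul hB0]
      refine mul_le_mul' (ENNReal.ofReal_le_ofReal ?_) ?_
      · have h3 : (a / τ) ^ (1 - 2 * μ) ≤ B := by
          refine Real.rpow_le_rpow_abs _ two_pos ?_ ?_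
          · rw [le_div_iff₀ hτ0]
            linarith [hτ.2]
          · rw [div_le_iff₀ hτ0]
            linarith [hτ.1]
        rwa [Real.div_rpow ha.le hτ0.le, div_le_iff₀ (Real.rpow_pos_of_pos hτ0 _)] at h3
      -- Sobolev at a gives the energy over b > a. Since τ ≤ a, enlarging to b > τ removes a from
      -- the bound while retaining a lower limit for the fibre integral.
      · exact (hΘ.enorm_bumpOp_sq_le hδ (hδ1.trans (by norm_num)) hτS ha x).trans
          (lintegral_mono_set (Ioi_subset_Ioi hτ.2))
    calc _ ≤ ∫⁻ t in Ioc (√δ / 2) √(2 * δ), ENNReal.ofReal (A * δ ^ q * a ^ (1 - 2 * μ)) *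
          (ENNReal.ofReal (2 * a * t) * V (a * (1 - t ^ 2))) :=
          setLIntegral_mono' measurableSet_Ioc h1
      _ ≤ ENNReal.ofReal (A * δ ^ q * a ^ (1 - 2 * μ)) * ∫⁻ τ in Icc (a / 2) a, V τ := by
          rw [lintegral_const_mul' _ _ ENNReal.ofReal_ne_top]
          exact mul_le_mul' le_rfl (lintegral_comp_one_sub_sq_le ha measurableSet_Ioc hS V)
      _ = ENNReal.ofReal (A * δ ^ q) *
          ∫⁻ τ in Icc (a / 2) a, ENNReal.ofReal (a ^ (1 - 2 * μ)) * V τ := by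
          rw [ENNReal.ofReal_mul (by positivity), mul_assoc,
            lintegral_const_mul' _ _ ENNReal.ofReal_ne_top]
      _ ≤ ENNReal.ofReal (A * δ ^ q) * ∫⁻ τ in Icc (a / 2) a,
          ENNReal.ofReal B * (ENNReal.ofReal (τ ^ (1 - 2 * μ)) * J τ x) :=
          mul_le_mul' le_rfl (lintegral_mono_ae ((ae_restrict_iff' measurableSet_Icc).2 h2))
      _ ≤ _ := by
          rw [lintegral_const_mul' _ _ ENNReal.ofReal_ne_top, ← mul_assoc,
            ← ENNReal.ofReal_mul (by positivity)]
          refine mul_le_mul' (le_of_eq (by ring_nf)) (lintegral_mono_set fun τ hτ => ?_)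
          exact (half_pos ha).trans_le hτ.1
  · set E : ℝ≥0∞ := ∫⁻ ξ, ‖F ξ‖ₑ ^ 2 with hE
    have hm1 : Measurable fun x => ∫⁻ τ in Ioi 0, ENNReal.ofReal (τ ^ (1 - 2 * μ)) * J τ x :=
      Measurable.lintegral_prod_right' (f := fun p : ConeSpace d × ℝ =>
        ENNReal.ofReal (p.2 ^ (1 - 2 * μ)) * J p.2 p.1) ((hρ.comp measurable_snd).mul hJm)
    rw [lintegral_const_mul _ hm1]
    have h1 := lintegral_lintegral_bumpEnergy_le (S := Ioi 0) hδ hδ1 hΘm hΘm' hhm measurable_id hρ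
      measurableSet_Ioi fun τ hτ => ⟨(mem_Ioi.1 hτ).le, hΘ⟩
    simp only [id] at h1
    set G : ℝ → ConeSpace d → ℝ≥0∞ := fun τ ξ => ENNReal.ofReal (τ ^ (1 - 2 * μ)) *
      ({ξ | τ ≤ slopeSq ξ * (1 + 4 * δ)} : Set (ConeSpace d)).indicator
        (fun ξ => ENNReal.ofReal (24 * K ^ 2) * ‖h τ ξ‖ₑ ^ 2) ξ with hG
    have hGm : Measurable (Function.uncurry G) := by
      refine (hρ.comp measurable_fst).mul ?_
      have hs : MeasurableSet {p : ℝ × ConeSpace d | p.1 ≤ slopeSq p.2 * (1 + 4 * δ)} :=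
        measurableSet_le (by fun_prop) (by fun_prop)
      exact ((hhm.enorm.pow_const 2).const_mul (ENNReal.ofReal (24 * K ^ 2))).indicator hs
    have h2 : ∫⁻ τ in Ioi (0 : ℝ), ENNReal.ofReal (τ ^ (1 - 2 * μ)) *
        ∫⁻ ξ, ({ξ | τ ≤ slopeSq ξ * (1 + 4 * δ)} : Set (ConeSpace d)).indicator
          (fun ξ => ENNReal.ofReal (24 * K ^ 2) * ‖h τ ξ‖ₑ ^ 2) ξ =
        -- With ξ fixed, the constraint τ ≤ r(1+4δ) and the truncated power (τ-r)_+ confine τ to the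
        -- short interval of the fibre estimate.
        ∫⁻ ξ, ∫⁻ τ in Ioi (0 : ℝ), G τ ξ := by
      rw [← lintegral_lintegral_swap hGm.aemeasurable]
      exact lintegral_congr fun τ => (lintegral_const_mul' _ _ ENNReal.ofReal_ne_top).symm
    have h3 : ∀ ξ, ∫⁻ τ in Ioi (0 : ℝ), G τ ξ ≤
        ENNReal.ofReal (24 * K ^ 2) * (ENNReal.ofReal (M ^ 2) * ‖F ξ‖ₑ ^ 2) *
          ENNReal.ofReal (D * δ ^ (2 * μ - 1)) := by
      intro ξ
      refine le_trans ?_ (mul_le_mul' le_rfl (lintegral_fibre_le (slopeSq_nonneg ξ) hδ hδ1 hμ))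
      rw [← lintegral_const_mul _ (by fun_prop (disch := exact measurableSet_Iic))]
      refine lintegral_mono fun τ => ?_
      simp only [hG]
      by_cases hτ : τ ≤ slopeSq ξ * (1 + 4 * δ)
      swap
      · rw [indicator_of_notMem (by exact hτ), mul_zero]
        exact bot_le
      rw [indicator_of_mem (by exact hτ), indicator_of_mem (by exact hτ)]
      have h4 : ‖h τ ξ‖ₑ ^ 2 ≤ ENNReal.ofReal (M ^ 2) *
          (ENNReal.ofReal (truncPow (τ - slopeSq ξ) (2 * (μ - 1))) * ‖F ξ‖ₑ ^ 2) := by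
        refine (enorm_mul_sq_le (hM _)).trans_eq ?_
        rw [enorm_mul, mul_pow, ← ofReal_norm (_ : ℂ), Complex.norm_real,
          Real.norm_of_nonneg (truncPow_nonneg _ _), ← ENNReal.ofReal_pow (truncPow_nonneg _ _),
          truncPow_sq]
      refine (mul_le_mul' le_rfl (mul_le_mul' le_rfl h4)).trans_eq ?_
      ring
    calc _ ≤ ENNReal.ofReal (A * B * δ ^ q) * ∫⁻ ξ,
          ENNReal.ofReal (24 * K ^ 2) * (ENNReal.ofReal (M ^ 2) * ‖F ξ‖ₑ ^ 2) *
          ENNReal.ofReal (D * δ ^ (2 * μ - 1)) :=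
          mul_le_mul' le_rfl ((h1.trans_eq h2).trans (lintegral_mono h3))
      _ = ENNReal.ofReal (A * B * δ ^ q) * (ENNReal.ofReal (24 * K ^ 2) *
          (ENNReal.ofReal (M ^ 2) * E) * ENNReal.ofReal (D * δ ^ (2 * μ - 1))) := by
          rw [lintegral_mul_const' _ _ ENNReal.ofReal_ne_top,
            lintegral_const_mul' _ _ ENNReal.ofReal_ne_top,
            lintegral_const_mul' _ _ ENNReal.ofReal_ne_top]
      _ = ENNReal.ofReal (A * B * δ ^ q) * ENNReal.ofReal (24 * K ^ 2) * ENNReal.ofReal (M ^ 2) *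
          ENNReal.ofReal (D * δ ^ (2 * μ - 1)) * E := by ring
      _ = _ := by
          rw [← ENNReal.ofReal_mul (by positivity), ← ENNReal.ofReal_mul (by positivity),
            ← ENNReal.ofReal_mul (by positivity)]
          congr 2
          rw [show 2 * μ + 2 * ν - 1 / 2 = q + (2 * μ - 1) by rw [hq]; ring, Real.rpow_add hδ q]
          generalize δ ^ q = y, δ ^ (2 * μ - 1) = z
          ring

/-! ### Assembly of the square function bound and conclusion -/

theorem lintegral_localizedCone_le {φ ψ : ℝ → ℂ} (j : ℕ) (μ ν R : ℝ) (f : ConeL2 d)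
    (x : ConeSpace d) :
    ∫⁻ t in Ioc (0 : ℝ) (√((2 : ℝ) ^ (1 - (j : ℝ)))),
        ‖localizedCone φ ψ j μ R t f x * ((t ^ (2 * ν + 1) : ℝ) : ℂ)‖ₑ ^ 2 ≤
      (∫⁻ t in Ioc 0 (√((2 : ℝ) ^ j)⁻¹ / 2), ENNReal.ofReal (t ^ (4 * ν + 2)) *
        ‖invFT (squareMult φ ψ ((2 : ℝ) ^ j)⁻¹ μ (R ^ 2) t (𝓕 f : ConeL2 d)) x‖ₑ ^ 2) +
      ∫⁻ t in Ioc (√((2 : ℝ) ^ j)⁻¹ / 2) √(2 * ((2 : ℝ) ^ j)⁻¹), ENNReal.ofReal (t ^ (4 * ν + 2)) *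
        ‖invFT (squareMult φ ψ ((2 : ℝ) ^ j)⁻¹ μ (R ^ 2) t (𝓕 f : ConeL2 d)) x‖ₑ ^ 2 := by
  have e : (2 : ℝ) ^ (1 - (j : ℝ)) = 2 * ((2 : ℝ) ^ j)⁻¹ := by
    rw [Real.rpow_sub two_pos, Real.rpow_one, Real.rpow_natCast, div_eq_mul_inv]
  rw [e]
  have hpt : ∀ t ∈ Ioc (0 : ℝ) √(2 * ((2 : ℝ) ^ j)⁻¹),
      ‖localizedCone φ ψ j μ R t f x * ((t ^ (2 * ν + 1) : ℝ) : ℂ)‖ₑ ^ 2 =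
      ENNReal.ofReal (t ^ (4 * ν + 2)) *
        ‖invFT (squareMult φ ψ ((2 : ℝ) ^ j)⁻¹ μ (R ^ 2) t (𝓕 f : ConeL2 d)) x‖ₑ ^ 2 := by
    intro t ht
    have htp : 0 ≤ t ^ (2 * ν + 1) := Real.rpow_nonneg ht.1.le _
    rw [localizedCone_eq, enorm_mul, mul_pow, mul_comm, ← ofReal_norm ((_ : ℝ) : ℂ),
      Complex.norm_real, Real.norm_of_nonneg htp, ← ENNReal.ofReal_pow htp, ← Real.rpow_two,
      ← Real.rpow_mul ht.1.le, show (2 * ν + 1) * 2 = 4 * ν + 2 by ring]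
  rw [setLIntegral_congr_fun measurableSet_Ioc hpt]
  refine (lintegral_mono_set ?_).trans (lintegral_union_le _ _ _)
  intro t ht
  rcases le_or_gt t (√((2 : ℝ) ^ j)⁻¹ / 2) with h | h
  · exact Or.inl ⟨ht.1, h⟩
  · exact Or.inr ⟨h, ht.2⟩

theorem exists_maximalSquare_bound {φ ψ : ℝ → ℂ} (hφ : IsConeCutoff φ) (hψ : IsConeCutoff ψ)
    {μ ν : ℝ} (hμ : 1 / 2 < μ) (hν : -(3 / 4) < ν) :
    ∃ C : ℝ≥0, ∀ j : ℕ, 2 ≤ j → ∀ f : ConeL2 d,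
      eLpNorm (maximalSquare φ ψ j μ ν f) 2 volume ≤
        C * ENNReal.ofReal ((2 : ℝ) ^ ((j : ℝ) / 4) * (2 : ℝ) ^ (-((j : ℝ) * (μ + ν)))) * ‖f‖ₑ := by
  obtain ⟨C₁, hC₁⟩ := exists_majorant_small (d := d) hφ hψ μ hν
  obtain ⟨C₂, hC₂⟩ := exists_majorant_large (d := d) hφ hψ hμ ν
  refine ⟨NNReal.sqrt (C₁.toNNReal + C₂.toNNReal), fun j hj f => ?_⟩
  set F : ConeSpace d → ℂ := ⇑(𝓕 f : ConeL2 d) with hF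
  have hFL : MemLp F 2 := Lp.memLp _
  have hFm : Measurable F := (Lp.stronglyMeasurable _).measurable
  set δ : ℝ := ((2 : ℝ) ^ j)⁻¹ with hδ
  have hδ0 : 0 < δ := by positivity
  have hδ1 : δ ≤ 1 / 4 := by
    rw [hδ, one_div]
    refine inv_anti₀ (by norm_num) ?_
    calc (4 : ℝ) = 2 ^ 2 := by norm_num
      _ ≤ 2 ^ j := pow_le_pow_right₀ one_le_two hj
  obtain ⟨H₁, hm₁, hp₁, hi₁⟩ := hC₁ δ hδ0 hδ1 F hFL hFm
  obtain ⟨H₂, hm₂, hp₂, hi₂⟩ := hC₂ δ hδ0 hδ1 F hFL hFm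
  set w : ℝ := (2 : ℝ) ^ ((j : ℝ) / 4) * (2 : ℝ) ^ (-((j : ℝ) * (μ + ν))) with hw
  have hw0 : 0 ≤ w := by positivity
  -- With δ = 2^{-j}, both majorants carry exactly the square of the claimed factor 2^{j/4}
  -- 2^{-j(μ+ν)}.
  have hδw : δ ^ (2 * μ + 2 * ν - 1 / 2) = w ^ 2 := by
    rw [hw, hδ, ← Real.rpow_add two_pos, ← Real.rpow_natCast, ← Real.rpow_neg two_pos.le,
      ← Real.rpow_mul two_pos.le, ← Real.rpow_natCast, ← Real.rpow_mul two_pos.le]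
    congr 1
    push_cast
    ring
  have hpt : ∀ x, maximalSquare φ ψ j μ ν f x ^ 2 ≤ H₁ x + H₂ x := by
    intro x
    rw [← ENNReal.rpow_half_sq (H₁ x + H₂ x)]
    refine pow_le_pow_left' (iSup₂_le fun R hR => ENNReal.rpow_le_rpow ?_ (by norm_num)) 2
    have hR2 : 0 < R ^ 2 := pow_pos (mem_Ioi.1 hR) 2
    exact (lintegral_localizedCone_le j μ ν R f x).trans
      (add_le_add (hp₁ _ hR2 x) (hp₂ _ hR2 x))
  have hsum : ∫⁻ x, maximalSquare φ ψ j μ ν f x ^ 2 ≤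
      ((C₁.toNNReal + C₂.toNNReal : ℝ≥0) : ℝ≥0∞) * (ENNReal.ofReal w ^ 2 * ‖f‖ₑ ^ 2) := by
    refine (lintegral_mono hpt).trans ?_
    rw [lintegral_add_left hm₁, ENNReal.coe_add, add_mul, ← lintegral_fourier_sq f, ← mul_assoc,
      ← mul_assoc, ← ENNReal.ofReal_pow hw0, ← hδw]
    have hδp : 0 ≤ δ ^ (2 * μ + 2 * ν - 1 / 2) := by positivity
    rw [ENNReal.ofReal_mul' hδp] at hi₁ hi₂
    exact add_le_add hi₁ hi₂
  rw [eLpNorm_two_enn]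
  refine (ENNReal.rpow_le_rpow hsum (by norm_num)).trans_eq ?_
  rw [ENNReal.mul_rpow_of_nonneg _ _ (by norm_num), ← mul_pow, ENNReal.sq_rpow_half, mul_assoc]
  congr 1
  rw [NNReal.sqrt_eq_rpow, ENNReal.coe_rpow_of_nonneg _ (by norm_num)]

end
theorem mainTheorem6 (d : ℕ) (hd : 3 ≤ d + 1) (φ : ℝ → ℂ) (hφ : IsConeCutoff φ) :
    (∀ lam : ℝ, 0 < lam → ∃ C : ℝ≥0, ∀ f g : ConeL2 d,
      AEMeasurable (maximalBilinearCone φ lam f g) volume ∧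
      eLpNorm (maximalBilinearCone φ lam f g) 1 volume ≤ C * ‖f‖ₑ * ‖g‖ₑ) ∧
    (∀ ν : ℝ, -(1 / 2) < ν → ∃ C : ℝ≥0, ∀ j : ℕ, 2 ≤ j → ∀ f : ConeL2 d,
      AEMeasurable (averagedMaximal φ ν j f) volume ∧
      eLpNorm (averagedMaximal φ ν j f) 2 volume ≤ C * ‖f‖ₑ) ∧
    (∀ ψ : ℝ → ℂ, IsConeCutoff ψ → ∀ μ ν : ℝ, 1 / 2 < μ → -(3 / 4) < ν →
      ∃ C : ℝ≥0, ∀ j : ℕ, 2 ≤ j → ∀ f : ConeL2 d,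
        AEMeasurable (maximalSquare φ ψ j μ ν f) volume ∧
        eLpNorm (maximalSquare φ ψ j μ ν f) 2 volume ≤
          C * ENNReal.ofReal ((2 : ℝ) ^ ((j : ℝ) / 4) * (2 : ℝ) ^ (-((j : ℝ) * (μ + ν)))) * ‖f‖ₑ) := by
  refine ⟨fun lam hlam => ?_, fun ν hν => ?_, fun ψ hψ μ ν hμ hν => ?_⟩
  · obtain ⟨C, hC⟩ := exists_maximalBilinearCone_bound (d := d) hφ hlam
    exact ⟨C, fun f g => ⟨(measurable_maximalBilinearCone hφ hlam f g).aemeasurable, hC f g⟩⟩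
  · obtain ⟨C, hC⟩ := exists_averagedMaximal_bound (d := d) hφ hν
    exact ⟨C, fun j _ f => ⟨(measurable_averagedMaximal hφ ν j f).aemeasurable, hC j f⟩⟩
  · obtain ⟨C, hC⟩ := exists_maximalSquare_bound (d := d) hφ hψ hμ hν
    exact ⟨C, fun j hj f => ⟨(measurable_maximalSquare hφ hψ j μ ν f).aemeasurable, hC j hj f⟩⟩
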